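/- Let $d\ge 3$. For $\sigma>0$ let $(Y_x)_{x\in\mathbb{Z}^d}$ be independent random vectors in $\mathbb{R}^d$, each with the Gaussian law $N_d(0,\sigma^2 I)$, and consider the random point sets $$\Pi=\{x+Y_x : x\in\mathbb{Z}^d\},\qquad \Pi_0=\{x+Y_x : x\in\mathbb{Z}^d\setminus\{0\}\}.$$ The law of a random point set is taken on the $\sigma$-algebra generated by the numbers of points in Borel sets; absolute continuity and singularity of random point sets refer to their laws. A $\Pi$-point is an $\mathbb{R}^d$-valued random variable $Z$ with $Z\in\Pi$ almost surely. The process $\Pi$ is *deletion tolerant* if for every $\Pi$-point $Z$ the process $\Pi\setminus\{Z\}$ is absolutely continuous with respect to $\Pi$; it is *deletion singular* if for every $\Pi$-point $Z$ the processes $\Pi$ and $\Pi\setminus\{Z\}$ are mutually singular. It is *rigid* if for every ball $B\subset\mathbb{R}^d$ there is a measurable function $N_B$ of point configurations such that $N_B(\Pi\cap B^c)=|\Pi\cap B|$ almost surely, and *non-rigid* otherwise. There exist finite critical values $0<\sigma_r(d)\le\sigma_c(d)<\infty$, depending only on $d$, such that 1. if $\sigma>\sigma_c(d)$, then $\Pi$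 is deletion tolerant, and $\Pi$ and $\Pi_0$ are mutually absolutely continuous; 2. if $0<\sigma<\sigma_c(d)$, then $\Pi$ is deletion singular; 3. if $0<\sigma<\sigma_r(d)$, then $\Pi$ is rigid; 4. if $\sigma>\sigma_r(d)$, then $\Pi$ is non-rigid. -/

import Mathlib

open MeasureTheory ProbabilityTheory

/-- A point configuration in `ℝ^d`: a set of points.  (This is a wrapper around `Set`, so that
it can carry the counting σ-algebra below and not the product σ-algebra that `Set` has.) -/
@[ext]
structure PointConfig (d : ℕ) where
  /-- The points of the configuration. -/
  pts : Set (EuclideanSpace ℝ (Fin d))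

namespace PointConfig

variable {d : ℕ}

/-- The number `|A ∩ B|` of points of the configuration `A` in the set `B`. -/
noncomputable def count (A : PointConfig d) (B : Set (EuclideanSpace ℝ (Fin d))) : ℕ∞ :=
  (A.pts ∩ B).encard

/-- The usual σ-algebra on point configurations: the smallest one that makes all the counts
`A ↦ |A ∩ B|`, with `B` a Borel set, measurable. -/
noncomputable instance instMeasurableSpace : MeasurableSpace (PointConfig d) :=
  ⨆ (B : Set (EuclideanSpace ℝ (Fin d))) (_ : MeasurableSet B),
    MeasurableSpace.comap (fun A : PointConfig d => A.count B) inferInstance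

/-- The part `A ∩ Bᶜ` of the configuration `A` outside `B`. -/
def outside (A : PointConfig d) (B : Set (EuclideanSpace ℝ (Fin d))) : PointConfig d :=
  ⟨A.pts ∩ Bᶜ⟩

/-- The configuration `A \ {z}`. -/
def erase (A : PointConfig d) (z : EuclideanSpace ℝ (Fin d)) : PointConfig d :=
  ⟨A.pts \ {z}⟩

end PointConfig

section PointProcess

variable {d : ℕ} {Ω : Type*} [MeasurableSpace Ω]

/-- `Z` is a `Π`-point: an `ℝ^d`-valued random variable with `Z ∈ Π` almost surely. -/
def IsPointOf (P : Measure Ω) (Pi : Ω → PointConfig d)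
    (Z : Ω → EuclideanSpace ℝ (Fin d)) : Prop :=
  Measurable Z ∧ ∀ᵐ ω ∂P, Z ω ∈ (Pi ω).pts

/-- `Π` is deletion tolerant: for every `Π`-point `Z`, the law of `Π \ Z` is absolutely
continuous with respect to the law of `Π`. -/
def DeletionTolerant (P : Measure Ω) (Pi : Ω → PointConfig d) : Prop :=
  ∀ Z : Ω → EuclideanSpace ℝ (Fin d), IsPointOf P Pi Z →
    P.map (fun ω => (Pi ω).erase (Z ω)) ≪ P.map Pi

/-- `Π` is deletion singular: for every `Π`-point `Z`, the laws of `Π` and `Π \ Z` are mutually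
singular. -/
def DeletionSingular (P : Measure Ω) (Pi : Ω → PointConfig d) : Prop :=
  ∀ Z : Ω → EuclideanSpace ℝ (Fin d), IsPointOf P Pi Z →
    P.map Pi ⟂ₘ P.map (fun ω => (Pi ω).erase (Z ω))

/-- `Π` is rigid: for every ball `B` there is a measurable function `N` of point configurations
with `N (Π ∩ Bᶜ) = |Π ∩ B|` almost surely. -/
def Rigid (P : Measure Ω) (Pi : Ω → PointConfig d) : Prop :=
  ∀ (c : EuclideanSpace ℝ (Fin d)) (r : ℝ), 0 < r →
    ∃ N : PointConfig d → ℕ∞, Measurable N ∧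
      ∀ᵐ ω ∂P, N ((Pi ω).outside (Metric.ball c r)) = (Pi ω).count (Metric.ball c r)

end PointProcess

section PerturbedLattice

variable {d : ℕ} {Ω : Type*}

/-- The lattice point `x ∈ ℤ^d` as a point of `ℝ^d`. -/
noncomputable def latticePoint (x : Fin d → ℤ) : EuclideanSpace ℝ (Fin d) :=
  WithLp.toLp 2 (fun i => (x i : ℝ))

/-- The perturbed lattice with the lattice points in `S` left out,
`Π_S = {x + Y_x : x ∈ ℤ^d \ S}`. -/
def perturbedLatticeWithout (S : Set (Fin d → ℤ))
    (Y : (Fin d → ℤ) → Ω → EuclideanSpace ℝ (Fin d)) (ω : Ω) : PointConfig d :=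
  ⟨{p | ∃ x : Fin d → ℤ, x ∉ S ∧ latticePoint x + Y x ω = p}⟩

/-- The perturbed lattice `Π = {x + Y_x : x ∈ ℤ^d}`. -/
def perturbedLattice (Y : (Fin d → ℤ) → Ω → EuclideanSpace ℝ (Fin d)) (ω : Ω) :
    PointConfig d :=
  perturbedLatticeWithout ∅ Y ω

/-- The family `Y` consists of independent random vectors with law `N_d(0, σ² I)`. -/
structure IsIIDGaussian [MeasurableSpace Ω] (P : Measure Ω) (σ : ℝ)
    (Y : (Fin d → ℤ) → Ω → EuclideanSpace ℝ (Fin d)) : Prop where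
  measurable : ∀ x, Measurable (Y x)
  indep : iIndepFun Y P
  law : ∀ x, P.map (Y x) = multivariateGaussian 0 (σ ^ 2 • (1 : Matrix (Fin d) (Fin d) ℝ))

end PerturbedLattice

/-! The random configurations above are measurable, so that their laws are the true image
measures. -/

theorem measurable_encard_of_countable {d : ℕ} {Ω ι : Type*} [MeasurableSpace Ω] [Countable ι]
    (f : ι → Ω → EuclideanSpace ℝ (Fin d)) (hf : ∀ i, Measurable (f i))
    (D : ι → Set Ω) (hD : ∀ i, MeasurableSet (D i)) :
    Measurable (fun ω => {p | ∃ i, ω ∈ D i ∧ f i ω = p}.encard) := by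
  have key : ∀ n : ℕ, MeasurableSet {ω | (n : ℕ∞) ≤ {p | ∃ i, ω ∈ D i ∧ f i ω = p}.encard} := by
    intro n
    have h : {ω | (n : ℕ∞) ≤ {p | ∃ i, ω ∈ D i ∧ f i ω = p}.encard} =
        ⋃ (s : Finset ι) (_ : s.card = n), ⋂ i ∈ s,
          (D i ∩ ⋂ j ∈ s, {ω | i ≠ j → f i ω ≠ f j ω}) := by
      ext ω
      simp only [Set.mem_ofPred_eq, Set.mem_iUnion, Set.mem_iInter, Set.mem_inter_iff]
      constructor
      · intro hn
        obtain ⟨t, ht, htn⟩ := Set.exists_subset_encard_eq hn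
        have htf : t.Finite := Set.finite_of_encard_eq_coe htn
        have hch : ∀ p : t, ∃ i, ω ∈ D i ∧ f i ω = p := fun p => ht p.2
        choose g hg using hch
        classical
        have := htf.fintype
        have hgi : Function.Injective g := by
          intro p q hpq
          apply Subtype.ext
          rw [← (hg p).2, ← (hg q).2, hpq]
        refine ⟨Finset.univ.image g, ?_, ?_⟩
        · rw [Finset.card_image_of_injective _ hgi, Finset.card_univ]
          have := Set.encard_eq_coe_toFinset_card t
          rw [htn, Set.toFinset_card] at this
          exact_mod_cast this.symm
        · intro i hi
          simp only [Finset.mem_image, Finset.mem_univ, true_and] at hi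
          obtain ⟨p, rfl⟩ := hi
          refine ⟨(hg p).1, ?_⟩
          intro j hj hne
          simp only [Finset.mem_image, Finset.mem_univ, true_and] at hj
          obtain ⟨q, rfl⟩ := hj
          rw [(hg p).2, (hg q).2]
          intro h
          exact hne (congrArg g (Subtype.ext h))
      · rintro ⟨s, rfl, hs⟩
        have hinj : Set.InjOn (fun i => f i ω) (s : Set ι) := by
          intro i hi j hj hij
          by_contra hne
          exact (hs i hi).2 j hj hne hij
        rw [← Set.encard_coe_eq_coe_finsetCard, ← hinj.encard_image]
        apply Set.encard_le_encard
        rintro p ⟨i, hi, rfl⟩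
        exact ⟨i, (hs i hi).1, rfl⟩
    rw [h]
    refine MeasurableSet.iUnion fun s => MeasurableSet.iUnion fun _ =>
      Finset.measurableSet_biInter s fun i _ => (hD i).inter
        (Finset.measurableSet_biInter s fun j _ => ?_)
    by_cases hij : i = j
    · simp [hij]
    · have h2 : {ω | i ≠ j → f i ω ≠ f j ω} = {ω | f i ω = f j ω}ᶜ := by
        ext ω
        simp [hij]
      rw [h2]
      exact (measurableSet_eq_fun (hf i) (hf j)).compl
  refine measurable_to_countable' fun a => ?_
  induction a using ENat.recTopCoe with
  | coe n =>
    have h : (fun ω => {p | ∃ i, ω ∈ D i ∧ f i ω = p}.encard) ⁻¹' {(n : ℕ∞)} =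
        {ω | (n : ℕ∞) ≤ {p | ∃ i, ω ∈ D i ∧ f i ω = p}.encard} \
          {ω | ((n + 1 : ℕ) : ℕ∞) ≤ {p | ∃ i, ω ∈ D i ∧ f i ω = p}.encard} := by
      ext ω
      simp only [Set.mem_preimage, Set.mem_singleton_iff, Set.mem_sdiff, Set.mem_ofPred_eq]
      generalize {p | ∃ i, ω ∈ D i ∧ f i ω = p}.encard = c
      induction c using ENat.recTopCoe with
      | coe m =>
        norm_cast
        omega
      | top => simp
    rw [h]
    exact (key n).diff (key (n + 1))
  | top =>
    have h : (fun ω => {p | ∃ i, ω ∈ D i ∧ f i ω = p}.encard) ⁻¹' {⊤} =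
        ⋂ n : ℕ, {ω | (n : ℕ∞) ≤ {p | ∃ i, ω ∈ D i ∧ f i ω = p}.encard} := by
      ext ω
      simp only [Set.mem_preimage, Set.mem_singleton_iff, Set.mem_iInter, Set.mem_ofPred_eq]
      exact ENat.eq_top_iff_forall_ge
    rw [h]
    exact MeasurableSet.iInter key

theorem PointConfig.measurable_iff {d : ℕ} {Ω : Type*} [MeasurableSpace Ω]
    (Pi : Ω → PointConfig d) :
    Measurable Pi ↔ ∀ B, MeasurableSet B → Measurable (fun ω => (Pi ω).count B) := by
  simp only [measurable_iff_comap_le, PointConfig.instMeasurableSpace, MeasurableSpace.comap_iSup,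
    iSup_le_iff, MeasurableSpace.comap_comp]
  rfl

theorem measurable_perturbedLatticeWithout {d : ℕ} {Ω : Type*} [MeasurableSpace Ω]
    (S : Set (Fin d → ℤ)) (Y : (Fin d → ℤ) → Ω → EuclideanSpace ℝ (Fin d))
    (hY : ∀ x, Measurable (Y x)) : Measurable (perturbedLatticeWithout S Y) := by
  rw [PointConfig.measurable_iff]
  intro B hB
  have hm : ∀ x, Measurable (fun ω => latticePoint x + Y x ω) := fun x => (hY x).const_add _
  convert measurable_encard_of_countable (fun x ω => latticePoint x + Y x ω) hm
    (fun x => {ω | x ∉ S} ∩ (fun ω => latticePoint x + Y x ω) ⁻¹' B)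
    (fun x => (MeasurableSet.const _).inter (hm x hB)) using 2 with ω
  unfold PointConfig.count perturbedLatticeWithout
  congr 1
  ext p
  constructor
  · rintro ⟨⟨x, hx, rfl⟩, hp⟩
    exact ⟨x, ⟨hx, hp⟩, rfl⟩
  · rintro ⟨x, ⟨hx, hp⟩, rfl⟩
    exact ⟨⟨x, hx, rfl⟩, hp⟩

theorem measurable_perturbedLattice_erase {d : ℕ} {Ω : Type*} [MeasurableSpace Ω]
    (Y : (Fin d → ℤ) → Ω → EuclideanSpace ℝ (Fin d)) (hY : ∀ x, Measurable (Y x))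
    (Z : Ω → EuclideanSpace ℝ (Fin d)) (hZ : Measurable Z) :
    Measurable (fun ω => (perturbedLattice Y ω).erase (Z ω)) := by
  rw [PointConfig.measurable_iff]
  intro B hB
  have hm : ∀ x, Measurable (fun ω => latticePoint x + Y x ω) := fun x => (hY x).const_add _
  convert measurable_encard_of_countable (fun x ω => latticePoint x + Y x ω) hm
    (fun x => {ω | latticePoint x + Y x ω = Z ω}ᶜ ∩ (fun ω => latticePoint x + Y x ω) ⁻¹' B)
    (fun x => (measurableSet_eq_fun (hm x) hZ).compl.inter (hm x hB)) using 2 with ω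
  unfold PointConfig.count perturbedLattice perturbedLatticeWithout PointConfig.erase
  congr 1
  ext p
  constructor
  · rintro ⟨⟨⟨x, hx, rfl⟩, hp'⟩, hp⟩
    exact ⟨x, ⟨hp', hp⟩, rfl⟩
  · rintro ⟨x, ⟨hx, hp⟩, rfl⟩
    exact ⟨⟨⟨x, Set.notMem_empty _, rfl⟩, hx⟩, hp⟩

open scoped ENNReal

/-! ### Resampling in product measures and a zero-one law -/

section ProductMeasure

variable {I X : Type*} [MeasurableSpace X]

/-- Two independent families form a single product over `Bool × I`; operations that mix the families
then become reindexings. -/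
theorem infinitePi_prod_eq_map (μ ν : I → Measure X) [∀ i, IsProbabilityMeasure (μ i)]
    [∀ i, IsProbabilityMeasure (ν i)] :
    (Measure.infinitePi μ).prod (Measure.infinitePi ν) =
      (Measure.infinitePi (fun p : Bool × I => (if p.1 then ν else μ) p.2)).map
        (fun ω => (fun i => ω (false, i), fun i => ω (true, i))) := by
  have hP : ∀ (b : Bool) (i : I), IsProbabilityMeasure ((if b then ν else μ) i) := by
    intro b i
    cases b <;> simp <;> infer_instance
  have h1 := Measure.infinitePi_map_curry (fun (b : Bool) (i : I) => (if b then ν else μ) i)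
  have h2 := Measure.infinitePi_map_eval_prod
    (P := fun b : Bool => Measure.infinitePi (fun i : I => (if b then ν else μ) i))
    (i := false) (j := true) (by simp)
  rw [← h1, Measure.map_map (by fun_prop) (by fun_prop)] at h2
  simp only [Bool.false_eq_true, if_false, if_true] at h2
  rw [← h2]
  rfl

/-- Exchanging the two copies on `s` is an injective reindexing of `Bool × I` that respects the
factors. -/
theorem map_piecewise_infinitePi_prod (μ : I → Measure X) [∀ i, IsProbabilityMeasure (μ i)] (s : Set I)
    [DecidablePred (· ∈ s)] :
    ((Measure.infinitePi μ).prod (Measure.infinitePi μ)).map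
      (fun p => (s.piecewise p.2 p.1, s.piecewise p.1 p.2)) =
      (Measure.infinitePi μ).prod (Measure.infinitePi μ) := by
  have h := infinitePi_prod_eq_map μ μ
  simp only [ite_self] at h
  have hm : Measurable (fun p : (I → X) × (I → X) =>
      (s.piecewise p.2 p.1, s.piecewise p.1 p.2)) := by
    refine Measurable.prodMk (measurable_pi_lambda _ fun i => ?_)
      (measurable_pi_lambda _ fun i => ?_) <;>
    · by_cases hi : i ∈ s <;> simp [Set.piecewise, hi] <;> fun_prop
  let f : Bool × I → Bool × I := fun p => (if p.2 ∈ s then !p.1 else p.1, p.2)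
  have hf : Function.Injective f := by
    rintro ⟨b, i⟩ ⟨b', i'⟩ h
    simp only [f, Prod.mk.injEq] at h
    obtain ⟨h1, rfl⟩ := h
    by_cases hi : i ∈ s <;> simp_all
  have h2 : (Measure.infinitePi (fun p : Bool × I => μ p.2)).map (fun ω i => ω (f i)) =
      Measure.infinitePi (fun p : Bool × I => μ p.2) :=
    Measure.map_infinitePi_infinitePi_of_inj (P := fun p : Bool × I => μ p.2) hf
  rw [h, Measure.map_map hm (by fun_prop)]
  conv_rhs => rw [← h2, Measure.map_map (by fun_prop) (by fun_prop)]
  congr 1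
  funext ω
  simp only [Function.comp, f, Prod.mk.injEq]
  constructor <;> funext i <;> by_cases hi : i ∈ s <;> simp [hi]

theorem measurePreserving_piecewise_infinitePi_prod (μ : I → Measure X) [∀ i, IsProbabilityMeasure (μ i)]
    (s : Set I) [DecidablePred (· ∈ s)] :
    MeasurePreserving (fun p : (I → X) × (I → X) => (s.piecewise p.2 p.1, s.piecewise p.1 p.2))
      ((Measure.infinitePi μ).prod (Measure.infinitePi μ))
      ((Measure.infinitePi μ).prod (Measure.infinitePi μ)) := by
  refine ⟨?_, map_piecewise_infinitePi_prod μ s⟩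
  refine Measurable.prodMk (measurable_pi_lambda _ fun i => ?_)
    (measurable_pi_lambda _ fun i => ?_) <;>
  · by_cases hi : i ∈ s <;> simp [Set.piecewise, hi] <;> fun_prop

theorem map_eval_infinitePi_prod (μ : I → Measure X) [∀ i, IsProbabilityMeasure (μ i)] (x : I) :
    ((Measure.infinitePi μ).prod (Measure.infinitePi μ)).map
      (fun p => (p.1, p.2 x)) = (Measure.infinitePi μ).prod (μ x) := by
  have := Measure.map_prod_map (Measure.infinitePi μ)
    (Measure.infinitePi μ) (f := id) (g := fun y => y x) measurable_id (by fun_prop)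
  rw [Measure.map_id, Measure.infinitePi_map_eval] at this
  rw [this]
  rfl

theorem map_update_infinitePi_prod [DecidableEq I] (μ : I → Measure X) [∀ i, IsProbabilityMeasure (μ i)]
    (x : I) :
    ((Measure.infinitePi μ).prod (μ x)).map (fun p => Function.update p.1 x p.2) =
      Measure.infinitePi μ := by
  have h := map_piecewise_infinitePi_prod μ ({x} : Set I)
  have h' := congrArg (Measure.map Prod.fst) h
  have hm : Measurable (fun p : (I → X) × (I → X) =>
      (({x} : Set I).piecewise p.2 p.1, ({x} : Set I).piecewise p.1 p.2)) := by
    refine Measurable.prodMk (measurable_pi_lambda _ fun i => ?_)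
      (measurable_pi_lambda _ fun i => ?_) <;>
    · by_cases hi : i = x <;> simp [Set.piecewise, hi] <;> fun_prop
  have hu : Measurable (fun p : (I → X) × X => Function.update p.1 x p.2) := by
    refine measurable_pi_lambda _ fun i => ?_
    by_cases hi : i = x
    · subst hi; simpa using measurable_snd
    · simp [hi]; fun_prop
  rw [Measure.map_map measurable_fst hm, Measure.map_fst_prod, measure_univ, one_smul] at h'
  rw [← map_eval_infinitePi_prod μ x, Measure.map_map hu (by fun_prop)]
  conv_rhs => rw [← h']
  congr 1
  funext p
  funext i
  by_cases hi : i = x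
  · subst hi; simp
  · simp [hi]

theorem measurePreserving_update_infinitePi_prod [DecidableEq I] (μ : I → Measure X)
    [∀ i, IsProbabilityMeasure (μ i)] (x : I) :
    MeasurePreserving (fun p : (I → X) × X => Function.update p.1 x p.2)
      ((Measure.infinitePi μ).prod (μ x)) (Measure.infinitePi μ) := by
  refine ⟨measurable_pi_lambda _ fun i => ?_, map_update_infinitePi_prod μ x⟩
  by_cases hi : i = x
  · subst hi; simpa using measurable_snd
  · simp [hi]; fun_prop

/-- Regrouped as pairs over `I`, the two families are summed coordinate by coordinate, and the law
of each sum is a convolution. -/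
theorem map_add_infinitePi_prod [AddMonoid X] [MeasurableAdd₂ X] (μ ν : I → Measure X)
    [∀ i, IsProbabilityMeasure (μ i)] [∀ i, IsProbabilityMeasure (ν i)] :
    ((Measure.infinitePi μ).prod (Measure.infinitePi ν)).map (fun p i => p.1 i + p.2 i) =
      Measure.infinitePi (fun i => (μ i).conv (ν i)) := by
  have hP : ∀ (p : Bool × I), IsProbabilityMeasure ((if p.1 then ν else μ) p.2) := by
    rintro ⟨b, i⟩
    cases b <;> simp <;> infer_instance
  have hP' : ∀ (i : I) (b : Bool), IsProbabilityMeasure ((if b then ν else μ) i) := 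
    fun i b => hP (b, i)
  have hP'' : ∀ (p : I × Bool), IsProbabilityMeasure ((if p.2 then ν else μ) p.1) := 
    fun p => hP (p.2, p.1)
  have h1 := Measure.infinitePi_map_curry (fun (i : I) (b : Bool) => (if b then ν else μ) i)
  have h3 := Measure.map_infinitePi_infinitePi_of_inj
    (P := fun p : Bool × I => (if p.1 then ν else μ) p.2) (Prod.swap_injective (α := I) (β := Bool))
  have h4 := Measure.infinitePi_map_pi
    (fun i : I => Measure.infinitePi (fun b : Bool => (if b then ν else μ) i))
    (f := fun (i : I) (w : Bool → X) => w false + w true) (by fun_prop)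
  have h5 : ∀ i, (Measure.infinitePi (fun b : Bool => (if b then ν else μ) i)).map
      (fun w : Bool → X => w false + w true) = (μ i).conv (ν i) := by
    intro i
    have := Measure.infinitePi_map_eval_prod (P := fun b : Bool => (if b then ν else μ) i)
      (i := false) (j := true) (by simp)
    simp only [Bool.false_eq_true, if_false, if_true] at this
    rw [Measure.conv, ← this, Measure.map_map (by fun_prop) (by fun_prop)]
    rfl
  simp only [Prod.fst_swap, Prod.snd_swap] at h3
  rw [← h1, ← h3, Measure.map_map (by fun_prop) (by fun_prop),
    Measure.map_map (by fun_prop) (by fun_prop)] at h4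
  simp only [h5] at h4
  rw [← h4, infinitePi_prod_eq_map, Measure.map_map (by fun_prop) (by fun_prop)]
  rfl

/-- A zero-one law: an event which almost surely survives the resampling of any single coordinate
has probability zero or one. -/
theorem infinitePi_zero_or_one [DecidableEq I] (g : Measure X) [IsProbabilityMeasure g]
    {D : Set (I → X)} (hD : MeasurableSet D)
    (h : ∀ x, ∀ᵐ p ∂((Measure.infinitePi (fun _ : I => g)).prod g),
      Function.update p.1 x p.2 ∈ D → p.1 ∈ D) :
    Measure.infinitePi (fun _ : I => g) D = 0 ∨ Measure.infinitePi (fun _ : I => g) D = 1 := by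
  set m := Measure.infinitePi (fun _ : I => g) with hm
  -- Both events have the measure of `D`, so the almost sure inclusion is an almost sure equality.
  have h1 : ∀ x, ∀ᵐ p ∂(m.prod g), (Function.update p.1 x p.2 ∈ D ↔ p.1 ∈ D) := by
    intro x
    have hu := measurePreserving_update_infinitePi_prod (fun _ : I => g) x
    have hf : MeasurePreserving (Prod.fst : (I → X) × X → (I → X)) (m.prod g) m :=
      measurePreserving_fst
    have h2 := ae_eq_of_ae_subset_of_measure_ge (μ := m.prod g)
      (s := (fun p : (I → X) × X => Function.update p.1 x p.2) ⁻¹' D) (t := Prod.fst ⁻¹' D)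
      (h x) (by
        rw [hu.measure_preimage hD.nullMeasurableSet, hf.measure_preimage hD.nullMeasurableSet])
      (hu.measurable hD).nullMeasurableSet (measure_ne_top _ _)
    exact h2.mem_iff
  have h2 : ∀ x, ∀ᵐ p ∂(m.prod m), (Function.update p.1 x (p.2 x) ∈ D ↔ p.1 ∈ D) := by
    intro x
    have h3 := h1 x
    rw [hm, ← map_eval_infinitePi_prod (fun _ : I => g) x] at h3
    exact ae_of_ae_map (by fun_prop) h3
  have h3 : ∀ J : Finset I, ∀ᵐ p ∂(m.prod m),
      ((J : Set I).piecewise p.2 p.1 ∈ D ↔ p.1 ∈ D) := by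
    intro J
    induction J using Finset.induction_on with
    | empty =>
      refine Filter.Eventually.of_forall fun p => ?_
      rw [Finset.piecewise_coe, Finset.piecewise_empty]
    | insert x J hx ih =>
      -- The coordinate `x` is resampled after the exchange on `J`; the exchange preserves the
      -- product measure, so `h2` still applies.
      have h4 := (measurePreserving_piecewise_infinitePi_prod (fun _ : I => g)
        (J : Set I)).quasiMeasurePreserving.ae (h2 x)
      filter_upwards [ih, h4] with p hp hq
      rw [← hp, ← hq]
      have : (J : Set I).piecewise p.1 p.2 x = p.2 x := by simp [hx]
      rw [this, Finset.piecewise_coe, Finset.piecewise_coe, ← Finset.piecewise_insert]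
  -- `D` is independent of every cylinder based on a finite `J`: by `h3` its coordinates in `J` may
  -- be replaced by an independent copy. Hence `D` is independent of itself.
  have h4 : m.restrict D = m D • m := by
    refine ext_of_generate_finite _ (generateFrom_squareCylinders (α := fun _ : I => X)).symm
      (isPiSystem_squareCylinders (fun _ => MeasurableSpace.isPiSystem_measurableSet)
        (fun _ => MeasurableSet.univ)) ?_ (by simp)
    rintro s ⟨J, t, ht, rfl⟩
    have hJ : MeasurableSet ((J : Set I).pi t) :=
      MeasurableSet.pi J.countable_toSet fun i _ => ht i (Set.mem_univ _)
    rw [Measure.restrict_apply hJ, Measure.smul_apply, smul_eq_mul, Set.inter_comm,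
      ← Measure.prod_prod]
    rw [← (measurePreserving_piecewise_infinitePi_prod (fun _ : I => g)
        (J : Set I)).measure_preimage (hD.prod hJ).nullMeasurableSet, ← hm]
    have hf : MeasurePreserving (Prod.fst : (I → X) × (I → X) → (I → X)) (m.prod m) m :=
      measurePreserving_fst
    rw [← hf.measure_preimage (hD.inter hJ).nullMeasurableSet]
    refine measure_congr ?_
    filter_upwards [h3 J] with p hp
    refine propext (and_congr hp.symm ?_)
    change (∀ i ∈ (J : Set I), _) ↔ (∀ i ∈ (J : Set I), _)
    refine forall₂_congr fun i hi => ?_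
    simp only [Set.piecewise_eq_of_mem _ _ _ hi]
  have h5 := congrArg (fun μ => μ D) h4
  simp only [Measure.restrict_apply_self, Measure.smul_apply, smul_eq_mul] at h5
  by_cases h0 : m D = 0
  · exact Or.inl h0
  · right
    have := (ENNReal.mul_right_inj h0 (measure_ne_top m D)).1 ((mul_one _).trans h5)
    exact this.symm

end ProductMeasure

/-! ### Separating families of locally finite configurations -/

namespace PointConfig

variable {d : ℕ}

theorem measurable_count {B : Set (EuclideanSpace ℝ (Fin d))} (hB : MeasurableSet B) :
    Measurable (fun A : PointConfig d => A.count B) :=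
  (measurable_iff (fun A : PointConfig d => A)).1 measurable_id B hB

theorem measurable_outside {B : Set (EuclideanSpace ℝ (Fin d))} (hB : MeasurableSet B) :
    Measurable (fun A : PointConfig d => A.outside B) := by
  rw [measurable_iff]
  intro B' hB'
  convert measurable_count (d := d) (hB.compl.inter hB') using 2 with A
  simp only [count, outside, Set.inter_assoc]

/-- The configuration has finitely many points in every ball. -/
def LocallyFinite (A : PointConfig d) : Prop :=
  ∀ n : ℕ, (A.pts ∩ Metric.ball 0 n).Finite

open Classical in
/-- The sets of a countable basis that are hit by the configuration. -/
noncomputable def hits (A : PointConfig d)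
    (b : TopologicalSpace.countableBasis (EuclideanSpace ℝ (Fin d))) : Bool :=
  decide (A.count b ≠ 0)

theorem measurable_hits : Measurable (hits : PointConfig d → _) := by
  refine measurable_pi_lambda _ fun b => measurable_to_bool ?_
  have hb : MeasurableSet (b : Set (EuclideanSpace ℝ (Fin d))) :=
    (TopologicalSpace.isOpen_of_mem_countableBasis b.2).measurableSet
  have : (fun A : PointConfig d => hits A b) ⁻¹' {true} = {A | A.count b = 0}ᶜ := by
    ext A
    simp [hits]
  rw [this]
  exact (measurable_count hb (MeasurableSet.singleton 0)).compl

/-- Around a point of `A` outside `A'` there is an open set without points of `A'`, since `A'` is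
finite in balls; a basis set inside it is hit by `A` only. -/
theorem LocallyFinite.pts_subset_of_hits_eq {A A' : PointConfig d} (hA' : A'.LocallyFinite)
    (h : A.hits = A'.hits) : A.pts ⊆ A'.pts := by
  intro p hp
  by_contra hp'
  obtain ⟨n, hn⟩ := exists_nat_gt ‖p‖
  have hU : IsOpen (Metric.ball 0 n \ (A'.pts ∩ Metric.ball 0 n)) :=
    Metric.isOpen_ball.sdiff (hA' n).isClosed
  have hpU : p ∈ Metric.ball 0 n \ (A'.pts ∩ Metric.ball 0 n) :=
    ⟨by simpa using hn, fun h => hp' h.1⟩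
  obtain ⟨b, hb, hpb, hbU⟩ := (TopologicalSpace.isBasis_countableBasis
    (EuclideanSpace ℝ (Fin d))).exists_subset_of_mem_open hpU hU
  have h1 : A.hits ⟨b, hb⟩ = true := by
    simp only [hits, count, ne_eq, Set.encard_eq_zero, decide_eq_true_eq]
    exact Set.Nonempty.ne_empty ⟨p, hp, hpb⟩
  rw [h] at h1
  simp only [hits, count, ne_eq, Set.encard_eq_zero, decide_eq_true_eq] at h1
  obtain ⟨q, hq, hqb⟩ := Set.nonempty_iff_ne_empty.2 h1
  exact (hbU hqb).2 ⟨hq, (hbU hqb).1⟩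

theorem LocallyFinite.eq_of_hits_eq {A A' : PointConfig d} (hA : A.LocallyFinite)
    (hA' : A'.LocallyFinite) (h : A.hits = A'.hits) : A = A' :=
  PointConfig.ext (Set.Subset.antisymm (hA'.pts_subset_of_hits_eq h)
    (hA.pts_subset_of_hits_eq h.symm))

/-- Two measurable families of locally finite configurations without a common value are
separated by a measurable set of configurations. -/
theorem exists_measurableSet_separating {X X' : Type*} [MeasurableSpace X] [StandardBorelSpace X]
    [MeasurableSpace X'] [StandardBorelSpace X'] {f : X → PointConfig d} (hf : Measurable f)
    {f' : X' → PointConfig d} (hf' : Measurable f') {D : Set X} (hD : MeasurableSet D)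
    {D' : Set X'} (hD' : MeasurableSet D') (hl : ∀ y ∈ D, (f y).LocallyFinite)
    (hl' : ∀ y ∈ D', (f' y).LocallyFinite) (h : ∀ y ∈ D, ∀ y' ∈ D', f y ≠ f' y') :
    ∃ C : Set (PointConfig d), MeasurableSet C ∧ (∀ y ∈ D, f y ∈ C) ∧ ∀ y ∈ D', f' y ∉ C := by
  -- The hit patterns lie in a Polish space of Boolean families, where Lusin separation applies;
  -- local finiteness makes the patterns determine the configurations.
  have h1 : AnalyticSet ((fun y => (f y).hits) '' D) :=
    hD.analyticSet_image (measurable_hits.comp hf)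
  have h2 : AnalyticSet ((fun y => (f' y).hits) '' D') :=
    hD'.analyticSet_image (measurable_hits.comp hf')
  have h3 : Disjoint ((fun y => (f y).hits) '' D) ((fun y => (f' y).hits) '' D') := by
    rw [Set.disjoint_left]
    rintro _ ⟨y, hy, rfl⟩ ⟨y', hy', hyy⟩
    exact h y hy y' hy' ((hl y hy).eq_of_hits_eq (hl' y' hy') hyy.symm)
  obtain ⟨u, hu, hu', hum⟩ := h1.measurablySeparable h2 h3
  refine ⟨hits ⁻¹' u, measurable_hits hum, fun y hy => hu ⟨y, hy, rfl⟩, fun y hy hyu => ?_⟩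
  exact Set.disjoint_left.1 hu' ⟨y, hy, rfl⟩ hyu

end PointConfig

/-! ### Configurations with labelled points -/

section Labels

variable {d : ℕ}

/-- The configuration with points `x + y x`, for `x ∉ S`. -/
def labelConfig (S : Set (Fin d → ℤ)) (y : (Fin d → ℤ) → EuclideanSpace ℝ (Fin d)) :
    PointConfig d :=
  perturbedLatticeWithout S (fun x (y : (Fin d → ℤ) → EuclideanSpace ℝ (Fin d)) => y x) y

theorem mem_labelConfig {S : Set (Fin d → ℤ)} {y : (Fin d → ℤ) → EuclideanSpace ℝ (Fin d)}
    {p : EuclideanSpace ℝ (Fin d)} :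
    p ∈ (labelConfig S y).pts ↔ ∃ x, x ∉ S ∧ latticePoint x + y x = p := Iff.rfl

theorem measurable_labelConfig (S : Set (Fin d → ℤ)) : Measurable (labelConfig S) :=
  measurable_perturbedLatticeWithout S _ fun x => measurable_pi_apply x

/-- The displacements for which the perturbed lattice points are distinct, with finitely many of
them in every ball. -/
def goodLabels (d : ℕ) : Set ((Fin d → ℤ) → EuclideanSpace ℝ (Fin d)) :=
  {y | Function.Injective (fun x => latticePoint x + y x) ∧
    ∀ n : ℕ, {x | latticePoint x + y x ∈ Metric.ball 0 n}.Finite}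

theorem measurable_latticePoint_add (x : Fin d → ℤ) :
    Measurable (fun y : (Fin d → ℤ) → EuclideanSpace ℝ (Fin d) => latticePoint x + y x) :=
  (measurable_pi_apply x).const_add _

theorem measurableSet_goodLabels : MeasurableSet (goodLabels d) := by
  have : goodLabels d = (⋂ (x) (x') (_ : x ≠ x'),
        {y : (Fin d → ℤ) → EuclideanSpace ℝ (Fin d) |
          latticePoint x + y x = latticePoint x' + y x'}ᶜ) ∩
      ⋂ n : ℕ, ⋃ J : Finset (Fin d → ℤ), ⋂ (x) (_ : x ∉ J),
        ((fun y : (Fin d → ℤ) → EuclideanSpace ℝ (Fin d) => latticePoint x + y x) ⁻¹'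
          Metric.ball 0 n)ᶜ := by
    ext y
    simp only [goodLabels, Set.mem_ofPred_eq, Set.mem_inter_iff, Set.mem_iInter, Set.mem_iUnion,
      Set.mem_compl_iff, Set.mem_preimage]
    refine and_congr ⟨fun h x x' hx hxx => hx (h hxx), fun h x x' hxx => ?_⟩
      (forall_congr' fun n => ⟨fun h => ⟨h.toFinset, fun x hx => by simpa using hx⟩,
        fun ⟨J, hJ⟩ => J.finite_toSet.subset fun x hx => ?_⟩)
    · by_contra hne
      exact h x x' hne hxx
    · by_contra hne
      exact hJ x hne hx
  rw [this]
  refine MeasurableSet.inter ?_ ?_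
  · refine MeasurableSet.iInter fun x => MeasurableSet.iInter fun x' =>
      MeasurableSet.iInter fun _ => MeasurableSet.compl ?_
    exact measurableSet_eq_fun (measurable_latticePoint_add x) (measurable_latticePoint_add x')
  · refine MeasurableSet.iInter fun n => MeasurableSet.iUnion fun J => MeasurableSet.iInter fun x =>
      MeasurableSet.iInter fun _ => MeasurableSet.compl ?_
    exact measurable_latticePoint_add x Metric.isOpen_ball.measurableSet

theorem locallyFinite_labelConfig {S : Set (Fin d → ℤ)}
    {y : (Fin d → ℤ) → EuclideanSpace ℝ (Fin d)} (hy : y ∈ goodLabels d) :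
    (labelConfig S y).LocallyFinite := by
  intro n
  refine ((hy.2 n).image (fun x => latticePoint x + y x)).subset ?_
  rintro p ⟨⟨x, _, rfl⟩, hp⟩
  exact ⟨x, hp, rfl⟩

/-- Two labellings of one configuration differ by a bijection of the labels. -/
theorem exists_equiv_of_labelConfig_eq {S T : Set (Fin d → ℤ)}
    {y y' : (Fin d → ℤ) → EuclideanSpace ℝ (Fin d)} (hy : y ∈ goodLabels d)
    (hy' : y' ∈ goodLabels d) (h : labelConfig S y = labelConfig T y') :
    ∃ φ : ↥Sᶜ ≃ ↥Tᶜ, ∀ x : ↥Sᶜ,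
      latticePoint (x : Fin d → ℤ) + y x = latticePoint (φ x : Fin d → ℤ) + y' (φ x) := by
  have h1 : ∀ x : ↥Sᶜ, ∃ x' : ↥Tᶜ, latticePoint (x : Fin d → ℤ) + y x =
      latticePoint (x' : Fin d → ℤ) + y' x' := by
    rintro ⟨x, hx⟩
    have : latticePoint x + y x ∈ (labelConfig T y').pts := h ▸ mem_labelConfig.2 ⟨x, hx, rfl⟩
    obtain ⟨x', hx', hxx⟩ := mem_labelConfig.1 this
    exact ⟨⟨x', hx'⟩, hxx.symm⟩
  have h2 : ∀ x' : ↥Tᶜ, ∃ x : ↥Sᶜ, latticePoint (x : Fin d → ℤ) + y x =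
      latticePoint (x' : Fin d → ℤ) + y' x' := by
    rintro ⟨x, hx⟩
    have : latticePoint x + y' x ∈ (labelConfig S y).pts := h ▸ mem_labelConfig.2 ⟨x, hx, rfl⟩
    obtain ⟨x', hx', hxx⟩ := mem_labelConfig.1 this
    exact ⟨⟨x', hx'⟩, hxx⟩
  choose f hf using h1
  choose f' hf' using h2
  exact ⟨⟨f, f', fun x => Subtype.ext (hy.1 ((hf' (f x)).trans (hf x).symm)),
    fun x => Subtype.ext (hy'.1 ((hf (f' x)).symm.trans (hf' x)))⟩, hf⟩

end Labels

/-! ### Densities of infinite products with finitely many changed factors -/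

section Density

/-- On a box, density times indicator is a product over `J ∪ s`, and independence factorises its
integral. Sites outside `s` contribute total mass one. -/
theorem infinitePi_withDensity {I X : Type*} [MeasurableSpace X] (μ : I → Measure X)
    [∀ i, IsProbabilityMeasure (μ i)] (f : I → X → ℝ≥0∞) (hf : ∀ i, Measurable (f i))
    [∀ i, IsProbabilityMeasure ((μ i).withDensity (f i))] (J : Finset I)
    (hJ : ∀ i ∉ J, f i = 1) :
    Measure.infinitePi (fun i => (μ i).withDensity (f i)) =
      (Measure.infinitePi μ).withDensity (fun y => ∏ i ∈ J, f i (y i)) := by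
  classical
  refine (Measure.eq_infinitePi _ fun s t ht => ?_).symm
  have hst : MeasurableSet ((s : Set I).pi t) :=
    MeasurableSet.pi s.countable_toSet fun i _ => ht i
  rw [withDensity_apply _ hst, ← lintegral_indicator hst]
  let u : I → Set X := fun i => if i ∈ s then t i else Set.univ
  have hu : ∀ i, MeasurableSet (u i) := fun i => by
    by_cases hi : i ∈ s <;> simp [u, hi, ht]
  have h1 : ∀ y : I → X, ((s : Set I).pi t).indicator (fun y => ∏ i ∈ J, f i (y i)) y =
      ∏ i ∈ J ∪ s, (u i).indicator (f i) (y i) := by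
    intro y
    by_cases hy : y ∈ (s : Set I).pi t
    · rw [Set.indicator_of_mem hy]
      have h2 : ∀ i, y i ∈ u i := fun i => by
        by_cases hi : i ∈ s
        · simpa [u, hi] using hy i hi
        · simp [u, hi]
      simp only [Set.indicator_of_mem (h2 _)]
      refine Finset.prod_subset Finset.subset_union_left fun i _ hi => ?_
      rw [hJ i hi]
      rfl
    · rw [Set.indicator_of_notMem hy]
      have : ∃ i ∈ s, y i ∉ t i := by
        by_contra! h
        exact hy fun i hi => h i hi
      obtain ⟨i, hi, hit⟩ := this
      refine (Finset.prod_eq_zero (Finset.mem_union_right _ hi) ?_).symm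
      rw [Set.indicator_of_notMem]
      simpa [u, hi] using hit
  simp only [h1]
  have hm : ∀ i, Measurable ((u i).indicator (f i)) := fun i => (hf i).indicator (hu i)
  rw [lintegral_prod_eq_prod_lintegral_of_indepFun (J ∪ s)
    (fun i (y : I → X) => (u i).indicator (f i) (y i)) (iIndepFun_infinitePi hm)
    (fun i => (hm i).comp (measurable_pi_apply i))]
  have h3 : ∀ i, ∫⁻ y, (u i).indicator (f i) (y i) ∂(Measure.infinitePi μ) =
      (μ i).withDensity (f i) (u i) := by
    intro i
    rw [withDensity_apply _ (hu i), ← lintegral_indicator (hu i), ← Measure.infinitePi_map_eval μ i,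
      lintegral_map (hm i) (measurable_pi_apply i)]
  simp only [h3]
  refine (Finset.prod_subset_one_on_sdiff Finset.subset_union_right (fun i hi => ?_)
    (fun i hi => ?_)).symm
  · have : i ∉ s := (Finset.mem_sdiff.1 hi).2
    simp [u, this]
  · simp [u, hi]

theorem map_withDensity_measurableEquiv {X Z : Type*} [MeasurableSpace X] [MeasurableSpace Z]
    (μ : Measure X) (e : X ≃ᵐ Z) (f : Z → ℝ≥0∞) :
    (μ.withDensity (f ∘ e)).map e = (μ.map e).withDensity f := by
  ext s hs
  rw [e.map_apply, withDensity_apply _ (e.measurable hs), withDensity_apply _ hs,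
    e.restrict_map, lintegral_map_equiv]
  rfl

end Density

/-! ### The isotropic Gaussian law: convolution, translation and exponential moments -/

section SiteGaussian

/-- The centred Gaussian law with covariance matrix `σ² I`. -/
noncomputable def siteGaussian (d : ℕ) (σ : ℝ) : Measure (EuclideanSpace ℝ (Fin d)) :=
  multivariateGaussian 0 (σ ^ 2 • (1 : Matrix (Fin d) (Fin d) ℝ))

variable {d : ℕ} {σ : ℝ}

instance : IsGaussian (siteGaussian d σ) := by unfold siteGaussian; infer_instance

instance : IsProbabilityMeasure (siteGaussian d σ) := by unfold siteGaussian; infer_instance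

theorem charFun_siteGaussian (t : EuclideanSpace ℝ (Fin d)) :
    charFun (siteGaussian d σ) t = Complex.exp (-(σ ^ 2 * ‖t‖ ^ 2 / 2 : ℝ)) := by
  have hS : (σ ^ 2 • (1 : Matrix (Fin d) (Fin d) ℝ)).PosSemidef :=
    Matrix.PosSemidef.one.smul (sq_nonneg σ)
  rw [siteGaussian, charFun_multivariateGaussian hS, EuclideanSpace.real_norm_sq_eq]
  congr 1
  simp only [inner_zero_right, Complex.ofReal_zero, zero_mul, zero_sub, Matrix.smul_mulVec,
    Matrix.one_mulVec, dotProduct, Pi.smul_apply, smul_eq_mul, Finset.mul_sum]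
  push_cast
  congr 2
  exact Finset.sum_congr rfl fun i _ => by ring

theorem siteGaussian_conv {τ ρ : ℝ} (h : σ ^ 2 + τ ^ 2 = ρ ^ 2) :
    (siteGaussian d σ).conv (siteGaussian d τ) = siteGaussian d ρ := by
  refine Measure.ext_of_charFun (funext fun t => ?_)
  rw [charFun_conv, charFun_siteGaussian, charFun_siteGaussian, charFun_siteGaussian,
    ← Complex.exp_add, ← h]
  congr 1
  push_cast
  ring

theorem siteGaussian_eq_map_smul :
    siteGaussian d σ = (siteGaussian d 1).map (fun y => σ • y) := by
  have : IsProbabilityMeasure ((siteGaussian d 1).map (fun y => σ • y)) :=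
    Measure.isProbabilityMeasure_map (by fun_prop)
  refine Measure.ext_of_charFun (funext fun t => ?_)
  rw [charFun_map_smul, charFun_siteGaussian, charFun_siteGaussian, norm_smul, Real.norm_eq_abs,
    mul_pow, sq_abs, one_pow, one_mul]

theorem siteGaussian_eq_map_pi :
    siteGaussian d σ = (Measure.pi fun _ : Fin d => gaussianReal 0 (σ ^ 2).toNNReal).map
      (WithLp.toLp 2) := by
  have : IsProbabilityMeasure ((Measure.pi fun _ : Fin d => gaussianReal 0 (σ ^ 2).toNNReal).map
      (WithLp.toLp 2)) := Measure.isProbabilityMeasure_map (by fun_prop)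
  refine Measure.ext_of_charFun (funext fun t => ?_)
  rw [charFun_siteGaussian, charFun_pi]
  simp_rw [charFun_gaussianReal, ← Complex.exp_sum, EuclideanSpace.real_norm_sq_eq]
  congr 1
  rw [Finset.mul_sum, Finset.sum_div]
  push_cast
  rw [← Finset.sum_neg_distrib]
  refine Finset.sum_congr rfl fun i _ => ?_
  rw [Real.coe_toNNReal _ (sq_nonneg σ)]
  push_cast
  ring

theorem gaussianReal_eq_withDensity {v : NNReal} (hv : v ≠ 0) (s : ℝ) :
    gaussianReal s v = (gaussianReal 0 v).withDensity
      (fun t => ENNReal.ofReal (Real.exp (s * t / v - s ^ 2 / (2 * v)))) := by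
  rw [gaussianReal_of_var_ne_zero _ hv, gaussianReal_of_var_ne_zero _ hv,
    ← withDensity_mul _ (measurable_gaussianPDF _ _) (by fun_prop)]
  congr 1
  funext t
  have hv' : (v : ℝ) ≠ 0 := by exact_mod_cast hv
  rw [Pi.mul_apply, gaussianPDF, gaussianPDF, ← ENNReal.ofReal_mul (gaussianPDFReal_nonneg _ _ _),
    gaussianPDFReal, gaussianPDFReal, mul_assoc _ (Real.exp _) (Real.exp _), ← Real.exp_add]
  congr 3
  field_simp
  ring

/-- The density of the Gaussian law translated by `s` with respect to the centred law. -/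
noncomputable def shiftDensity (σ : ℝ) (s y : EuclideanSpace ℝ (Fin d)) : ℝ≥0∞ :=
  ENNReal.ofReal (Real.exp (inner ℝ s y / σ ^ 2 - ‖s‖ ^ 2 / (2 * σ ^ 2)))

theorem measurable_shiftDensity (s : EuclideanSpace ℝ (Fin d)) :
    Measurable (shiftDensity σ s) := by
  unfold shiftDensity; fun_prop

theorem measurable_uncurry_shiftDensity :
    Measurable (fun p : EuclideanSpace ℝ (Fin d) × EuclideanSpace ℝ (Fin d) =>
      shiftDensity σ p.1 p.2) := by
  unfold shiftDensity; fun_prop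

theorem shiftDensity_zero : shiftDensity σ (0 : EuclideanSpace ℝ (Fin d)) = 1 := by
  funext y; simp [shiftDensity]

/-- The Cameron–Martin formula for the law `N(0, σ² I)`. -/
theorem map_const_add_siteGaussian (hσ : 0 < σ) (s : EuclideanSpace ℝ (Fin d)) :
    (siteGaussian d σ).map (fun y => s + y) = (siteGaussian d σ).withDensity (shiftDensity σ s) := by
  set v := (σ ^ 2).toNNReal with hv
  have hv0 : v ≠ 0 := by rw [hv, ne_eq, Real.toNNReal_eq_zero]; push Not; positivity
  have hv1 : (v : ℝ) = σ ^ 2 := Real.coe_toNNReal _ (sq_nonneg σ)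
  have h1 : (siteGaussian d σ).map (fun y => s + y) =
      (Measure.pi fun i : Fin d => gaussianReal (s i) v).map (MeasurableEquiv.toLp 2 _) := by
    have h2 : (Measure.pi fun _ : Fin d => gaussianReal 0 v).map (fun y i => s i + y i) =
        Measure.pi fun i : Fin d => gaussianReal (s i) v := by
      have : ∀ i, IsProbabilityMeasure ((gaussianReal 0 v).map (fun t => s i + t)) := fun i =>
        Measure.isProbabilityMeasure_map (by fun_prop)
      rw [Measure.pi_map_pi (f := fun (i : Fin d) t => s i + t) (by fun_prop)]
      congr 1
      funext i
      rw [gaussianReal_map_const_add, zero_add]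
    rw [siteGaussian_eq_map_pi, ← h2, Measure.map_map (by fun_prop) (by fun_prop),
      Measure.map_map (by fun_prop) (by fun_prop)]
    rfl
  have h3 := gaussianReal_eq_withDensity hv0
  have hp : ∀ i : Fin d, IsProbabilityMeasure ((gaussianReal 0 v).withDensity
      (fun t => ENNReal.ofReal (Real.exp (s i * t / v - s i ^ 2 / (2 * v))))) := fun i => by
    rw [← h3]; infer_instance
  have h4 := infinitePi_withDensity (fun _ : Fin d => gaussianReal 0 v)
    (fun i t => ENNReal.ofReal (Real.exp (s i * t / v - s i ^ 2 / (2 * v)))) (by fun_prop)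
    Finset.univ (by simp)
  simp only [← h3, Measure.infinitePi_eq_pi] at h4
  rw [h1, h4, siteGaussian_eq_map_pi, ← hv]
  change _ = ((Measure.pi fun _ : Fin d => gaussianReal 0 v).map
    (MeasurableEquiv.toLp 2 (Fin d → ℝ))).withDensity _
  rw [← map_withDensity_measurableEquiv]
  congr 2
  funext y
  simp only [Function.comp, shiftDensity]
  rw [← ENNReal.ofReal_prod_of_nonneg (fun _ _ => (Real.exp_pos _).le), ← Real.exp_sum,
    EuclideanSpace.real_norm_sq_eq, PiLp.inner_apply, Finset.sum_sub_distrib, Finset.sum_div,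
    Finset.sum_div, hv1]
  simp [mul_comm]

theorem map_const_add_siteGaussian_absolutelyContinuous (hσ : 0 < σ)
    (s : EuclideanSpace ℝ (Fin d)) :
    (siteGaussian d σ).map (fun y => s + y) ≪ siteGaussian d σ := by
  rw [map_const_add_siteGaussian hσ]
  exact withDensity_absolutelyContinuous _ _

instance (s : EuclideanSpace ℝ (Fin d)) [Fact (0 < σ)] :
    IsProbabilityMeasure ((siteGaussian d σ).withDensity (shiftDensity σ s)) := by
  rw [← map_const_add_siteGaussian Fact.out]
  exact Measure.isProbabilityMeasure_map (by fun_prop)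

theorem lintegral_shiftDensity (hσ : 0 < σ) (s : EuclideanSpace ℝ (Fin d)) :
    ∫⁻ y, shiftDensity σ s y ∂siteGaussian d σ = 1 := by
  have := Fact.mk hσ
  rw [← setLIntegral_univ, ← withDensity_apply _ MeasurableSet.univ]
  exact measure_univ

/-- One density changes the measure to the law translated by `s`, under which the other density
acquires a constant factor. This is the correlation of two shifts in the second moment bound. -/
theorem lintegral_shiftDensity_mul (hσ : 0 < σ) (s t : EuclideanSpace ℝ (Fin d)) :
    ∫⁻ y, shiftDensity σ s y * shiftDensity σ t y ∂siteGaussian d σ =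
      ENNReal.ofReal (Real.exp (inner ℝ s t / σ ^ 2)) := by
  have h1 := lintegral_withDensity_eq_lintegral_mul (siteGaussian d σ)
    (measurable_shiftDensity (σ := σ) s) (measurable_shiftDensity (σ := σ) t)
  simp only [Pi.mul_apply] at h1
  rw [← h1, ← map_const_add_siteGaussian hσ,
    lintegral_map (measurable_shiftDensity t) (by fun_prop)]
  have h2 : ∀ y, shiftDensity σ t (s + y) =
      ENNReal.ofReal (Real.exp (inner ℝ s t / σ ^ 2)) * shiftDensity σ t y := by
    intro y
    rw [shiftDensity, shiftDensity, ← ENNReal.ofReal_mul (Real.exp_pos _).le, ← Real.exp_add,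
      inner_add_right, real_inner_comm]
    congr 2
    ring
  simp only [h2]
  rw [lintegral_const_mul _ (measurable_shiftDensity t), lintegral_shiftDensity hσ, mul_one]

theorem siteGaussian_singleton (hd : 0 < d) (hσ : 0 < σ) (p : EuclideanSpace ℝ (Fin d)) :
    siteGaussian d σ {p} = 0 := by
  set v := (σ ^ 2).toNNReal with hv
  have hv0 : v ≠ 0 := by rw [hv, ne_eq, Real.toNNReal_eq_zero]; push Not; positivity
  have : NullSingletonClass (gaussianReal 0 v) := nullSingletonClass_gaussianReal hv0
  have h1 : (WithLp.toLp 2 : (Fin d → ℝ) → _) ⁻¹' {p} = {WithLp.ofLp p} := by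
    ext y
    simp only [Set.mem_preimage, Set.mem_singleton_iff]
    constructor
    · rintro rfl; rfl
    · rintro rfl; rfl
  rw [siteGaussian_eq_map_pi, Measure.map_apply (by fun_prop) (measurableSet_singleton p), h1,
    Measure.pi_singleton]
  exact Finset.prod_eq_zero (Finset.mem_univ ⟨0, hd⟩) (measure_singleton _)

/-- Fernique's theorem gives `exp (C ‖y‖²)` integrable for some `C > 0`, and completing the square
bounds `a ‖y‖` by `C ‖y‖² + a² / (4 C)`. -/
theorem lintegral_exp_norm_siteGaussian_lt_top (a : ℝ) :
    ∫⁻ y, ENNReal.ofReal (Real.exp (a * ‖y‖)) ∂siteGaussian d σ < ⊤ := by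
  obtain ⟨C, hC, hi⟩ := IsGaussian.exists_integrable_exp_sq (siteGaussian d σ)
  have h1 : Integrable (fun y => Real.exp (a ^ 2 / (4 * C)) * Real.exp (C * ‖y‖ ^ 2))
    (siteGaussian d σ) := hi.const_mul _
  refine lt_of_le_of_lt (lintegral_mono fun y => ENNReal.ofReal_le_ofReal ?_)
    h1.lintegral_lt_top
  rw [← Real.exp_add]
  refine Real.exp_le_exp.2 ?_
  have : a ^ 2 / (4 * C) + C * ‖y‖ ^ 2 - a * ‖y‖ = (a - 2 * C * ‖y‖) ^ 2 / (4 * C) := by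
    field_simp; ring
  have h2 : 0 ≤ (a - 2 * C * ‖y‖) ^ 2 / (4 * C) := by positivity
  linarith

/-- Scaling to unit variance bounds the moment independently of `σ`, so that `a` can be taken as
large as `1 / σ` when the noise is small. -/
theorem lintegral_exp_norm_siteGaussian_le (hσ : 0 ≤ σ) {a : ℝ} (ha : a * σ ≤ 1) :
    ∫⁻ y, ENNReal.ofReal (Real.exp (a * ‖y‖)) ∂siteGaussian d σ ≤
      ∫⁻ y, ENNReal.ofReal (Real.exp (1 * ‖y‖)) ∂siteGaussian d 1 := by
  rw [siteGaussian_eq_map_smul, lintegral_map (by fun_prop) (by fun_prop)]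
  refine lintegral_mono fun y => ENNReal.ofReal_le_ofReal (Real.exp_le_exp.2 ?_)
  rw [norm_smul, Real.norm_eq_abs, abs_of_nonneg hσ, ← mul_assoc]
  exact mul_le_mul_of_nonneg_right ha (norm_nonneg y)

end SiteGaussian

/-! ### Exponential sums over the lattice -/

section LatticeSum

theorem tsum_int_exp_neg_abs_lt_top {a : ℝ} (ha : 0 < a) :
    ∑' k : ℤ, ENNReal.ofReal (Real.exp (-(a * |(k : ℝ)|))) < ⊤ := by
  refine Summable.tsum_ofReal_lt_top ?_
  have h : Summable fun n : ℕ => Real.exp (-(a * |((n : ℤ) : ℝ)|)) := by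
    have h1 : Summable fun n : ℕ => Real.exp (-a) ^ n :=
      summable_geometric_of_lt_one (Real.exp_pos _).le (by rw [Real.exp_lt_one_iff]; linarith)
    refine h1.congr fun n => ?_
    rw [← Real.exp_nat_mul, Int.cast_natCast, Nat.abs_cast]
    congr 1; ring
  refine summable_int_iff_summable_nat_and_neg.2 ⟨h, ?_⟩
  simpa using h

/-- Both sides are the total mass of the `n`-fold product of the measure with point masses `f`. -/
theorem tsum_pi_prod_eq {α : Type*} [Countable α] (f : α → ℝ≥0∞) (hf : ∑' k, f k < ⊤) (n : ℕ) :
    ∑' x : Fin n → α, ∏ i, f (x i) = (∑' k, f k) ^ n := by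
  let _ : MeasurableSpace α := ⊤
  let ν : Measure α := Measure.count.withDensity f
  have hν : ν Set.univ = ∑' k, f k := by
    rw [withDensity_apply _ MeasurableSet.univ, setLIntegral_univ, lintegral_count]
  have : IsFiniteMeasure ν := ⟨by rw [hν]; exact hf⟩
  have h1 : ∀ k, ν {k} = f k := fun k => by
    rw [withDensity_apply _ (measurableSet_singleton k), lintegral_singleton]
    simp
  have h2 : ∀ x : Fin n → α, ∏ i, f (x i) = (Measure.pi fun _ : Fin n => ν) {x} := fun x => by
    rw [Measure.pi_singleton]
    simp only [h1]
  have h3 := lintegral_countable' (μ := Measure.pi fun _ : Fin n => ν) (fun _ => 1)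
  simp only [one_mul, lintegral_one] at h3
  simp only [h2]
  rw [← h3, Measure.pi_univ]
  simp [hν]

variable {d : ℕ}

theorem latticePoint_apply (x : Fin d → ℤ) (i : Fin d) : latticePoint x i = x i := rfl

theorem latticePoint_sub (x y : Fin d → ℤ) :
    latticePoint (x - y) = latticePoint x - latticePoint y := by
  ext i; simp [latticePoint_apply]

theorem latticePoint_add (x y : Fin d → ℤ) :
    latticePoint (x + y) = latticePoint x + latticePoint y := by
  ext i; simp [latticePoint_apply]

theorem one_le_norm_latticePoint {x : Fin d → ℤ} (hx : x ≠ 0) : 1 ≤ ‖latticePoint x‖ := by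
  obtain ⟨i, hi⟩ : ∃ i, x i ≠ 0 := by
    by_contra! h
    exact hx (funext h)
  have h1 : ‖latticePoint x i‖ ≤ ‖latticePoint x‖ := PiLp.norm_apply_le _ i
  rw [latticePoint_apply, Real.norm_eq_abs] at h1
  have h2 : (1 : ℝ) ≤ |(x i : ℝ)| := by exact_mod_cast Int.one_le_abs hi
  linarith

/-- Since `∑ |x i| ≤ d ‖x‖`, the sum is dominated by a product of one-dimensional sums with rate `a
/ d`. -/
theorem tsum_exp_neg_norm_latticePoint_lt_top {a : ℝ} (ha : 0 < a) :
    ∑' x : Fin d → ℤ, ENNReal.ofReal (Real.exp (-(a * ‖latticePoint x‖))) < ⊤ := by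
  rcases Nat.eq_zero_or_pos d with rfl | hd
  · rw [tsum_fintype]
    exact ENNReal.sum_lt_top.2 fun _ _ => ENNReal.ofReal_lt_top
  have hd' : (0 : ℝ) < d := by exact_mod_cast hd
  have hZ := tsum_int_exp_neg_abs_lt_top (div_pos ha hd')
  refine lt_of_le_of_lt (ENNReal.tsum_le_tsum fun x => ?_)
    ((tsum_pi_prod_eq _ hZ d).trans_lt (ENNReal.pow_lt_top hZ))
  rw [← ENNReal.ofReal_prod_of_nonneg (fun _ _ => (Real.exp_pos _).le), ← Real.exp_sum]
  refine ENNReal.ofReal_le_ofReal (Real.exp_le_exp.2 ?_)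
  rw [Finset.sum_neg_distrib, ← Finset.mul_sum, neg_le_neg_iff]
  have h1 : ∑ i : Fin d, |(x i : ℝ)| ≤ ∑ _i : Fin d, ‖latticePoint x‖ :=
    Finset.sum_le_sum fun i _ => by
      have := PiLp.norm_apply_le (latticePoint x) i
      rwa [latticePoint_apply, Real.norm_eq_abs] at this
  rw [Finset.sum_const, Finset.card_univ, Fintype.card_fin, nsmul_eq_mul] at h1
  calc a / d * ∑ i : Fin d, |(x i : ℝ)| ≤ a / d * (d * ‖latticePoint x‖) := by gcongr
    _ = a * ‖latticePoint x‖ := by field_simp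

end LatticeSum

/-! ### The laws of the displacements and of the configurations -/

section Law

/-- The law of the displacements. -/
noncomputable def displacementLaw (d : ℕ) (σ : ℝ) :
    Measure ((Fin d → ℤ) → EuclideanSpace ℝ (Fin d)) :=
  Measure.infinitePi fun _ => siteGaussian d σ

instance (d : ℕ) (σ : ℝ) : IsProbabilityMeasure (displacementLaw d σ) := by
  unfold displacementLaw; infer_instance

/-- The law of the perturbed lattice with the points in `S` left out. -/
noncomputable def latticeLaw {d : ℕ} (σ : ℝ) (S : Set (Fin d → ℤ)) : Measure (PointConfig d) :=
  (displacementLaw d σ).map (labelConfig S)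

variable {d : ℕ} {σ : ℝ}

instance (S : Set (Fin d → ℤ)) : IsProbabilityMeasure (latticeLaw σ S) :=
  Measure.isProbabilityMeasure_map (measurable_labelConfig S).aemeasurable

theorem latticeLaw_apply (S : Set (Fin d → ℤ)) {C : Set (PointConfig d)} (hC : MeasurableSet C) :
    latticeLaw σ S C = displacementLaw d σ (labelConfig S ⁻¹' C) :=
  Measure.map_apply (measurable_labelConfig S) hC

theorem IsIIDGaussian.map_eq {Ω : Type*} [MeasurableSpace Ω] {P : Measure Ω}
    [IsProbabilityMeasure P] {Y : (Fin d → ℤ) → Ω → EuclideanSpace ℝ (Fin d)}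
    (h : IsIIDGaussian P σ Y) : P.map (fun ω x => Y x ω) = displacementLaw d σ := by
  rw [h.indep.map_fun_eq_infinitePi_map h.measurable]
  simp only [h.law]
  rfl

theorem IsIIDGaussian.measurePreserving {Ω : Type*} [MeasurableSpace Ω] {P : Measure Ω}
    [IsProbabilityMeasure P] {Y : (Fin d → ℤ) → Ω → EuclideanSpace ℝ (Fin d)}
    (h : IsIIDGaussian P σ Y) :
    MeasurePreserving (fun ω x => Y x ω) P (displacementLaw d σ) :=
  ⟨measurable_pi_lambda _ h.measurable, h.map_eq⟩

theorem IsIIDGaussian.map_perturbedLatticeWithout {Ω : Type*} [MeasurableSpace Ω] {P : Measure Ω}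
    [IsProbabilityMeasure P] {Y : (Fin d → ℤ) → Ω → EuclideanSpace ℝ (Fin d)}
    (h : IsIIDGaussian P σ Y) (S : Set (Fin d → ℤ)) :
    P.map (perturbedLatticeWithout S Y) = latticeLaw σ S := by
  rw [latticeLaw, ← h.map_eq,
    Measure.map_map (measurable_labelConfig S) (measurable_pi_lambda _ h.measurable)]
  rfl

theorem measurePreserving_eval_displacementLaw (x : Fin d → ℤ) :
    MeasurePreserving (fun y => y x) (displacementLaw d σ) (siteGaussian d σ) :=
  measurePreserving_eval_infinitePi (fun _ : Fin d → ℤ => siteGaussian d σ) x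

theorem measurePreserving_update_displacementLaw (x : Fin d → ℤ) :
    MeasurePreserving (fun p : ((Fin d → ℤ) → EuclideanSpace ℝ (Fin d)) ×
      EuclideanSpace ℝ (Fin d) => Function.update p.1 x p.2)
      ((displacementLaw d σ).prod (siteGaussian d σ)) (displacementLaw d σ) :=
  measurePreserving_update_infinitePi_prod (fun _ : Fin d → ℤ => siteGaussian d σ) x

/-- Given one displacement, a coincidence forces another, independent one to take a single value,
and the Gaussian law has no atoms. -/
theorem ae_injective_displacementLaw (hd : 0 < d) (hσ : 0 < σ) :
    ∀ᵐ y ∂displacementLaw d σ, Function.Injective (fun x => latticePoint x + y x) := by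
  have h1 : ∀ x x' : Fin d → ℤ, ∀ᵐ y ∂displacementLaw d σ, x ≠ x' →
      latticePoint x + y x ≠ latticePoint x' + y x' := by
    intro x x'
    by_cases hx : x = x'
    · simp [hx]
    have h2 := Measure.infinitePi_map_eval_prod
      (P := fun _ : Fin d → ℤ => siteGaussian d σ) hx
    have h3 : ∀ᵐ p ∂((siteGaussian d σ).prod (siteGaussian d σ)),
        latticePoint x + p.1 ≠ latticePoint x' + p.2 := by
      have hm : MeasurableSet {p : EuclideanSpace ℝ (Fin d) × EuclideanSpace ℝ (Fin d) |
          latticePoint x + p.1 ≠ latticePoint x' + p.2} :=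
        (measurableSet_eq_fun (by fun_prop) (by fun_prop)).compl
      rw [Measure.ae_prod_iff_ae_ae hm]
      refine Filter.Eventually.of_forall fun p => ?_
      refine measure_mono_null (t := {latticePoint x + p - latticePoint x'}) (fun q hq => ?_)
        (siteGaussian_singleton hd hσ _)
      simp only [ne_eq, Set.mem_compl_iff, Set.mem_ofPred_eq, not_not] at hq
      rw [Set.mem_singleton_iff, hq]
      abel
    rw [← h2] at h3
    filter_upwards [ae_of_ae_map (by fun_prop) h3] with y hy _
    exact hy
  filter_upwards [ae_all_iff.2 fun x => ae_all_iff.2 (h1 x)] with y hy x x' hxx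
  by_contra hne
  exact hy x x' hne hxx

/-- Borel–Cantelli: reaching the ball from `x` takes a displacement of length at least `‖x‖ - R`, of
exponentially small probability. -/
theorem ae_finite_displacementLaw (R : ℝ) :
    ∀ᵐ y ∂displacementLaw d σ, {x | latticePoint x + y x ∈ Metric.ball 0 R}.Finite := by
  suffices h : ∑' x : Fin d → ℤ,
      displacementLaw d σ {y | latticePoint x + y x ∈ Metric.ball 0 R} ≠ ⊤ from
    ae_finite_setOfPred_mem h
  set M := ∫⁻ y, ENNReal.ofReal (Real.exp (1 * ‖y‖)) ∂siteGaussian d σ with hM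
  have hM' : M < ⊤ := lintegral_exp_norm_siteGaussian_lt_top 1
  have h1 : ∀ x : Fin d → ℤ, displacementLaw d σ {y | latticePoint x + y x ∈ Metric.ball 0 R} ≤
      ENNReal.ofReal (Real.exp (-(1 * ‖latticePoint x‖))) * (M * ENNReal.ofReal (Real.exp R)) := by
    intro x
    have h2 : displacementLaw d σ {y | latticePoint x + y x ∈ Metric.ball 0 R} =
        siteGaussian d σ {z | latticePoint x + z ∈ Metric.ball 0 R} :=
      (measurePreserving_eval_displacementLaw x).measure_preimage
        (measurableSet_preimage (by fun_prop) Metric.isOpen_ball.measurableSet).nullMeasurableSet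
    rw [h2]
    have h3 := meas_ge_le_lintegral_div (μ := siteGaussian d σ)
      (f := fun z => ENNReal.ofReal (Real.exp (1 * ‖z‖))) (by fun_prop)
      (ε := ENNReal.ofReal (Real.exp (‖latticePoint x‖ - R))) (by simp [Real.exp_pos]) (by simp)
    refine (measure_mono fun z hz => ?_).trans (h3.trans (le_of_eq ?_))
    · simp only [Set.mem_ofPred_eq, mem_ball_zero_iff] at hz ⊢
      refine ENNReal.ofReal_le_ofReal (Real.exp_le_exp.2 ?_)
      have := norm_sub_norm_le (latticePoint x) (-z)
      rw [norm_neg, sub_neg_eq_add] at this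
      linarith
    · rw [div_eq_mul_inv, ← ENNReal.ofReal_inv_of_pos (Real.exp_pos _), ← Real.exp_neg,
        mul_comm, mul_left_comm, ← ENNReal.ofReal_mul (Real.exp_pos _).le, ← Real.exp_add, mul_comm]
      congr 3
      ring
  refine ne_top_of_le_ne_top ?_ (ENNReal.tsum_le_tsum h1)
  rw [ENNReal.tsum_mul_right]
  exact ENNReal.mul_ne_top (tsum_exp_neg_norm_latticePoint_lt_top one_pos).ne
    (ENNReal.mul_ne_top hM'.ne ENNReal.ofReal_ne_top)

theorem ae_goodLabels (hd : 0 < d) (hσ : 0 < σ) :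
    ∀ᵐ y ∂displacementLaw d σ, y ∈ goodLabels d := by
  filter_upwards [ae_injective_displacementLaw hd hσ,
    ae_all_iff.2 fun n : ℕ => ae_finite_displacementLaw (n : ℝ)] with y h1 h2
  exact ⟨h1, h2⟩

end Law

/-! ### Absolute continuity or singularity -/

section Dichotomy

variable {d : ℕ} {σ : ℝ}

/-- This reduces singularity to a deterministic statement about pairs of labellings: no measurable
event needs to be exhibited by hand. -/
theorem mutuallySingular_latticeLaw_of_ae (hd : 0 < d) (hσ : 0 < σ) {S T : Set (Fin d → ℤ)}
    {D D' : Set ((Fin d → ℤ) → EuclideanSpace ℝ (Fin d))} (hD : MeasurableSet D)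
    (hD' : MeasurableSet D') (h : ∀ᵐ y ∂displacementLaw d σ, y ∈ D)
    (h' : ∀ᵐ y ∂displacementLaw d σ, y ∈ D')
    (hne : ∀ y ∈ D, y ∈ goodLabels d → ∀ y' ∈ D', y' ∈ goodLabels d →
      labelConfig S y ≠ labelConfig T y') :
    latticeLaw σ S ⟂ₘ latticeLaw σ T := by
  obtain ⟨C, hC, h1, h2⟩ := PointConfig.exists_measurableSet_separating
    (measurable_labelConfig S) (measurable_labelConfig T)
    (hD.inter measurableSet_goodLabels) (hD'.inter measurableSet_goodLabels)
    (fun y hy => locallyFinite_labelConfig hy.2) (fun y hy => locallyFinite_labelConfig hy.2)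
    (fun y hy y' hy' => hne y hy.1 hy.2 y' hy'.1 hy'.2)
  refine ⟨Cᶜ, hC.compl, ?_, ?_⟩
  · rw [latticeLaw_apply S hC.compl, Set.preimage_compl, ← mem_ae_iff]
    filter_upwards [h, ae_goodLabels hd hσ] with y hy hg
    exact h1 y ⟨hy, hg⟩
  · rw [compl_compl, latticeLaw_apply T hC, ← compl_compl (labelConfig T ⁻¹' C), ← mem_ae_iff]
    filter_upwards [h', ae_goodLabels hd hσ] with y hy hg
    exact h2 y ⟨hy, hg⟩

theorem labelConfig_update_of_mem {S : Set (Fin d → ℤ)} {x : Fin d → ℤ} (hx : x ∈ S)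
    (y : (Fin d → ℤ) → EuclideanSpace ℝ (Fin d)) (z : EuclideanSpace ℝ (Fin d)) :
    labelConfig S (Function.update y x z) = labelConfig S y := by
  refine PointConfig.ext (Set.ext fun p => exists_congr fun x' => and_congr_right fun hx' => ?_)
  have : x' ≠ x := fun h => hx' (h ▸ hx)
  simp only [Function.update_of_ne this]

/-- The right side depends only on the configuration and the moved point, not on the labelling. This
is what allows moves to be compared between `Π_S` and `Π_T`. -/
theorem labelConfig_update_of_notMem {S : Set (Fin d → ℤ)} {x : Fin d → ℤ} (hx : x ∉ S)
    {y : (Fin d → ℤ) → EuclideanSpace ℝ (Fin d)} (hy : y ∈ goodLabels d)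
    (w : EuclideanSpace ℝ (Fin d)) :
    labelConfig S (Function.update y x (w - latticePoint x)) =
      ⟨insert w ((labelConfig S y).pts \ {latticePoint x + y x})⟩ := by
  refine PointConfig.ext (Set.ext fun p => ?_)
  rw [mem_labelConfig, Set.mem_insert_iff, Set.mem_sdiff, mem_labelConfig,
    Set.mem_singleton_iff]
  constructor
  · rintro ⟨x', hx', rfl⟩
    by_cases h : x' = x
    · subst h
      left
      rw [Function.update_self]
      abel
    · right
      rw [Function.update_of_ne h]
      exact ⟨⟨x', hx', rfl⟩, fun h' => h (hy.1 h')⟩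
  · rintro (rfl | ⟨⟨x', hx', rfl⟩, hp⟩)
    · refine ⟨x, hx, ?_⟩
      rw [Function.update_self]
      abel
    · have h : x' ≠ x := fun h => hp (h ▸ rfl)
      exact ⟨x', hx', by rw [Function.update_of_ne h]⟩

theorem measurable_update_sub (x : Fin d → ℤ) :
    Measurable (fun p : ((Fin d → ℤ) → EuclideanSpace ℝ (Fin d)) × EuclideanSpace ℝ (Fin d) =>
      Function.update p.1 x (p.2 - latticePoint x)) := by
  refine measurable_pi_lambda _ fun i => ?_
  by_cases hi : i = x
  · subst hi; simp only [Function.update_self]; fun_prop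
  · simp only [Function.update_of_ne hi]; fun_prop

/-- The probability that moving the point with label `x` to a Gaussian position leads to `C`. -/
noncomputable def moveProb (σ : ℝ) (C : Set (PointConfig d)) (S : Set (Fin d → ℤ))
    (x : Fin d → ℤ) (y : (Fin d → ℤ) → EuclideanSpace ℝ (Fin d)) : ℝ≥0∞ :=
  siteGaussian d σ {w | labelConfig S (Function.update y x (w - latticePoint x)) ∈ C}

theorem measurable_moveProb {C : Set (PointConfig d)} (hC : MeasurableSet C)
    (S : Set (Fin d → ℤ)) (x : Fin d → ℤ) : Measurable (moveProb σ C S x) :=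
  measurable_measure_prodMk_left
    (((measurable_labelConfig S).comp (measurable_update_sub x)) hC)

/-- `moveProb` draws the new position, not the displacement, from the centred law, so that it does
not see the label. Gaussian null sets are preserved by translation, so this makes no difference for
null events. -/
theorem moveProb_eq_zero_iff (hσ : 0 < σ) (C : Set (PointConfig d))
    (S : Set (Fin d → ℤ)) (x : Fin d → ℤ) (y : (Fin d → ℤ) → EuclideanSpace ℝ (Fin d)) :
    moveProb σ C S x y = 0 ↔
      ∀ᵐ z ∂siteGaussian d σ, labelConfig S (Function.update y x z) ∉ C := by
  have hq : ∀ s : EuclideanSpace ℝ (Fin d), Measure.QuasiMeasurePreserving (fun z => s + z)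
      (siteGaussian d σ) (siteGaussian d σ) := fun s =>
    ⟨by fun_prop, map_const_add_siteGaussian_absolutelyContinuous hσ s⟩
  have h0 : moveProb σ C S x y = 0 ↔
      ∀ᵐ w ∂siteGaussian d σ, labelConfig S (Function.update y x (w - latticePoint x)) ∉ C := by
    rw [ae_iff]
    simp only [not_not]
    rfl
  rw [h0]
  constructor
  · intro h
    filter_upwards [(hq (latticePoint x)).ae h] with z hz
    simpa using hz
  · intro h
    filter_upwards [(hq (-latticePoint x)).ae h] with z hz
    rwa [neg_add_eq_sub] at hz

theorem latticeLaw_absolutelyContinuous_or_mutuallySingular (hd : 0 < d) (hσ : 0 < σ)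
    (S T : Set (Fin d → ℤ)) :
    latticeLaw σ S ≪ latticeLaw σ T ∨ latticeLaw σ S ⟂ₘ latticeLaw σ T := by
  obtain ⟨s, hs, hs1, hs2⟩ := (latticeLaw σ S).mutuallySingular_singularPart (latticeLaw σ T)
  -- `s` carries the absolutely continuous part of the law of `Π_S`, and its complement is null for
  -- `Π_T`.
  have hac : ∀ A, latticeLaw σ T A = 0 → latticeLaw σ S (A ∩ s) = 0 := by
    intro A hA
    rw [← (latticeLaw σ S).singularPart_add_rnDeriv (latticeLaw σ T), Measure.add_apply,
      measure_mono_null Set.inter_subset_right hs1, zero_add]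
    exact withDensity_absolutelyContinuous _ _ (measure_mono_null Set.inter_subset_left hA)
  set m := displacementLaw d σ with hm
  -- Resampling a point of `Π_T` preserves its law, which gives `sᶜ` no mass; so almost surely no
  -- move leads into `sᶜ`.
  have hDT : ∀ᵐ y ∂m, ∀ x, moveProb σ sᶜ T x y = 0 := by
    refine ae_all_iff.2 fun x => ?_
    have h1 : ∀ᵐ y ∂m, labelConfig T y ∉ sᶜ := by
      rw [ae_iff]
      simp only [not_not]
      rw [latticeLaw_apply T hs.compl] at hs2
      exact hs2
    have h2 := (measurePreserving_update_displacementLaw x).quasiMeasurePreserving.ae h1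
    filter_upwards [Measure.ae_ae_of_ae_prod h2] with y hy
    exact (moveProb_eq_zero_iff hσ sᶜ T x y).2 hy
  have hDS : ∀ x, ∀ᵐ y ∂m, x ∉ S → labelConfig S y ∈ s → moveProb σ sᶜ S x y = 0 := by
    intro x
    by_cases hx : x ∈ S
    · simp [hx]
    -- `C` contains the configurations in `s` from which moving the point labelled `x` may lead to
    -- `sᶜ`. They never arise from a typical labelling of `Π_T`, so `C` is null for `Π_T` and `C ∩
    -- s` is null for `Π_S`.
    obtain ⟨C, hC, hC1, hC2⟩ := PointConfig.exists_measurableSet_separating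
      (measurable_labelConfig S) (measurable_labelConfig T)
      (D := (goodLabels d ∩ labelConfig S ⁻¹' s) ∩ (moveProb σ sᶜ S x ⁻¹' {0})ᶜ)
      (D' := goodLabels d ∩ ⋂ x, moveProb σ sᶜ T x ⁻¹' {0})
      ((measurableSet_goodLabels.inter (measurable_labelConfig S hs)).inter
        (measurable_moveProb hs.compl S x (measurableSet_singleton 0)).compl)
      (measurableSet_goodLabels.inter (MeasurableSet.iInter fun x =>
        measurable_moveProb hs.compl T x (measurableSet_singleton 0)))
      (fun y hy => locallyFinite_labelConfig hy.1.1) (fun y hy => locallyFinite_labelConfig hy.1)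
      (by
        rintro y ⟨⟨hy, hys⟩, hyx⟩ y' ⟨hy', hyx'⟩ heq
        obtain ⟨φ, hφ⟩ := exists_equiv_of_labelConfig_eq hy hy' heq
        refine hyx ?_
        have h1 := Set.mem_iInter.1 hyx' (φ ⟨x, hx⟩)
        have h2 : moveProb σ sᶜ S x y = moveProb σ sᶜ T (φ ⟨x, hx⟩) y' := by
          unfold moveProb
          congr 2
          funext w
          rw [labelConfig_update_of_notMem hx hy, labelConfig_update_of_notMem (φ ⟨x, hx⟩).2 hy',
            heq, hφ ⟨x, hx⟩]
        rw [Set.mem_preimage, h2]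
        exact h1)
    have h1 : latticeLaw σ T C = 0 := by
      rw [latticeLaw_apply T hC, ← compl_compl (labelConfig T ⁻¹' C), ← mem_ae_iff]
      filter_upwards [hDT, ae_goodLabels hd hσ] with y hy hg
      exact hC2 y ⟨hg, Set.mem_iInter.2 hy⟩
    have h2 := hac C h1
    rw [latticeLaw_apply S (hC.inter hs), ← compl_compl (labelConfig S ⁻¹' (C ∩ s)),
      ← mem_ae_iff] at h2
    filter_upwards [h2, ae_goodLabels hd hσ] with y hy hg _ hys
    by_contra hne
    exact hy ⟨hC1 y ⟨⟨hg, hys⟩, hne⟩, hys⟩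
  have hDm : MeasurableSet (labelConfig S ⁻¹' sᶜ) := measurable_labelConfig S hs.compl
  -- From `s` no resampling leads to `sᶜ`; hence a resampled configuration in `sᶜ` comes from one in
  -- `sᶜ`.
  have h01 := infinitePi_zero_or_one (siteGaussian d σ) hDm (fun x => by
    have hum := (measurePreserving_update_displacementLaw (d := d) (σ := σ) x).measurable
    have hmm : MeasurableSet {p : ((Fin d → ℤ) → EuclideanSpace ℝ (Fin d)) ×
        EuclideanSpace ℝ (Fin d) | Function.update p.1 x p.2 ∈ labelConfig S ⁻¹' sᶜ →
          p.1 ∈ labelConfig S ⁻¹' sᶜ} := by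
      have : {p : ((Fin d → ℤ) → EuclideanSpace ℝ (Fin d)) ×
        EuclideanSpace ℝ (Fin d) | Function.update p.1 x p.2 ∈ labelConfig S ⁻¹' sᶜ →
          p.1 ∈ labelConfig S ⁻¹' sᶜ} = ((fun p => Function.update p.1 x p.2) ⁻¹'
          (labelConfig S ⁻¹' sᶜ))ᶜ ∪ Prod.fst ⁻¹' (labelConfig S ⁻¹' sᶜ) := by
        ext p
        simp only [Set.mem_ofPred_eq, Set.mem_union, Set.mem_compl_iff, Set.mem_preimage]
        tauto
      rw [this]
      exact (hum hDm).compl.union (measurable_fst hDm)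
    refine (Measure.ae_prod_iff_ae_ae hmm).2 ?_
    filter_upwards [hDS x] with y hy
    by_cases hx : x ∈ S
    · refine Filter.Eventually.of_forall fun z => ?_
      simp only [Set.mem_preimage, labelConfig_update_of_mem hx, imp_self]
    · by_cases hys : labelConfig S y ∈ s
      · filter_upwards [(moveProb_eq_zero_iff hσ sᶜ S x y).1 (hy hx hys)] with z hz hz'
        exact absurd hz' hz
      · exact Filter.Eventually.of_forall fun z _ => hys)
  rcases h01 with h0 | h1
  · left
    intro A hA
    have h2 : latticeLaw σ S sᶜ = 0 := by rw [latticeLaw_apply S hs.compl]; exact h0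
    refine measure_mono_null (fun a ha => ?_) (measure_union_null (hac A hA) h2)
    by_cases has : a ∈ s
    · exact Or.inl ⟨ha, has⟩
    · exact Or.inr has
  · right
    refine ⟨s, hs, ?_, hs2⟩
    have h2 : latticeLaw σ S sᶜ = 1 := by rw [latticeLaw_apply S hs.compl]; exact h1
    rwa [prob_compl_eq_one_iff hs] at h2

end Dichotomy

/-! ### Independence of the labelling, monotonicity in the noise, translation -/

section Relabel

variable {d : ℕ} {σ : ℝ}

/-- The added noise is i.i.d., so reading it along `φ` does not change its law: noise added to a
configuration does not depend on how its points are labelled. -/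
theorem map_labelConfig_eq_of_equiv {S T : Set (Fin d → ℤ)}
    {y y' : (Fin d → ℤ) → EuclideanSpace ℝ (Fin d)} (φ : ↥Sᶜ ≃ ↥Tᶜ)
    (hφ : ∀ x : ↥Sᶜ, latticePoint (x : Fin d → ℤ) + y x =
      latticePoint (φ x : Fin d → ℤ) + y' (φ x)) :
    (displacementLaw d σ).map (fun z => labelConfig S (y + z)) =
      (displacementLaw d σ).map (fun z => labelConfig T (y' + z)) := by
  classical
  have h1 := Measure.map_infinitePi_infinitePi_of_inj
    (P := fun _ : Fin d → ℤ => siteGaussian d σ) (Subtype.val_injective (p := (· ∈ Sᶜ)))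
  have h2 := Measure.map_infinitePi_infinitePi_of_inj
    (P := fun _ : Fin d → ℤ => siteGaussian d σ)
    ((Subtype.val_injective (p := (· ∈ Tᶜ))).comp φ.injective)
  let K : (↥Sᶜ → EuclideanSpace ℝ (Fin d)) → PointConfig d := fun w =>
    labelConfig S (y + fun x => if hx : x ∈ Sᶜ then w ⟨x, hx⟩ else 0)
  have hK : Measurable K := by
    refine (measurable_labelConfig S).comp (Measurable.const_add ?_ y)
    refine measurable_pi_lambda _ fun x => ?_
    by_cases hx : x ∈ Sᶜ
    · simp only [hx, dif_pos]; fun_prop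
    · simp only [hx, dif_neg, not_false_eq_true]; fun_prop
  have h3 : (fun z => labelConfig S (y + z)) = K ∘ (fun z (x : ↥Sᶜ) => z x) := by
    funext z
    refine PointConfig.ext (Set.ext fun p => exists_congr fun x => and_congr_right fun hx => ?_)
    simp [hx]
  have h4 : (fun z => labelConfig T (y' + z)) = K ∘ (fun z (x : ↥Sᶜ) => z (φ x)) := by
    funext z
    refine PointConfig.ext (Set.ext fun p => ?_)
    simp only [Function.comp, K, mem_labelConfig]
    constructor
    · rintro ⟨x, hx, rfl⟩
      obtain ⟨⟨x', hx'⟩, hxx⟩ := φ.surjective ⟨x, hx⟩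
      refine ⟨x', hx', ?_⟩
      have h5 := hφ ⟨x', hx'⟩
      have hx'' : x' ∉ S := hx'
      simp only [hxx] at h5
      simp only [Pi.add_apply, Set.mem_compl_iff, hx'', not_false_eq_true, dif_pos, hxx,
        ← add_assoc, h5]
    · rintro ⟨x', hx', rfl⟩
      refine ⟨φ ⟨x', hx'⟩, (φ ⟨x', hx'⟩).2, ?_⟩
      have h5 := hφ ⟨x', hx'⟩
      simp only [Pi.add_apply, Set.mem_compl_iff, hx', not_false_eq_true, dif_pos,
        ← add_assoc] at h5 ⊢
      rw [h5]
  rw [h3, h4, ← Measure.map_map hK (by fun_prop), ← Measure.map_map hK (by fun_prop)]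
  congr 1
  exact h1.trans h2.symm

/-- Noise of size `ρ` is noise of size `σ` plus independent noise of size `τ`. After the `τ`-noise,
almost every `y` reaches `C` with probability zero and almost every `y'` with probability one, so
`y` and `y'` cannot label the same configuration. -/
theorem mutuallySingular_latticeLaw_of_le (hd : 0 < d) (hσ : 0 < σ) {ρ : ℝ} (h : σ ≤ ρ)
    {S T : Set (Fin d → ℤ)} (hST : latticeLaw ρ S ⟂ₘ latticeLaw ρ T) :
    latticeLaw σ S ⟂ₘ latticeLaw σ T := by
  obtain ⟨C, hC, hC1, hC2⟩ := hST
  set τ := √(ρ ^ 2 - σ ^ 2) with hτ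
  have hτ2 : σ ^ 2 + τ ^ 2 = ρ ^ 2 := by
    rw [hτ, Real.sq_sqrt (by nlinarith)]; ring
  have hadd : ((displacementLaw d σ).prod (displacementLaw d τ)).map (fun p => p.1 + p.2) =
      displacementLaw d ρ := by
    have := map_add_infinitePi_prod (fun _ : Fin d → ℤ => siteGaussian d σ)
      (fun _ : Fin d → ℤ => siteGaussian d τ)
    simp only [siteGaussian_conv hτ2] at this
    exact this
  have hmm : ∀ S : Set (Fin d → ℤ), Measurable (fun p : ((Fin d → ℤ) → EuclideanSpace ℝ (Fin d)) ×
      ((Fin d → ℤ) → EuclideanSpace ℝ (Fin d)) => labelConfig S (p.1 + p.2)) := fun S =>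
    (measurable_labelConfig S).comp (by fun_prop)
  have key : ∀ (S : Set (Fin d → ℤ)) (C : Set (PointConfig d)), MeasurableSet C →
      latticeLaw ρ S C = 0 → ∀ᵐ y ∂displacementLaw d σ,
        displacementLaw d τ ((fun z => labelConfig S (y + z)) ⁻¹' C) = 0 := by
    intro S C hC h0
    rw [latticeLaw_apply S hC, ← hadd, Measure.map_apply (by fun_prop)
      (measurable_labelConfig S hC)] at h0
    exact (Measure.measure_prod_null (hmm S hC)).1 h0
  refine mutuallySingular_latticeLaw_of_ae hd hσ
    (measurable_measure_prodMk_left (ν := displacementLaw d τ) (hmm S hC)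
      (measurableSet_singleton 0))
    (measurable_measure_prodMk_left (ν := displacementLaw d τ) (hmm T hC.compl)
      (measurableSet_singleton 0))
    (key S C hC hC1) (key T Cᶜ hC.compl hC2) ?_
  intro y hy hyg y' hy' hyg' heq
  obtain ⟨φ, hφ⟩ := exists_equiv_of_labelConfig_eq hyg hyg' heq
  have h1 := map_labelConfig_eq_of_equiv (σ := τ) φ hφ
  have hm1 : ∀ (S : Set (Fin d → ℤ)) (y : (Fin d → ℤ) → EuclideanSpace ℝ (Fin d)),
      Measurable (fun z => labelConfig S (y + z)) := fun S y =>
    (measurable_labelConfig S).comp (by fun_prop)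
  have h2 := congrArg (fun μ => μ C) h1
  simp only [Measure.map_apply (hm1 _ _) hC] at h2
  have h3 : displacementLaw d τ ((fun z => labelConfig S (y + z)) ⁻¹' C) = 0 := hy
  have h4 : displacementLaw d τ ((fun z => labelConfig T (y' + z)) ⁻¹' C)ᶜ = 0 := hy'
  rw [h3] at h2
  rw [prob_compl_eq_zero_iff ((hm1 _ _) hC), ← h2] at h4
  exact zero_ne_one h4

/-- The translate of a configuration. -/
def PointConfig.translate (v : EuclideanSpace ℝ (Fin d)) (A : PointConfig d) : PointConfig d :=
  ⟨(fun p => v + p) ⁻¹' A.pts⟩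

theorem PointConfig.measurable_translate (v : EuclideanSpace ℝ (Fin d)) :
    Measurable (PointConfig.translate v) := by
  rw [PointConfig.measurable_iff]
  intro B hB
  have hm : Measurable (fun p : EuclideanSpace ℝ (Fin d) => -v + p) := by fun_prop
  convert PointConfig.measurable_count (d := d) (hm hB) using 2 with A
  simp only [count, translate]
  have : (fun p => v + p) '' ((fun p => v + p) ⁻¹' A.pts ∩ B) =
      A.pts ∩ (fun p => -v + p) ⁻¹' B := by
    ext p
    simp only [Set.mem_image, Set.mem_inter_iff, Set.mem_preimage]
    constructor
    · rintro ⟨q, ⟨h1, h2⟩, rfl⟩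
      exact ⟨h1, by simpa using h2⟩
    · rintro ⟨h1, h2⟩
      exact ⟨-v + p, ⟨by simpa using h1, h2⟩, by simp⟩
  rw [← this, (add_right_injective v).injOn.encard_image]

/-- `translate` takes a preimage and so moves points by `-latticePoint x`; this is the relabelling
`x' ↦ x' + x`, under which i.i.d. displacements are invariant. -/
theorem map_translate_latticeLaw (x : Fin d → ℤ) (S T : Set (Fin d → ℤ))
    (h : ∀ x', x' ∈ S ↔ x' + x ∈ T) :
    (latticeLaw σ T).map (PointConfig.translate (latticePoint x)) = latticeLaw σ S := by
  rw [latticeLaw, Measure.map_map (PointConfig.measurable_translate _) (measurable_labelConfig T)]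
  let φ : ↥Sᶜ ≃ ↥Tᶜ := (Equiv.addRight x).subtypeEquiv fun x' => not_congr (h x')
  have h1 := map_labelConfig_eq_of_equiv (σ := σ) (S := S) (T := T) (y := 0)
    (y' := fun _ => -latticePoint x) φ (fun x' => by
      change _ = latticePoint ((x' : Fin d → ℤ) + x) + _
      rw [latticePoint_add]; simp)
  simp only [zero_add] at h1
  rw [latticeLaw, h1]
  congr 1
  funext z
  refine PointConfig.ext (Set.ext fun p => exists_congr fun x' => and_congr_right fun _ => ?_)
  simp only [Pi.add_apply]
  constructor
  · intro h; rw [← neg_add_eq_iff_eq_add.2 h]; abel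
  · rintro rfl; abel

end Relabel

/-! ### Infinite orbits of bijections between cofinite sets -/

section Orbit

/-- If a set with more elements than `S` is removed from the target of a bijection, some orbit
of the bijection never reaches `S`. -/
theorem exists_injective_orbit {α : Type*} {S T : Set α} (hS : S.Finite)
    (hST : S.ncard < T.ncard) (φ : ↥Sᶜ ≃ ↥Tᶜ) :
    ∃ u : ℕ → ↥Sᶜ, Function.Injective (fun k => (u k : α)) ∧
      ∀ k, (u (k + 1) : α) = φ (u k) := by
  classical
  let f : α → α := fun x => if hx : x ∈ Sᶜ then φ ⟨x, hx⟩ else x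
  have hf : ∀ x (hx : x ∈ Sᶜ), f x = φ ⟨x, hx⟩ := fun x hx => dif_pos hx
  have hinj : ∀ x x', x ∉ S → x' ∉ S → f x = f x' → x = x' := by
    intro x x' hx hx' h
    rw [hf x hx, hf x' hx'] at h
    exact congrArg Subtype.val (φ.injective (Subtype.ext h))
  have hT : ∀ x, x ∉ S → f x ∉ T := by
    intro x hx
    rw [hf x hx]
    exact (φ ⟨x, hx⟩).2
  -- `f` never enters `T` from outside `S`. Two meeting orbits can thus be traced back step by step,
  -- and they reach `T` only at their starting points, at the same time.
  have orbit_inj : ∀ a b t t', t ∈ T → t' ∈ T → (∀ i < a, f^[i] t ∉ S) → (∀ i < b, f^[i] t' ∉ S) →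
      f^[a] t = f^[b] t' → a = b ∧ t = t' := by
    intro a
    induction a with
    | zero =>
      intro b t t' ht ht' _ hb h
      cases b with
      | zero => exact ⟨rfl, h⟩
      | succ b =>
        rw [Function.iterate_succ_apply'] at h
        exact absurd (show f (f^[b] t') ∈ T from h ▸ ht) (hT _ (hb b b.lt_succ_self))
    | succ a ih =>
      intro b t t' ht ht' ha hb h
      cases b with
      | zero =>
        rw [Function.iterate_succ_apply'] at h
        exact absurd (show f (f^[a] t) ∈ T from h ▸ ht') (hT _ (ha a a.lt_succ_self))
      | succ b =>
        rw [Function.iterate_succ_apply', Function.iterate_succ_apply'] at h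
        have h1 := ih b t t' ht ht' (fun i hi => ha i (by omega)) (fun i hi => hb i (by omega))
          (hinj _ _ (ha a a.lt_succ_self) (hb b b.lt_succ_self) h)
        exact ⟨by omega, h1.2⟩
  have hex : ∃ t ∈ T, ∀ k, f^[k] t ∉ S := by
    by_contra! hne
    choose! n hn using hne
    have hex' : ∀ t ∈ T, ∃ k, f^[k] t ∈ S := fun t ht => ⟨n t, hn t ht⟩
    -- The first visit to `S` would embed `T` into `S`.
    let e : α → α := fun t => if ht : ∃ k, f^[k] t ∈ S then f^[Nat.find ht] t else t
    refine absurd (Set.ncard_le_ncard_of_injOn e (s := T) (t := S) (fun t ht => ?_) ?_ hS)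
      (not_le.2 hST)
    · simp only [e, dif_pos (hex' t ht)]
      exact Nat.find_spec (hex' t ht)
    · intro t ht t' ht' h
      simp only [e, dif_pos (hex' t ht), dif_pos (hex' t' ht')] at h
      exact (orbit_inj _ _ t t' ht ht' (fun i hi => Nat.find_min (hex' t ht) hi)
        (fun i hi => Nat.find_min (hex' t' ht') hi) h).2
  obtain ⟨t, ht, htS⟩ := hex
  refine ⟨fun k => ⟨f^[k] t, htS k⟩, fun i j h => ?_, fun k => ?_⟩
  · exact (orbit_inj i j t t ht ht (fun k _ => htS k) (fun k _ => htS k) h).1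
  · change f^[k + 1] t = _
    rw [Function.iterate_succ_apply', hf _ (htS k)]

end Orbit

/-! ### Singularity for small noise -/

section Tame

variable {d : ℕ} {σ : ℝ}

/-- Along every long enough self-avoiding path, the displacements add up to less than half of
the length of the path. -/
def Tame (y : (Fin d → ℤ) → EuclideanSpace ℝ (Fin d)) : Prop :=
  ∀ x₀ : Fin d → ℤ, ∃ n₀ : ℕ, ∀ n ≥ n₀, ∀ u : ℕ → (Fin d → ℤ), u 0 = x₀ →
    Set.InjOn u (Finset.range (n + 1)) →
      ∑ k ∈ Finset.range (n + 1), ‖y (u k)‖ <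
        (∑ k ∈ Finset.range n, ‖latticePoint (u (k + 1) - u k)‖) / 2

/-- On an orbit of the label matching, each step is a difference of one displacement from `y` and
one from `y'`. The length of the orbit is therefore at most the sum of the two totals, each of which
is less than half of it. -/
theorem labelConfig_ne_of_tame {S T : Set (Fin d → ℤ)} (hS : S.Finite)
    (hST : S.ncard < T.ncard) {y y' : (Fin d → ℤ) → EuclideanSpace ℝ (Fin d)} (hy : Tame y)
    (hy' : Tame y') (hg : y ∈ goodLabels d) (hg' : y' ∈ goodLabels d) :
    labelConfig S y ≠ labelConfig T y' := by
  intro heq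
  obtain ⟨φ, hφ⟩ := exists_equiv_of_labelConfig_eq hg hg' heq
  obtain ⟨u, hu, hu'⟩ := exists_injective_orbit hS hST φ
  obtain ⟨n₁, h1⟩ := hy (u 0)
  obtain ⟨n₂, h2⟩ := hy' (u 0)
  have h3 := h1 (max n₁ n₂) (le_max_left _ _) (fun k => u k) rfl hu.injOn
  have h4 := h2 (max n₁ n₂) (le_max_right _ _) (fun k => u k) rfl hu.injOn
  set n := max n₁ n₂
  have h5 : ∀ k, ‖latticePoint ((u (k + 1) : Fin d → ℤ) - (u k : Fin d → ℤ))‖ ≤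
      ‖y (u k)‖ + ‖y' (u (k + 1))‖ := by
    intro k
    have h6 := hφ (u k)
    rw [← hu' k] at h6
    have h7 : latticePoint ((u (k + 1) : Fin d → ℤ) - (u k : Fin d → ℤ)) = y (u k) - y' (u (k + 1)) := by
      rw [latticePoint_sub, sub_eq_sub_iff_add_eq_add, ← h6, add_comm]
    rw [h7]
    exact norm_sub_le _ _
  have h6 := Finset.sum_le_sum fun k (_ : k ∈ Finset.range n) => h5 k
  rw [Finset.sum_add_distrib] at h6
  -- The steps use `y` at times `0, …, n - 1` and `y'` at times `1, …, n`; the missing end terms are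
  -- nonnegative.
  have h7 := Finset.sum_range_succ (fun k => ‖y (u k)‖) n
  have h8 := Finset.sum_range_succ' (fun k => ‖y' (u k)‖) n
  have h9 := norm_nonneg (y (u n))
  have h10 := norm_nonneg (y' (u 0))
  linarith

/-- The path with the given starting point and steps. -/
def pathOfSteps {n : ℕ} (x₀ : Fin d → ℤ) (w : Fin n → Fin d → ℤ) (k : ℕ) : Fin d → ℤ :=
  x₀ + ∑ i ∈ Finset.range k, if h : i < n then w ⟨i, h⟩ else 0

theorem pathOfSteps_succ_sub {n : ℕ} (x₀ : Fin d → ℤ) (w : Fin n → Fin d → ℤ) (k : Fin n) :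
    pathOfSteps x₀ w (k + 1) - pathOfSteps x₀ w k = w k := by
  simp [pathOfSteps, Finset.sum_range_succ]

theorem pathOfSteps_eq {n : ℕ} (u : ℕ → Fin d → ℤ) {k : ℕ} (hk : k ≤ n) :
    pathOfSteps (u 0) (fun i : Fin n => u (i + 1) - u i) k = u k := by
  have h1 : ∀ i ∈ Finset.range k, (if h : i < n then u (i + 1) - u i else 0) = u (i + 1) - u i :=
    fun i hi => dif_pos ((Finset.mem_range.1 hi).trans_le hk)
  rw [pathOfSteps, Finset.sum_congr rfl h1, Finset.sum_range_sub]
  abel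

/-- Markov's inequality for the exponential of the sum, with independence over `J`. -/
theorem displacementLaw_sum_norm_ge_le {J : Finset (Fin d → ℤ)} {a : ℝ} (ha : 0 < a) (r : ℝ) :
    displacementLaw d σ {y | r ≤ ∑ x ∈ J, ‖y x‖} ≤
      ENNReal.ofReal (Real.exp (-(a * r))) *
        (∫⁻ y, ENNReal.ofReal (Real.exp (a * ‖y‖)) ∂siteGaussian d σ) ^ J.card := by
  have hm : Measurable fun z : EuclideanSpace ℝ (Fin d) => ENNReal.ofReal (Real.exp (a * ‖z‖)) := by
    fun_prop
  have h1 : ∫⁻ y, ∏ x ∈ J, ENNReal.ofReal (Real.exp (a * ‖y x‖)) ∂displacementLaw d σ =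
      (∫⁻ y, ENNReal.ofReal (Real.exp (a * ‖y‖)) ∂siteGaussian d σ) ^ J.card := by
    have h2 := lintegral_prod_eq_prod_lintegral_of_indepFun (μ := displacementLaw d σ) J
      (fun x y => ENNReal.ofReal (Real.exp (a * ‖y x‖)))
      (iIndepFun_infinitePi (P := fun _ : Fin d → ℤ => siteGaussian d σ)
        (X := fun _ z => ENNReal.ofReal (Real.exp (a * ‖z‖))) (fun _ => hm))
      (fun x => hm.comp (measurable_pi_apply x))
    rw [h2, ← Finset.prod_const]
    refine Finset.prod_congr rfl fun x _ => ?_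
    exact (measurePreserving_eval_displacementLaw x).lintegral_comp hm
  have h3 := meas_ge_le_lintegral_div (μ := displacementLaw d σ)
    (f := fun y => ∏ x ∈ J, ENNReal.ofReal (Real.exp (a * ‖y x‖)))
    (Finset.measurable_prod J fun x _ => hm.comp (measurable_pi_apply x)).aemeasurable
    (ε := ENNReal.ofReal (Real.exp (a * r))) (by simp [Real.exp_pos]) (by simp)
  refine (measure_mono fun y hy => ?_).trans (h3.trans (le_of_eq ?_))
  · simp only [Set.mem_ofPred_eq] at hy ⊢
    rw [← ENNReal.ofReal_prod_of_nonneg (fun _ _ => (Real.exp_pos _).le), ← Real.exp_sum,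
      ← Finset.mul_sum]
    exact ENNReal.ofReal_le_ofReal (Real.exp_le_exp.2 (by gcongr))
  · rw [h1, div_eq_mul_inv, ← ENNReal.ofReal_inv_of_pos (Real.exp_pos _), ← Real.exp_neg, mul_comm]

-- A union bound over self-avoiding paths of `n` steps. The exponential bounds factor over the
-- steps, the total is at most `M * 2⁻¹ ^ n`, and Borel–Cantelli applies. The rate `a / 2` comes
-- from the threshold of half the length.
open Classical in
theorem ae_tame {a : ℝ} (ha : 0 < a)
    (hZ : (∫⁻ y, ENNReal.ofReal (Real.exp (a * ‖y‖)) ∂siteGaussian d σ) *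
      ∑' x : Fin d → ℤ, (if x = 0 then 0 else
        ENNReal.ofReal (Real.exp (-(a / 2 * ‖latticePoint x‖)))) ≤ 2⁻¹) :
    ∀ᵐ y ∂displacementLaw d σ, Tame y := by
  set M := ∫⁻ y, ENNReal.ofReal (Real.exp (a * ‖y‖)) ∂siteGaussian d σ with hM
  have hM' : M < ⊤ := lintegral_exp_norm_siteGaussian_lt_top a
  -- The zero step does not occur in a self-avoiding path, and it must be left out: its weight one
  -- would keep the sum from being small.
  set f : (Fin d → ℤ) → ℝ≥0∞ := fun x => if x = 0 then 0 else
        ENNReal.ofReal (Real.exp (-(a / 2 * ‖latticePoint x‖))) with hf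
  have hf' : ∑' x, f x < ⊤ := by
    refine lt_of_le_of_lt (ENNReal.tsum_le_tsum fun x => ?_)
      (tsum_exp_neg_norm_latticePoint_lt_top (d := d) (half_pos ha))
    by_cases hx : x = 0
    · simp [hf, hx]
    · simp [hf, hx]
  refine ae_all_iff.2 fun x₀ => ?_
  let B : ℕ → Set ((Fin d → ℤ) → EuclideanSpace ℝ (Fin d)) := fun n =>
    ⋃ (w : Fin n → Fin d → ℤ) (_ : Set.InjOn (pathOfSteps x₀ w) (Finset.range (n + 1))),
      {y | (∑ i, ‖latticePoint (w i)‖) / 2 ≤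
        ∑ x ∈ (Finset.range (n + 1)).image (pathOfSteps x₀ w), ‖y x‖}
  have hB : ∀ n, displacementLaw d σ (B n) ≤ M * 2⁻¹ ^ n := by
    intro n
    have h1 : ∀ w : Fin n → Fin d → ℤ, displacementLaw d σ
        (⋃ (_ : Set.InjOn (pathOfSteps x₀ w) (Finset.range (n + 1))),
      {y | (∑ i, ‖latticePoint (w i)‖) / 2 ≤
        ∑ x ∈ (Finset.range (n + 1)).image (pathOfSteps x₀ w), ‖y x‖}) ≤
        M ^ (n + 1) * ∏ i, f (w i) := by
      intro w
      by_cases hw : Set.InjOn (pathOfSteps x₀ w) (Finset.range (n + 1))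
      swap
      · simp only [hw, Set.iUnion_false, measure_empty, zero_le]
      simp only [hw, Set.iUnion_true]
      refine (displacementLaw_sum_norm_ge_le ha _).trans (le_of_eq ?_)
      rw [Finset.card_image_of_injOn hw, Finset.card_range, mul_comm]
      congr 1
      have hw0 : ∀ i, w i ≠ 0 := by
        intro i hi
        have h2 := pathOfSteps_succ_sub x₀ w i
        rw [hi, sub_eq_zero] at h2
        have := hw (by simp) (by simp) h2
        omega
      have h3 : ∀ i, f (w i) = ENNReal.ofReal (Real.exp (-(a / 2 * ‖latticePoint (w i)‖))) :=
        fun i => if_neg (hw0 i)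
      simp only [h3]
      rw [← ENNReal.ofReal_prod_of_nonneg (fun _ _ => (Real.exp_pos _).le), ← Real.exp_sum,
        Finset.sum_neg_distrib, ← Finset.mul_sum]
      congr 3
      ring
    refine (measure_iUnion_le _).trans ((ENNReal.tsum_le_tsum h1).trans ?_)
    rw [ENNReal.tsum_mul_left, tsum_pi_prod_eq f hf', pow_succ', mul_assoc, ← mul_pow]
    gcongr
  have hsum : ∑' n, displacementLaw d σ (B n) ≠ ⊤ := by
    refine ne_top_of_le_ne_top ?_ (ENNReal.tsum_le_tsum hB)
    rw [ENNReal.tsum_mul_left, ENNReal.tsum_geometric]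
    refine ENNReal.mul_ne_top hM'.ne ?_
    simp
  filter_upwards [ae_eventually_notMem hsum] with y hy
  obtain ⟨n₀, hn₀⟩ := Filter.eventually_atTop.1 hy
  refine ⟨n₀, fun n hn u hu0 hu => ?_⟩
  by_contra! hlt
  refine hn₀ n hn (Set.mem_iUnion.2 ⟨fun i => u (i + 1) - u i, ?_⟩)
  have h1 : ∀ k ∈ Finset.range (n + 1),
      pathOfSteps x₀ (fun i : Fin n => u (i + 1) - u i) k = u k := fun k hk => by
    rw [← hu0]
    exact pathOfSteps_eq u (by simpa [Nat.lt_succ_iff] using hk)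
  have h2 : Set.InjOn (pathOfSteps x₀ (fun i : Fin n => u (i + 1) - u i))
      (Finset.range (n + 1)) := by
    intro i hi j hj hij
    rw [h1 i hi, h1 j hj] at hij
    exact hu hi hj hij
  refine Set.mem_iUnion.2 ⟨h2, ?_⟩
  rw [Set.mem_ofPred_eq, Finset.sum_image h2,
    Fin.sum_univ_eq_sum_range (fun i => ‖latticePoint (u (i + 1) - u i)‖),
    Finset.sum_congr rfl fun k hk => congrArg (fun x => ‖y x‖) (h1 k hk)]
  exact hlt

open Classical in
theorem exists_pos_ae_tame (d : ℕ) : ∃ σ : ℝ, 0 < σ ∧ ∀ᵐ y ∂displacementLaw d σ, Tame y := by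
  set M := ∫⁻ y, ENNReal.ofReal (Real.exp (1 * ‖y‖)) ∂siteGaussian d 1 with hM
  have hM' : M < ⊤ := lintegral_exp_norm_siteGaussian_lt_top 1
  set Z := ∑' x : Fin d → ℤ, ENNReal.ofReal (Real.exp (-(1 * ‖latticePoint x‖))) with hZ
  have hZ' : Z < ⊤ := tsum_exp_neg_norm_latticePoint_lt_top one_pos
  set K := (M * Z).toReal with hK
  have hK0 : 0 ≤ K := ENNReal.toReal_nonneg
  set t := Real.log (2 * K + 1) with ht
  have ht0 : 0 ≤ t := Real.log_nonneg (by linarith)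
  -- Half of `a` is `1 + t`: the part `1` keeps the lattice sum finite, and the part `t` gains `exp
  -- (-t) = 1 / (2 * K + 1)` because nonzero lattice points have norm at least one.
  set a := 2 + 2 * t with ha
  have ha0 : 0 < a := by positivity
  refine ⟨a⁻¹, inv_pos.2 ha0, ae_tame ha0 ?_⟩
  have h1 : (∑' x : Fin d → ℤ, (if x = 0 then 0 else
        ENNReal.ofReal (Real.exp (-(a / 2 * ‖latticePoint x‖))))) ≤
      Z * ENNReal.ofReal (Real.exp (-t)) := by
    rw [hZ, ← ENNReal.tsum_mul_right]
    refine ENNReal.tsum_le_tsum fun x => ?_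
    by_cases hx : x = 0
    · simp [hx]
    · rw [if_neg hx, ← ENNReal.ofReal_mul (Real.exp_pos _).le, ← Real.exp_add]
      refine ENNReal.ofReal_le_ofReal (Real.exp_le_exp.2 ?_)
      have := one_le_norm_latticePoint hx
      rw [ha]
      nlinarith
  calc _ ≤ M * (Z * ENNReal.ofReal (Real.exp (-t))) := by
        gcongr
        exact lintegral_exp_norm_siteGaussian_le (inv_pos.2 ha0).le (mul_inv_cancel₀ ha0.ne').le
    _ = ENNReal.ofReal (K * Real.exp (-t)) := by
        rw [← mul_assoc, ENNReal.ofReal_mul hK0, hK,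
          ENNReal.ofReal_toReal (ENNReal.mul_lt_top hM' hZ').ne]
    _ ≤ ENNReal.ofReal (2⁻¹) := by
        refine ENNReal.ofReal_le_ofReal ?_
        rw [ht, Real.exp_neg, Real.exp_log (by linarith), ← div_eq_mul_inv,
          div_le_iff₀ (by linarith)]
        linarith
    _ = 2⁻¹ := by rw [ENNReal.ofReal_inv_of_pos two_pos]; simp

theorem exists_pos_mutuallySingular_latticeLaw (hd : 0 < d) :
    ∃ σ : ℝ, 0 < σ ∧ ∀ S T : Set (Fin d → ℤ), S.Finite → T.Finite → S.ncard ≠ T.ncard →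
      latticeLaw σ S ⟂ₘ latticeLaw σ T := by
  obtain ⟨σ, hσ, ht⟩ := exists_pos_ae_tame d
  refine ⟨σ, hσ, ?_⟩
  -- A measurable null set covers the labellings that are not tame, so measurability of `Tame`
  -- itself is not needed.
  obtain ⟨N, hN, hNm, hN0⟩ := exists_measurable_superset_of_null (ae_iff.1 ht)
  have hmem : ∀ᵐ y ∂displacementLaw d σ, y ∈ Nᶜ := by
    simpa [ae_iff] using hN0
  have htame : ∀ y ∈ Nᶜ, Tame y := fun y hy => by
    by_contra h
    exact hy (hN h)
  have key : ∀ S T : Set (Fin d → ℤ), S.Finite → S.ncard < T.ncard →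
      latticeLaw σ S ⟂ₘ latticeLaw σ T := fun S T hS hST =>
    mutuallySingular_latticeLaw_of_ae hd hσ hNm.compl hNm.compl hmem hmem
      fun y hy hg y' hy' hg' => labelConfig_ne_of_tame hS hST (htame y hy) (htame y' hy') hg hg'
  intro S T hS hT hne
  rcases lt_or_gt_of_ne hne with h | h
  · exact key S T hS h
  · exact (key T S hT h).symm

end Tame

/-! ### A random path with summable meeting probabilities -/

section RandomPath

/-- The scale of the step from time `s` to time `s + 1`. -/
def stepScale (s : ℕ) : ℕ := padicValNat 2 (s + 1)

/-- The position of the step from time `s` to time `s + 1` among the steps of its scale. -/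
def stepIndex (s : ℕ) : ℕ := (s + 1) / 2 ^ (stepScale s + 1)

/-- The block, consisting of `4 ^ j` consecutive steps of scale `j`, to which a step belongs. -/
def stepBlock (s : ℕ) : ℕ × ℕ := (stepScale s, stepIndex s / 4 ^ stepScale s)

/-- The position of a step in its block. -/
def stepRank (s : ℕ) : ℕ := stepIndex s % 4 ^ stepScale s

/-- Steps of scale `j` are those with `s + 1` an odd multiple of `2 ^ j`. They recur with period `2
* 2 ^ j`, so a block of `4 ^ j` of them lasts for a time `2 * 8 ^ j`. -/
theorem stepScale_stepIndex (s : ℕ) : s + 1 = 2 ^ stepScale s * (2 * stepIndex s + 1) := by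
  obtain ⟨q, hq⟩ : 2 ^ stepScale s ∣ s + 1 := pow_padicValNat_dvd
  have hodd : q % 2 = 1 := by
    by_contra h
    have h0 : q % 2 = 0 := by omega
    obtain ⟨c, rfl⟩ := Nat.dvd_of_mod_eq_zero h0
    have h1 : 2 ^ (padicValNat 2 (s + 1) + 1) ∣ s + 1 :=
      ⟨c, by rw [pow_succ, mul_assoc]; exact hq⟩
    exact pow_succ_padicValNat_not_dvd (p := 2) s.succ_ne_zero h1
  have h2 : stepIndex s = q / 2 := by
    rw [stepIndex, hq, pow_succ]
    exact Nat.mul_div_mul_left _ _ (by positivity)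
  rw [h2]
  conv_lhs => rw [hq]
  congr 1
  omega

theorem stepScale_eq (j i : ℕ) : stepScale (2 ^ j * (2 * i + 1) - 1) = j := by
  have h1 : 2 ^ j * (2 * i + 1) - 1 + 1 = 2 ^ j * (2 * i + 1) :=
    Nat.sub_add_cancel (Nat.mul_pos (by positivity) (by omega))
  rw [stepScale, h1, padicValNat.mul (by positivity) (by omega), padicValNat.prime_pow,
    padicValNat.eq_zero_of_not_dvd (by omega), add_zero]

theorem stepIndex_eq (j i : ℕ) : stepIndex (2 ^ j * (2 * i + 1) - 1) = i := by
  have h1 : 2 ^ j * (2 * i + 1) - 1 + 1 = 2 ^ j * (2 * i + 1) :=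
    Nat.sub_add_cancel (Nat.mul_pos (by positivity) (by omega))
  rw [stepIndex, stepScale_eq, h1, pow_succ, Nat.mul_div_mul_left _ _ (by positivity)]
  omega

/-- The lateral step at time `s`, where `ξ` are the displacements of the blocks. -/
def lateralStep (ξ : ℕ × ℕ → ℕ × ℕ) (s : ℕ) : ℕ × ℕ :=
  (if stepRank s < (ξ (stepBlock s)).1 then 1 else 0,
    if stepRank s < (ξ (stepBlock s)).2 then 1 else 0)

/-- The lateral position at time `t`. -/
def lateral (ξ : ℕ × ℕ → ℕ × ℕ) (t : ℕ) : ℕ × ℕ := ∑ s ∈ Finset.range t, lateralStep ξ s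

/-- The total lateral displacement in a block of scale `j`. -/
def blockDisplacement (j : ℕ) (v : ℕ × ℕ) : ℕ × ℕ := (min v.1 (4 ^ j), min v.2 (4 ^ j))

theorem block_le_of_stepBlock_eq {s j m : ℕ} (h : stepBlock s = (j, m)) :
    m * (2 * 8 ^ j) ≤ s ∧ s < (m + 1) * (2 * 8 ^ j) := by
  have h1 := stepScale_stepIndex s
  simp only [stepBlock, Prod.mk.injEq] at h
  obtain ⟨h2, h3⟩ := h
  rw [h2] at h1 h3
  have h4 : m * 4 ^ j ≤ stepIndex s := by rw [← h3]; exact Nat.div_mul_le_self _ _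
  have h5 : stepIndex s < (m + 1) * 4 ^ j := by
    rw [← h3, mul_comm]; exact Nat.lt_mul_div_succ _ (by positivity)
  have h6 : (8 : ℕ) ^ j = 2 ^ j * 4 ^ j := by rw [← mul_pow]; norm_num
  have h7 : (0 : ℕ) < 2 ^ j := by positivity
  rw [h6]
  constructor
  · have : 2 ^ j * (2 * (m * 4 ^ j)) ≤ 2 ^ j * (2 * stepIndex s) := by gcongr
    nlinarith
  · have : 2 ^ j * (2 * stepIndex s + 2) ≤ 2 ^ j * (2 * ((m + 1) * 4 ^ j)) := by
      gcongr; omega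
    nlinarith

theorem sum_range_ite_lt (a M : ℕ) :
    ∑ r ∈ Finset.range M, (if r < a then 1 else 0) = min a M := by
  rw [Finset.sum_boole]
  have : (Finset.range M).filter (· < a) = Finset.range (min a M) := by
    ext r; simp; omega
  rw [this]
  simp

theorem sum_block_lateralStep (ξ : ℕ × ℕ → ℕ × ℕ) {j m t : ℕ} (h : (m + 1) * (2 * 8 ^ j) ≤ t) :
    ∑ s ∈ (Finset.range t).filter (fun s => stepBlock s = (j, m)), lateralStep ξ s =
      blockDisplacement j (ξ (j, m)) := by
  have hM : (0 : ℕ) < 4 ^ j := by positivity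
  have hidx : ∀ r < 4 ^ j, stepBlock (2 ^ j * (2 * (4 ^ j * m + r) + 1) - 1) = (j, m) := by
    intro r hr
    rw [stepBlock, stepIndex_eq, stepScale_eq, Nat.mul_add_div hM, Nat.div_eq_of_lt hr, add_zero]
  have h1 : ∑ s ∈ (Finset.range t).filter (fun s => stepBlock s = (j, m)), lateralStep ξ s =
      ∑ r ∈ Finset.range (4 ^ j), ((if r < (ξ (j, m)).1 then 1 else 0,
        if r < (ξ (j, m)).2 then 1 else 0) : ℕ × ℕ) := by
    refine Finset.sum_nbij' stepRank (fun r => 2 ^ j * (2 * (4 ^ j * m + r) + 1) - 1)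
      (fun s hs => ?_) (fun r hr => ?_) (fun s hs => ?_) (fun r hr => ?_) (fun s hs => ?_)
    · have hs' := (Finset.mem_filter.1 hs).2
      simp only [stepBlock, Prod.mk.injEq] at hs'
      rw [Finset.mem_range, stepRank, hs'.1]
      exact Nat.mod_lt _ hM
    · have hr' := hidx r (Finset.mem_range.1 hr)
      refine Finset.mem_filter.2 ⟨Finset.mem_range.2 ?_, hr'⟩
      exact (block_le_of_stepBlock_eq hr').2.trans_le h
    · have hs' := (Finset.mem_filter.1 hs).2
      simp only [stepBlock, Prod.mk.injEq] at hs'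
      obtain ⟨hj, hm⟩ := hs'
      have h2 := stepScale_stepIndex s
      have h3 := Nat.div_add_mod (stepIndex s) (4 ^ j)
      rw [hj] at h2 hm
      simp only [stepRank, hj]
      rw [hm] at h3
      rw [h3, ← h2]
      rfl
    · rw [stepRank, stepIndex_eq, stepScale_eq, Nat.mul_add_mod,
        Nat.mod_eq_of_lt (Finset.mem_range.1 hr)]
    · rw [lateralStep, (Finset.mem_filter.1 hs).2]
  rw [h1]
  refine Prod.ext ?_ ?_
  · rw [Prod.fst_sum]; exact sum_range_ite_lt _ _
  · rw [Prod.snd_sum]; exact sum_range_ite_lt _ _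

theorem lateralStep_update_of_ne (ξ : ℕ × ℕ → ℕ × ℕ) {p : ℕ × ℕ} (v : ℕ × ℕ) {s : ℕ}
    (h : stepBlock s ≠ p) : lateralStep (Function.update ξ p v) s = lateralStep ξ s := by
  rw [lateralStep, Function.update_of_ne h, lateralStep]

/-- A block that is over influences the position only through its total displacement, so redrawing
it adds an independent uniform vector to the rest. -/
theorem lateral_update (ξ : ℕ × ℕ → ℕ × ℕ) {j m t : ℕ} (h : (m + 1) * (2 * 8 ^ j) ≤ t)
    (v : ℕ × ℕ) : lateral (Function.update ξ (j, m) v) t = blockDisplacement j v +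
      ∑ s ∈ (Finset.range t).filter (fun s => ¬stepBlock s = (j, m)), lateralStep ξ s := by
  rw [lateral, ← Finset.sum_filter_add_sum_filter_not _ (fun s => stepBlock s = (j, m)),
    sum_block_lateralStep _ h, Function.update_self]
  congr 1
  exact Finset.sum_congr rfl fun s hs => lateralStep_update_of_ne ξ v (Finset.mem_filter.1 hs).2

theorem lateral_update_of_le (ξ : ℕ × ℕ → ℕ × ℕ) {j m t : ℕ} (h : t ≤ m * (2 * 8 ^ j))
    (v : ℕ × ℕ) : lateral (Function.update ξ (j, m) v) t = lateral ξ t := by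
  refine Finset.sum_congr rfl fun s hs => lateralStep_update_of_ne ξ v fun hs' => ?_
  have h1 := (block_le_of_stepBlock_eq hs').1
  have h2 := Finset.mem_range.1 hs
  omega

/-- The law of the displacement in a block: uniform on a square. -/
noncomputable def blockLaw (j : ℕ) : Measure (ℕ × ℕ) :=
  (PMF.uniformOfFintype (Fin (4 ^ j) × Fin (4 ^ j))).toMeasure.map
    (fun v => ((v.1 : ℕ), (v.2 : ℕ)))

instance (j : ℕ) : IsProbabilityMeasure (blockLaw j) :=
  Measure.isProbabilityMeasure_map (by fun_prop)

theorem blockLaw_blockDisplacement_le (j : ℕ) (a : ℕ × ℕ) :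
    blockLaw j {v | blockDisplacement j v = a} ≤ (16 ^ j)⁻¹ := by
  rw [blockLaw, Measure.map_apply (by fun_prop) (MeasurableSet.of_discrete)]
  have hsub : (((fun v : Fin (4 ^ j) × Fin (4 ^ j) => ((v.1 : ℕ), (v.2 : ℕ))) ⁻¹'
      {v | blockDisplacement j v = a})).Subsingleton := by
    rintro ⟨v, v'⟩ hv ⟨w, w'⟩ hw
    simp only [Set.mem_preimage, Set.mem_ofPred_eq, blockDisplacement] at hv hw
    rw [min_eq_left v.2.le, min_eq_left v'.2.le] at hv
    rw [min_eq_left w.2.le, min_eq_left w'.2.le, ← hv, Prod.mk.injEq] at hw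
    exact Prod.ext (Fin.ext hw.1.symm) (Fin.ext hw.2.symm)
  rcases hsub.eq_empty_or_singleton with h | ⟨v, h⟩
  · rw [h]; simp
  · rw [h, PMF.toMeasure_apply_singleton _ _ (measurableSet_singleton v),
      PMF.uniformOfFintype_apply]
    simp only [Fintype.card_prod, Fintype.card_fin]
    rw [← mul_pow]
    norm_num

/-- The law of the displacements of all blocks. -/
noncomputable def pathLaw : Measure (ℕ × ℕ → ℕ × ℕ) :=
  Measure.infinitePi fun p => blockLaw p.1

instance : IsProbabilityMeasure pathLaw := by unfold pathLaw; infer_instance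

theorem measurable_lateralStep (s : ℕ) : Measurable (fun ξ => lateralStep ξ s) :=
  (Measurable.of_discrete (f := fun v : ℕ × ℕ => ((if stepRank s < v.1 then 1 else 0,
    if stepRank s < v.2 then 1 else 0) : ℕ × ℕ))).comp (measurable_pi_apply (stepBlock s))

theorem measurable_lateral (t : ℕ) : Measurable (fun ξ => lateral ξ t) :=
  Finset.measurable_fun_sum _ fun s _ => measurable_lateralStep s

/-- A bound for the probability that the path is at a given place, when the path is known up to
the time `g` before. -/
noncomputable def gapBound (g : ℕ) : ℝ≥0∞ := (16 ^ Nat.log 8 (g / 4))⁻¹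

/-- As `16 = 8 ^ (4 / 3)`, the bound decays like `g ^ (-4 / 3)`. A single lateral coordinate would
give `4` instead of `16`, and the divergent exponent `2 / 3`. -/
theorem tsum_gapBound_lt_top : ∑' g, gapBound g < ⊤ := by
  have h1 : Summable fun g : ℕ => (64 : ℝ) ^ (4 / 3 : ℝ) * (1 / (g : ℝ) ^ (4 / 3 : ℝ)) :=
    (Real.summable_one_div_nat_rpow.2 (by norm_num)).mul_left _
  rw [tsum_eq_zero_add' ENNReal.summable]
  have h2 : ∀ g : ℕ, gapBound (g + 1) ≤
      ENNReal.ofReal ((64 : ℝ) ^ (4 / 3 : ℝ) * (1 / ((g + 1 : ℕ) : ℝ) ^ (4 / 3 : ℝ))) := by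
    intro g
    set l := Nat.log 8 ((g + 1) / 4) with hl
    have h3 : (g + 1) / 4 < 8 ^ (l + 1) := Nat.lt_pow_succ_log_self (by norm_num) _
    have h4 : g + 1 ≤ 64 * 8 ^ l := by rw [pow_succ] at h3; omega
    have h5 : ((g + 1 : ℕ) : ℝ) ≤ 64 * 8 ^ l := by exact_mod_cast h4
    have h6 : ((8 : ℝ) ^ l) ^ (4 / 3 : ℝ) = 16 ^ l := by
      have h8 : (8 : ℝ) ^ l = (2 : ℝ) ^ ((3 * l : ℕ) : ℝ) := by
        rw [Real.rpow_natCast, pow_mul]; norm_num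
      have h16 : (16 : ℝ) ^ l = (2 : ℝ) ^ ((4 * l : ℕ) : ℝ) := by
        rw [Real.rpow_natCast, pow_mul]; norm_num
      rw [h8, h16, ← Real.rpow_mul (by norm_num)]
      congr 1
      push_cast
      ring
    have h7 : ((g + 1 : ℕ) : ℝ) ^ (4 / 3 : ℝ) ≤ (64 : ℝ) ^ (4 / 3 : ℝ) * 16 ^ l := by
      rw [← h6, ← Real.mul_rpow (by norm_num) (by positivity)]
      exact Real.rpow_le_rpow (by positivity) h5 (by norm_num)
    have h8 : gapBound (g + 1) = ENNReal.ofReal ((16 ^ l)⁻¹) := by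
      rw [gapBound, ENNReal.ofReal_inv_of_pos (by positivity), ENNReal.ofReal_pow (by norm_num)]
      simp [hl]
    rw [h8]
    refine ENNReal.ofReal_le_ofReal ?_
    rw [mul_one_div, inv_eq_one_div, div_le_div_iff₀ (by positivity) (by positivity), one_mul]
    exact h7
  refine ENNReal.add_lt_top.2 ⟨by simp [gapBound], ?_⟩
  exact lt_of_le_of_lt (ENNReal.tsum_le_tsum h2)
    (((summable_nat_add_iff 1).2 h1).tsum_ofReal_lt_top)

/-- The function is determined by the blocks which begin before time `t`. -/
def DependsOnPast (t : ℕ) (h : (ℕ × ℕ → ℕ × ℕ) → ℝ≥0∞) : Prop :=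
  ∀ ξ j m v, t ≤ m * (2 * 8 ^ j) → h (Function.update ξ (j, m) v) = h ξ

/-- The indicator of the event that the path is at `a` at time `t`. -/
noncomputable def atPlace (t : ℕ) (a : ℕ × ℕ) (ξ : ℕ × ℕ → ℕ × ℕ) : ℝ≥0∞ :=
  if lateral ξ t = a then 1 else 0

theorem measurable_atPlace (t : ℕ) (a : ℕ × ℕ) : Measurable (atPlace t a) :=
  (Measurable.of_discrete (f := fun b : ℕ × ℕ => (if b = a then 1 else 0 : ℝ≥0∞))).comp
    (measurable_lateral t)

theorem atPlace_le_one (t : ℕ) (a : ℕ × ℕ) (ξ : ℕ × ℕ → ℕ × ℕ) : atPlace t a ξ ≤ 1 := by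
  unfold atPlace; split_ifs <;> simp

theorem dependsOnPast_atPlace (t : ℕ) (a : ℕ × ℕ) : DependsOnPast t (atPlace t a) := by
  intro ξ j m v h
  rw [atPlace, lateral_update_of_le ξ h, atPlace]

/-- Between `t` and `t'` lies a whole block of scale `j`, which `h` does not see. With all other
blocks fixed, at most one of its `16 ^ j` equally likely values brings the path to `a`. -/
theorem lintegral_mul_atPlace_le {h : (ℕ × ℕ → ℕ × ℕ) → ℝ≥0∞} (hm : Measurable h) {t : ℕ}
    (hh : DependsOnPast t h) {t' : ℕ} (a : ℕ × ℕ) :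
    ∫⁻ ξ, h ξ * atPlace t' a ξ ∂pathLaw ≤ gapBound (t' - t) * ∫⁻ ξ, h ξ ∂pathLaw := by
  set j := Nat.log 8 ((t' - t) / 4) with hj
  rcases lt_or_ge (t' - t) 4 with hlt | hge
  · have : gapBound (t' - t) = 1 := by rw [gapBound, Nat.div_eq_of_lt hlt]; simp
    rw [this, one_mul]
    refine lintegral_mono fun ξ => ?_
    exact mul_le_of_le_one_right' (atPlace_le_one _ _ _)
  have h8 : 8 ^ j ≤ (t' - t) / 4 := Nat.pow_log_le_self 8 (by omega)
  have h8' : 4 * 8 ^ j ≤ t' - t := by omega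
  set T := 2 * 8 ^ j with hT
  have hT0 : 0 < T := by positivity
  -- The block begins at the first multiple of `T` from `t` on and ends before `t + 2 * T = t + 4 *
  -- 8 ^ j`; hence the division by `4` in `gapBound`.
  obtain ⟨m, hm1, hm2⟩ : ∃ m, t ≤ m * T ∧ (m + 1) * T ≤ t' := by
    refine ⟨(t + T - 1) / T, ?_, ?_⟩
    · have h2 := Nat.lt_mul_div_succ (t + T - 1) hT0
      rw [mul_comm, add_mul] at h2
      omega
    · have := Nat.div_mul_le_self (t + T - 1) T
      rw [add_mul]
      omega
  have hu := measurePreserving_update_infinitePi_prod (fun p : ℕ × ℕ => blockLaw p.1) (j, m)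
  have hmm : Measurable fun ξ => h ξ * atPlace t' a ξ := hm.mul (measurable_atPlace t' a)
  have hmu : Measurable fun p : (ℕ × ℕ → ℕ × ℕ) × ℕ × ℕ =>
      h (Function.update p.1 (j, m) p.2) * atPlace t' a (Function.update p.1 (j, m) p.2) :=
    hmm.comp hu.measurable
  rw [pathLaw, ← hu.lintegral_comp hmm, lintegral_prod _ hmu.aemeasurable,
    ← lintegral_const_mul _ hm]
  refine lintegral_mono fun ξ => ?_
  set R := ∑ s ∈ (Finset.range t').filter (fun s => ¬stepBlock s = (j, m)), lateralStep ξ s with hR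
  -- Truncated subtraction is harmless: if the path is at `a`, then `a` is `R` plus the displacement
  -- of the block.
  have h1 : ∀ v, h (Function.update ξ (j, m) v) * atPlace t' a (Function.update ξ (j, m) v) ≤
      h ξ * {v | blockDisplacement j v = (a.1 - R.1, a.2 - R.2)}.indicator 1 v := by
    intro v
    rw [hh ξ j m v hm1]
    gcongr
    rw [atPlace, lateral_update ξ hm2, ← hR]
    split_ifs with hv
    · rw [Set.indicator_of_mem]
      · rfl
      · rw [Set.mem_ofPred_eq, ← hv]
        simp
    · exact zero_le
  calc _ ≤ ∫⁻ v, h ξ * {v | blockDisplacement j v = (a.1 - R.1, a.2 - R.2)}.indicator 1 v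
          ∂blockLaw j := lintegral_mono h1
    _ = h ξ * blockLaw j {v | blockDisplacement j v = (a.1 - R.1, a.2 - R.2)} := by
        rw [lintegral_const_mul _ (by exact Measurable.of_discrete),
          lintegral_indicator_one MeasurableSet.of_discrete]
    _ ≤ h ξ * (16 ^ j)⁻¹ := by gcongr; exact blockLaw_blockDisplacement_le j _
    _ = gapBound (t' - t) * h ξ := by rw [mul_comm, gapBound]

/-- The product is expanded by the first index `k` at which the term `f k` is chosen. -/
theorem prod_Ioc_one_add (f : ℕ → ℝ≥0∞) {t n : ℕ} (h : t ≤ n) :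
    ∏ k ∈ Finset.Ioc t n, (1 + f k) =
      1 + ∑ k ∈ Finset.Ioc t n, f k * ∏ l ∈ Finset.Ioc k n, (1 + f l) := by
  obtain ⟨e, he⟩ := Nat.exists_eq_add_of_le h
  clear h
  induction e generalizing t with
  | zero => simp [he]
  | succ e ih =>
    have ih := ih (t := t + 1) (by omega)
    have h1 : Finset.Ioc t n = insert (t + 1) (Finset.Ioc (t + 1) n) := by
      ext k; simp only [Finset.mem_Ioc, Finset.mem_insert]; omega
    have h2 : t + 1 ∉ Finset.Ioc (t + 1) n := by simp
    rw [h1, Finset.prod_insert h2, Finset.sum_insert h2, add_mul, one_mul]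
    nth_rewrite 1 [ih]
    ring

/-- A renewal argument: at the first chosen visit `k`, the weight `h * atPlace k (a k)` is known at
time `k`, and induction bounds the remaining product by a factor `2`. Summing over `k` gives `1 + 2
* 2⁻¹ = 2`. -/
theorem lintegral_mul_prod_atPlace_le {θ : ℝ≥0∞} (hθ : θ * ∑' g, gapBound g ≤ 2⁻¹)
    (a : ℕ → ℕ × ℕ) {t n : ℕ} (htn : t ≤ n) {h : (ℕ × ℕ → ℕ × ℕ) → ℝ≥0∞} (hm : Measurable h)
    (hh : DependsOnPast t h) :
    ∫⁻ ξ, h ξ * ∏ k ∈ Finset.Ioc t n, (1 + θ * atPlace k (a k) ξ) ∂pathLaw ≤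
      2 * ∫⁻ ξ, h ξ ∂pathLaw := by
  induction hd : n - t using Nat.strong_induction_on generalizing t h with
  | _ e ih =>
  have hmp : ∀ k : ℕ, Measurable fun ξ => ∏ l ∈ Finset.Ioc k n, (1 + θ * atPlace l (a l) ξ) :=
    fun k => Finset.measurable_fun_prod _ fun l _ =>
      ((measurable_atPlace l (a l)).const_mul θ).const_add 1
  have h1 : ∀ ξ, h ξ * ∏ k ∈ Finset.Ioc t n, (1 + θ * atPlace k (a k) ξ) =
      h ξ + ∑ k ∈ Finset.Ioc t n, θ * (h ξ * atPlace k (a k) ξ *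
        ∏ l ∈ Finset.Ioc k n, (1 + θ * atPlace l (a l) ξ)) := by
    intro ξ
    rw [prod_Ioc_one_add _ htn, mul_add, mul_one, Finset.mul_sum]
    congr 1
    exact Finset.sum_congr rfl fun k _ => by ring
  have hm' : ∀ k, Measurable fun ξ => h ξ * atPlace k (a k) ξ := fun k =>
    hm.mul (measurable_atPlace k (a k))
  have hmk : ∀ k, Measurable fun ξ => h ξ * atPlace k (a k) ξ *
      ∏ l ∈ Finset.Ioc k n, (1 + θ * atPlace l (a l) ξ) := fun k => (hm' k).mul (hmp k)
  simp only [h1]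
  rw [lintegral_add_left hm, lintegral_finsetSum _ fun k _ => (hmk k).const_mul θ]
  have h2 : ∀ k ∈ Finset.Ioc t n, ∫⁻ ξ, θ * (h ξ * atPlace k (a k) ξ *
        ∏ l ∈ Finset.Ioc k n, (1 + θ * atPlace l (a l) ξ)) ∂pathLaw ≤
      θ * (2 * (gapBound (k - t) * ∫⁻ ξ, h ξ ∂pathLaw)) := by
    intro k hk
    have hk' := Finset.mem_Ioc.1 hk
    rw [lintegral_const_mul _ (hmk k)]
    gcongr
    refine (ih (n - k) (by omega) hk'.2 (hm' k) (fun ξ j m v hjm => ?_) rfl).trans ?_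
    · rw [hh ξ j m v (hk'.1.le.trans hjm), dependsOnPast_atPlace k (a k) ξ j m v hjm]
    · gcongr
      exact lintegral_mul_atPlace_le hm hh (a k)
  have h3 : ∑ k ∈ Finset.Ioc t n, gapBound (k - t) ≤ ∑' g, gapBound g := by
    have hinj : Set.InjOn (fun k => k - t) (Finset.Ioc t n : Set ℕ) := by
      intro k hk l hl hkl
      simp only [Finset.coe_Ioc, Set.mem_Ioc] at hk hl hkl
      omega
    rw [← Finset.sum_image (f := gapBound) hinj]
    exact ENNReal.sum_le_tsum _
  calc _ ≤ ∫⁻ ξ, h ξ ∂pathLaw +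
        ∑ k ∈ Finset.Ioc t n, θ * (2 * (gapBound (k - t) * ∫⁻ ξ, h ξ ∂pathLaw)) := by
        gcongr with k hk
        exact h2 k hk
    _ = ∫⁻ ξ, h ξ ∂pathLaw + 2 * (θ * ∑ k ∈ Finset.Ioc t n, gapBound (k - t)) *
          ∫⁻ ξ, h ξ ∂pathLaw := by
        congr 1
        rw [Finset.mul_sum, Finset.mul_sum, Finset.sum_mul]
        exact Finset.sum_congr rfl fun k _ => by ring
    _ ≤ ∫⁻ ξ, h ξ ∂pathLaw + 2 * 2⁻¹ * ∫⁻ ξ, h ξ ∂pathLaw := by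
        gcongr
        exact (mul_le_mul_right h3 θ).trans hθ
    _ = 2 * ∫⁻ ξ, h ξ ∂pathLaw := by
        rw [ENNReal.mul_inv_cancel (by simp) (by simp), one_mul, two_mul]

theorem lintegral_prod_atPlace_le {θ : ℝ≥0∞} (hθ : θ * ∑' g, gapBound g ≤ 2⁻¹)
    (a : ℕ → ℕ × ℕ) (n : ℕ) :
    ∫⁻ ξ, ∏ k ∈ Finset.range (n + 1), (1 + θ * atPlace k (a k) ξ) ∂pathLaw ≤ (1 + θ) * 2 := by
  -- The visit at time `0`, where all paths start, is not covered by the renewal bound and costs the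
  -- factor `1 + θ`.
  have h1 : Finset.range (n + 1) = insert 0 (Finset.Ioc 0 n) := by
    ext k; simp only [Finset.mem_range, Finset.mem_insert, Finset.mem_Ioc]; omega
  have hmp : Measurable fun ξ => ∏ l ∈ Finset.Ioc 0 n, (1 + θ * atPlace l (a l) ξ) :=
    Finset.measurable_fun_prod _ fun l _ => ((measurable_atPlace l (a l)).const_mul θ).const_add 1
  have h2 := lintegral_mul_prod_atPlace_le hθ a (Nat.zero_le n) (h := fun _ => 1)
    measurable_const (fun _ _ _ _ _ => rfl)
  simp only [one_mul, lintegral_one, measure_univ, mul_one] at h2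
  rw [h1]
  simp only [Finset.prod_insert (show 0 ∉ Finset.Ioc 0 n by simp)]
  calc _ ≤ ∫⁻ ξ, (1 + θ) * ∏ l ∈ Finset.Ioc 0 n, (1 + θ * atPlace l (a l) ξ) ∂pathLaw := by
        refine lintegral_mono fun ξ => ?_
        gcongr
        exact mul_le_of_le_one_right' (atPlace_le_one _ _ _)
    _ ≤ (1 + θ) * 2 := by
        rw [lintegral_const_mul _ hmp]
        gcongr

end RandomPath

/-! ### Shifting the lattice along the path -/

section Shift

variable {e : ℕ}

/-- The path in `ℤ^d` with the given lateral displacements. -/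
def pathPoint (ξ : ℕ × ℕ → ℕ × ℕ) (t : ℕ) : Fin (e + 3) → ℤ := fun i =>
  if i = 0 then (t : ℤ) else if i = 1 then ((lateral ξ t).1 : ℤ)
    else if i = 2 then ((lateral ξ t).2 : ℤ) else 0

theorem pathPoint_apply_zero (ξ : ℕ × ℕ → ℕ × ℕ) (t : ℕ) :
    (pathPoint ξ t : Fin (e + 3) → ℤ) 0 = t := by simp [pathPoint]

theorem pathPoint_zero (ξ : ℕ × ℕ → ℕ × ℕ) : (pathPoint ξ 0 : Fin (e + 3) → ℤ) = 0 := by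
  funext i
  simp [pathPoint, lateral]

theorem lateral_eq_of_pathPoint_eq {ξ ξ' : ℕ × ℕ → ℕ × ℕ} {t : ℕ}
    (h : (pathPoint ξ t : Fin (e + 3) → ℤ) = pathPoint ξ' t) : lateral ξ t = lateral ξ' t := by
  have h1 := congrFun h 1
  have h2 := congrFun h 2
  have hv : ((2 : Fin (e + 3)) : ℕ) = 2 := Nat.mod_eq_of_lt (show 2 < e + 3 by omega)
  have h20 : (2 : Fin (e + 3)) ≠ 0 := by
    rw [Ne, Fin.ext_iff, hv]
    simp
  have h21 : (2 : Fin (e + 3)) ≠ 1 := by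
    rw [Ne, Fin.ext_iff, hv]
    simp
  simp only [pathPoint, one_ne_zero, if_false, if_true, h20, h21] at h1 h2
  exact Prod.ext (by exact_mod_cast h1) (by exact_mod_cast h2)

/-- The point is visited by the path. -/
def OnPath (ξ : ℕ × ℕ → ℕ × ℕ) (x : Fin (e + 3) → ℤ) : Prop := x = pathPoint ξ (x 0).toNat

instance (ξ : ℕ × ℕ → ℕ × ℕ) (x : Fin (e + 3) → ℤ) : Decidable (OnPath ξ x) := by
  unfold OnPath; infer_instance

theorem onPath_pathPoint (ξ : ℕ × ℕ → ℕ × ℕ) (t : ℕ) :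
    OnPath ξ (pathPoint ξ t : Fin (e + 3) → ℤ) := by
  rw [OnPath, pathPoint_apply_zero]; rfl

/-- The displacement of `x` to the next point of the path, for `x` on the path. -/
noncomputable def pathShift (ξ : ℕ × ℕ → ℕ × ℕ) (x : Fin (e + 3) → ℤ) :
    EuclideanSpace ℝ (Fin (e + 3)) :=
  if OnPath ξ x then latticePoint (pathPoint ξ ((x 0).toNat + 1) - x) else 0

/-- Moving every point of the path to the next one is a bijection of `ℤ^d` onto `ℤ^d \ {0}`. -/
theorem exists_equiv_pathShift (ξ : ℕ × ℕ → ℕ × ℕ) :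
    ∃ φ : ↥(∅ : Set (Fin (e + 3) → ℤ))ᶜ ≃ ↥({0} : Set (Fin (e + 3) → ℤ))ᶜ,
      ∀ x : ↥(∅ : Set (Fin (e + 3) → ℤ))ᶜ,
        latticePoint (x : Fin (e + 3) → ℤ) + pathShift ξ x =
          latticePoint (φ x : Fin (e + 3) → ℤ) + (0 : (Fin (e + 3) → ℤ) → _) (φ x) := by
  let f : (Fin (e + 3) → ℤ) → (Fin (e + 3) → ℤ) := fun x =>
    if OnPath ξ x then pathPoint ξ ((x 0).toNat + 1) else x
  have hf1 : ∀ x, OnPath ξ x → f x = pathPoint ξ ((x 0).toNat + 1) := fun x hx => if_pos hx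
  have hf2 : ∀ x, ¬OnPath ξ x → f x = x := fun x hx => if_neg hx
  have hf0 : ∀ x, f x ∈ ({0} : Set (Fin (e + 3) → ℤ))ᶜ := by
    intro x hx
    rw [Set.mem_singleton_iff] at hx
    by_cases h : OnPath ξ x
    · rw [hf1 x h] at hx
      have := congrFun hx 0
      rw [pathPoint_apply_zero, Pi.zero_apply] at this
      omega
    · rw [hf2 x h] at hx
      exact h (by rw [hx, ← pathPoint_zero ξ]; exact onPath_pathPoint ξ 0)
  have hmix : ∀ x x', OnPath ξ x → ¬OnPath ξ x' → f x ≠ f x' := by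
    intro x x' hx hx' h
    rw [hf1 x hx, hf2 x' hx'] at h
    exact hx' (h ▸ onPath_pathPoint ξ _)
  have hinj : Function.Injective f := by
    intro x x' h
    by_cases hx : OnPath ξ x <;> by_cases hx' : OnPath ξ x'
    · rw [hf1 x hx, hf1 x' hx'] at h
      have h0 := congrFun h 0
      rw [pathPoint_apply_zero, pathPoint_apply_zero] at h0
      have h1 : (x 0).toNat = (x' 0).toNat := by omega
      rw [OnPath] at hx hx'
      rw [hx, hx', h1]
    · exact absurd h (hmix x x' hx hx')
    · exact absurd h.symm (hmix x' x hx' hx)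
    · rwa [hf2 x hx, hf2 x' hx'] at h
  have hsurj : ∀ z, z ≠ 0 → ∃ x, f x = z := by
    intro z hz
    by_cases h : OnPath ξ z
    · obtain ⟨k, hk⟩ | hk : (∃ k, (z 0).toNat = k + 1) ∨ (z 0).toNat = 0 := by
        rcases hzz : (z 0).toNat with _ | k
        · exact Or.inr rfl
        · exact Or.inl ⟨k, rfl⟩
      · refine ⟨pathPoint ξ k, ?_⟩
        rw [hf1 _ (onPath_pathPoint ξ k), pathPoint_apply_zero, Int.toNat_natCast, ← hk]
        exact h.symm
      · rw [OnPath, hk, pathPoint_zero] at h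
        exact absurd h hz
    · exact ⟨z, hf2 z h⟩
  refine ⟨Equiv.ofBijective (fun x => ⟨f x, hf0 x⟩) ⟨fun x x' h => ?_, fun z => ?_⟩, fun x => ?_⟩
  · exact Subtype.ext (hinj (congrArg Subtype.val h))
  · obtain ⟨x, hx⟩ := hsurj z z.2
    exact ⟨⟨x, Set.notMem_empty x⟩, Subtype.ext hx⟩
  · change latticePoint (x : Fin (e + 3) → ℤ) + pathShift ξ x = latticePoint (f x) + 0
    rw [add_zero]
    by_cases h : OnPath ξ (x : Fin (e + 3) → ℤ)
    · simp only [pathShift, h, if_true, hf1 _ h, latticePoint_sub]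
      abel
    · simp only [pathShift, h, if_false, hf2 _ h, add_zero]

theorem lateral_succ (ξ : ℕ × ℕ → ℕ × ℕ) (t : ℕ) :
    lateral ξ (t + 1) = lateral ξ t + lateralStep ξ t := Finset.sum_range_succ _ _

/-- Every coordinate of a step of the path is `0` or `1`. -/
theorem norm_pathShift_sq_le (ξ : ℕ × ℕ → ℕ × ℕ) (x : Fin (e + 3) → ℤ) :
    ‖pathShift ξ x‖ ^ 2 ≤ e + 3 := by
  unfold pathShift
  split_ifs with h
  · rw [EuclideanSpace.real_norm_sq_eq]
    have h1 : ∀ i : Fin (e + 3),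
        latticePoint (pathPoint ξ ((x 0).toNat + 1) - x) i ^ 2 ≤ 1 := by
      intro i
      rw [latticePoint_apply, sq_le_one_iff_abs_le_one]
      rw [OnPath] at h
      generalize (x 0).toNat = t at h
      subst h
      have h2 : (lateralStep ξ t).1 ≤ 1 := by unfold lateralStep; dsimp only; split_ifs <;> simp
      have h3 : (lateralStep ξ t).2 ≤ 1 := by unfold lateralStep; dsimp only; split_ifs <;> simp
      have h4 : |(pathPoint ξ (t + 1) - pathPoint ξ t : Fin (e + 3) → ℤ) i| ≤ 1 := by
        rw [Pi.sub_apply]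
        simp only [pathPoint, lateral_succ, Prod.fst_add, Prod.snd_add]
        split_ifs
        · simp
        · push_cast; rw [add_sub_cancel_left, abs_le]; omega
        · push_cast; rw [add_sub_cancel_left, abs_le]; omega
        · simp
      have h5 := (Int.cast_le (R := ℝ)).2 h4
      rwa [Int.cast_abs, Int.cast_one] at h5
    refine (Finset.sum_le_sum fun i _ => h1 i).trans ?_
    simp
  · rw [norm_zero, zero_pow two_ne_zero]; positivity

theorem inner_pathShift_le (ξ ξ' : ℕ × ℕ → ℕ × ℕ) (x : Fin (e + 3) → ℤ) :
    inner ℝ (pathShift ξ x) (pathShift ξ' x) ≤ e + 3 := by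
  have h1 := real_inner_le_norm (pathShift ξ x) (pathShift ξ' x)
  have h2 := norm_pathShift_sq_le ξ x
  have h3 := norm_pathShift_sq_le ξ' x
  nlinarith [sq_nonneg (‖pathShift ξ x‖ - ‖pathShift ξ' x‖)]

theorem measurable_pathPoint (t : ℕ) :
    Measurable (fun ξ => (pathPoint ξ t : Fin (e + 3) → ℤ)) :=
  (Measurable.of_discrete (f := fun v : ℕ × ℕ => (fun i => if i = 0 then (t : ℤ) else
    if i = 1 then (v.1 : ℤ) else if i = 2 then (v.2 : ℤ) else 0 : Fin (e + 3) → ℤ))).comp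
    (measurable_lateral t)

theorem measurable_pathShift (x : Fin (e + 3) → ℤ) : Measurable (fun ξ => pathShift ξ x) := by
  have := (Measurable.of_discrete (f := fun v : (Fin (e + 3) → ℤ) × (Fin (e + 3) → ℤ) =>
    if x = v.1 then latticePoint (v.2 - x) else 0)).comp
    ((measurable_pathPoint (x 0).toNat).prodMk (measurable_pathPoint ((x 0).toNat + 1)))
  convert this using 2 with ξ
  simp only [pathShift, OnPath, Function.comp_apply]

/-- A site contributes only if both paths visit it. The coordinate `0` is the time of the visit, so
such sites inject into the times at which the lateral positions agree. -/
theorem prod_exp_inner_pathShift_le {σ : ℝ} (J : Finset (Fin (e + 3) → ℤ)) {n : ℕ}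
    (hJ : ∀ x ∈ J, (x 0).toNat ≤ n) {θ : ℝ≥0∞}
    (hθ : ENNReal.ofReal (Real.exp ((e + 3) / σ ^ 2)) ≤ 1 + θ) (ξ ξ' : ℕ × ℕ → ℕ × ℕ) :
    ∏ x ∈ J, ENNReal.ofReal (Real.exp (inner ℝ (pathShift ξ x) (pathShift ξ' x) / σ ^ 2)) ≤
      ∏ k ∈ Finset.range (n + 1), (1 + θ * atPlace k (lateral ξ' k) ξ) := by
  have h1 : ∀ x : Fin (e + 3) → ℤ, ENNReal.ofReal
      (Real.exp (inner ℝ (pathShift ξ x) (pathShift ξ' x) / σ ^ 2)) ≤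
      if OnPath ξ x ∧ OnPath ξ' x then 1 + θ else 1 := by
    intro x
    split_ifs with h
    · refine le_trans (ENNReal.ofReal_le_ofReal (Real.exp_le_exp.2 ?_)) hθ
      gcongr
      exact inner_pathShift_le ξ ξ' x
    · rcases not_and_or.1 h with h | h <;> simp [pathShift, h]
  have h2 : ∀ k, 1 + θ * atPlace k (lateral ξ' k) ξ =
      if lateral ξ k = lateral ξ' k then 1 + θ else 1 := by
    intro k
    rw [atPlace]
    split_ifs <;> simp
  refine (Finset.prod_le_prod' fun x _ => h1 x).trans ?_
  simp only [h2]
  rw [← Finset.prod_filter, ← Finset.prod_filter, Finset.prod_const, Finset.prod_const]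
  refine pow_le_pow_right₀ le_self_add ?_
  refine Finset.card_le_card_of_injOn (fun x => (x 0).toNat) (fun x hx => ?_) ?_
  · obtain ⟨hxJ, hx1, hx2⟩ := Finset.mem_filter.1 hx
    refine Finset.mem_coe.2 (Finset.mem_filter.2 ⟨Finset.mem_range.2 ?_, ?_⟩)
    · exact Nat.lt_succ_of_le (hJ x hxJ)
    · exact lateral_eq_of_pathPoint_eq (e := e) (hx1.symm.trans hx2)
  · intro x hx x' hx' h
    have hx1 := (Finset.mem_filter.1 hx).2.1
    have hx2 := (Finset.mem_filter.1 hx').2.1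
    rw [OnPath] at hx1 hx2
    rw [hx1, hx2]
    exact congrArg _ h

end Shift

/-! ### Absolute continuity from bounds on cylinders -/

section Continuity

theorem absolutelyContinuous_of_forall_cylinder {I X : Type*} [MeasurableSpace X]
    (μ ν : Measure (I → X)) [IsFiniteMeasure μ] [IsFiniteMeasure ν] {K : ℝ≥0∞} (hK : K ≠ ⊤)
    (h : ∀ ε : NNReal, 0 < ε → ∀ t ∈ measurableCylinders (fun _ : I => X),
      ν t ≤ ε * K + (ε : ℝ≥0∞)⁻¹ * μ t) : ν ≪ μ := by
  refine Measure.AbsolutelyContinuous.mk fun D hD hD0 => ?_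
  have key : ∀ ε : NNReal, 0 < ε → ν D ≤ ε * (K + 1 + ε) := by
    intro ε hε
    have hε' : (ε : ℝ≥0∞) ≠ 0 := by simpa using hε.ne'
    -- The cylinder is chosen within `ε²`, so that the factor `ε⁻¹` in front of `μ t` still leaves a
    -- bound of order `ε`.
    obtain ⟨t, ht, htD⟩ := exists_measure_symmDiff_lt_of_generateFrom_isSetRing (μ := μ + ν)
      (isSetRing_measurableCylinders (α := fun _ : I => X))
      ⟨{Set.univ}, Set.countable_singleton _, by
        rw [Set.singleton_subset_iff]; exact univ_mem_measurableCylinders _, by simp⟩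
      (generateFrom_measurableCylinders (α := fun _ : I => X)).symm hD
      (ε := (ε : ℝ≥0∞) ^ 2) (pos_iff_ne_zero.2 (pow_ne_zero 2 hε'))
    rw [Measure.add_apply] at htD
    have h1 : μ (symmDiff t D) ≤ (ε : ℝ≥0∞) ^ 2 := le_self_add.trans htD.le
    have h2 : ν (symmDiff t D) ≤ (ε : ℝ≥0∞) ^ 2 := le_add_self.trans htD.le
    have h3 : μ t ≤ (ε : ℝ≥0∞) ^ 2 := by
      calc μ t ≤ μ (D ∪ symmDiff t D) := measure_mono fun a ha => by
            by_cases haD : a ∈ D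
            · exact Or.inl haD
            · exact Or.inr (Or.inl ⟨ha, haD⟩)
        _ ≤ μ D + μ (symmDiff t D) := measure_union_le _ _
        _ ≤ (ε : ℝ≥0∞) ^ 2 := by rw [hD0, zero_add]; exact h1
    calc ν D ≤ ν (t ∪ symmDiff t D) := measure_mono fun a ha => by
          by_cases hat : a ∈ t
          · exact Or.inl hat
          · exact Or.inr (Or.inr ⟨ha, hat⟩)
      _ ≤ ν t + ν (symmDiff t D) := measure_union_le _ _
      _ ≤ (ε * K + (ε : ℝ≥0∞)⁻¹ * (ε : ℝ≥0∞) ^ 2) + (ε : ℝ≥0∞) ^ 2 := by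
          gcongr
          exact (h ε hε t ht).trans (by gcongr)
      _ = ε * (K + 1 + ε) := by
          rw [pow_two, ← mul_assoc, ENNReal.inv_mul_cancel hε' ENNReal.coe_ne_top]
          ring
  have hlim : Filter.Tendsto (fun n : ℕ => ((n + 1 : ℝ≥0∞)⁻¹) * (K + 1 + 1)) Filter.atTop
      (nhds (0 * (K + 1 + 1))) := by
    refine ENNReal.Tendsto.mul_const ?_ (Or.inr (by finiteness))
    have := ENNReal.tendsto_inv_nat_nhds_zero.comp (Filter.tendsto_add_atTop_nat 1)
    simpa [Function.comp_def] using this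
  rw [zero_mul] at hlim
  refine le_antisymm (ge_of_tendsto' hlim fun n => ?_) zero_le
  have hn := key ((n + 1 : NNReal)⁻¹) (by positivity)
  have hc : (((n + 1 : NNReal)⁻¹ : NNReal) : ℝ≥0∞) = (n + 1 : ℝ≥0∞)⁻¹ := by
    rw [ENNReal.coe_inv (by positivity)]; push_cast; rfl
  rw [hc] at hn
  refine hn.trans ?_
  gcongr
  rw [ENNReal.inv_le_one]
  exact le_add_self

end Continuity

/-! ### Second moments of mixed densities -/

section SecondMoment

variable {A B : Type*} [MeasurableSpace A] [MeasurableSpace B]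

theorem lintegral_lintegral_mul_self (Q : Measure A) [SFinite Q] (m : Measure B) [SFinite m]
    {G : A → B → ℝ≥0∞} (hG : Measurable (Function.uncurry G)) :
    ∫⁻ y, (∫⁻ ξ, G ξ y ∂Q) * ∫⁻ ξ, G ξ y ∂Q ∂m =
      ∫⁻ ξ', ∫⁻ ξ, ∫⁻ y, G ξ y * G ξ' y ∂m ∂Q ∂Q := by
  have hG1 : ∀ y, Measurable fun ξ => G ξ y := fun y =>
    hG.comp (f := fun ξ => (ξ, y)) (by fun_prop)
  have h4 : ∀ y, (∫⁻ ξ, G ξ y ∂Q) * ∫⁻ ξ, G ξ y ∂Q = ∫⁻ ξ', ∫⁻ ξ, G ξ y * G ξ' y ∂Q ∂Q := by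
    intro y
    simp only [lintegral_mul_const _ (hG1 y)]
    rw [lintegral_const_mul _ (hG1 y)]
  have hGG : Measurable fun q : B × A × A => G q.2.2 q.1 * G q.2.1 q.1 :=
    (hG.comp (f := fun q : B × A × A => (q.2.2, q.1)) (by fun_prop)).mul
      (hG.comp (f := fun q : B × A × A => (q.2.1, q.1)) (by fun_prop))
  have hGG' : ∀ ξ', Measurable fun q : B × A => G q.2 q.1 * G ξ' q.1 := fun ξ' =>
    hGG.comp (f := fun q : B × A => (q.1, ξ', q.2)) (by fun_prop)
  have hGi : Measurable fun q : B × A => ∫⁻ ξ, G ξ q.1 * G q.2 q.1 ∂Q :=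
    Measurable.lintegral_prod_right' (f := fun r : (B × A) × A => G r.2 r.1.1 * G r.1.2 r.1.1)
      (hGG.comp (f := fun r : (B × A) × A => (r.1.1, r.1.2, r.2)) (by fun_prop))
  simp only [h4]
  rw [lintegral_lintegral_swap hGi.aemeasurable]
  refine lintegral_congr fun ξ' => ?_
  rw [lintegral_lintegral_swap (hGG' ξ').aemeasurable]

/-- Pointwise `a ≤ ε * a² + ε⁻¹`. A bound of this form on every cylinder replaces a martingale limit
of the densities. -/
theorem setLIntegral_le_of_lintegral_mul_self_le (m : Measure B) {F : B → ℝ≥0∞}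
    (hF : Measurable F) {K : ℝ≥0∞} (hK : ∫⁻ y, F y * F y ∂m ≤ K) {ε : NNReal} (hε : 0 < ε)
    (C : Set B) : ∫⁻ y in C, F y ∂m ≤ ε * K + (ε : ℝ≥0∞)⁻¹ * m C := by
  have hε' : (ε : ℝ≥0∞) ≠ 0 := by simpa using hε.ne'
  have h6 : ∀ a : ℝ≥0∞, a ≤ ε * (a * a) + (ε : ℝ≥0∞)⁻¹ := by
    intro a
    rcases le_total a (ε : ℝ≥0∞)⁻¹ with h | h
    · exact h.trans le_add_self
    · refine le_trans ?_ le_self_add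
      calc a = ε * ((ε : ℝ≥0∞)⁻¹ * a) := by
            rw [← mul_assoc, ENNReal.mul_inv_cancel hε' ENNReal.coe_ne_top, one_mul]
        _ ≤ ε * (a * a) := by gcongr
  calc ∫⁻ y in C, F y ∂m ≤ ∫⁻ y in C, (ε * (F y * F y) + (ε : ℝ≥0∞)⁻¹) ∂m :=
        lintegral_mono fun y => h6 (F y)
    _ = ∫⁻ y in C, ε * (F y * F y) ∂m + (ε : ℝ≥0∞)⁻¹ * m C := by
        rw [lintegral_add_right _ measurable_const, setLIntegral_const]
    _ ≤ ∫⁻ y, ε * (F y * F y) ∂m + (ε : ℝ≥0∞)⁻¹ * m C := by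
        gcongr
        exact Measure.restrict_le_self
    _ ≤ ε * K + (ε : ℝ≥0∞)⁻¹ * m C := by
        rw [lintegral_const_mul _ (f := fun y => F y * F y) (hF.mul hF)]
        gcongr

end SecondMoment

/-! ### Failure of singularity for large noise -/

section LargeNoise

variable {e : ℕ} {σ : ℝ}

theorem displacementLaw_add_mem_cylinder {d : ℕ} (hσ : 0 < σ)
    (s : (Fin d → ℤ) → EuclideanSpace ℝ (Fin d)) (J : Finset (Fin d → ℤ))
    {S : Set (J → EuclideanSpace ℝ (Fin d))} (hS : MeasurableSet S) :
    displacementLaw d σ {y | s + y ∈ cylinder J S} =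
      ∫⁻ y in cylinder J S, ∏ x ∈ J, shiftDensity σ (s x) (y x) ∂displacementLaw d σ := by
  classical
  have := Fact.mk hσ
  have hC : MeasurableSet (cylinder J S) := MeasurableSet.preimage hS
    (Finset.measurable_restrict (X := fun _ => EuclideanSpace ℝ (Fin d)) J)
  -- The shift is cut off outside `J`, where the cylinder does not see it; only finitely many
  -- factors then change.
  set s' : (Fin d → ℤ) → EuclideanSpace ℝ (Fin d) := fun x => if x ∈ J then s x else 0 with hs'
  have h1 : {y | s + y ∈ cylinder J S} = (fun y x => s' x + y x) ⁻¹' cylinder J S := by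
    ext y
    simp only [Set.mem_ofPred_eq, Set.mem_preimage, mem_cylinder]
    have : J.restrict (s + y) = J.restrict fun x => s' x + y x := by
      funext x
      simp [hs']
    rw [this]
  have h2 : (displacementLaw d σ).map (fun y x => s' x + y x) =
      (displacementLaw d σ).withDensity (fun y => ∏ x ∈ J, shiftDensity σ (s' x) (y x)) := by
    have h3 := Measure.infinitePi_map_pi (fun _ : Fin d → ℤ => siteGaussian d σ)
      (f := fun x z => s' x + z) (by fun_prop)
    simp only [map_const_add_siteGaussian hσ] at h3
    rw [displacementLaw, h3]
    refine infinitePi_withDensity _ _ (fun x => measurable_shiftDensity _) J fun x hx => ?_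
    simp only [hs', hx, if_false]
    exact shiftDensity_zero
  rw [h1, ← Measure.map_apply (measurable_pi_lambda _ fun x => by fun_prop) hC, h2,
    withDensity_apply _ hC]
  refine lintegral_congr fun y => Finset.prod_congr rfl fun x hx => ?_
  simp only [hs', hx, if_true]

/-- The law of the displacements when the points on a random path are moved one step ahead. -/
noncomputable def shiftedLaw (e : ℕ) (σ : ℝ) :
    Measure ((Fin (e + 3) → ℤ) → EuclideanSpace ℝ (Fin (e + 3))) :=
  (pathLaw.prod (displacementLaw (e + 3) σ)).map (fun p => pathShift p.1 + p.2)

theorem measurable_pathShift_add : Measurable (fun p : (ℕ × ℕ → ℕ × ℕ) ×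
    ((Fin (e + 3) → ℤ) → EuclideanSpace ℝ (Fin (e + 3))) => pathShift p.1 + p.2) :=
  measurable_pi_lambda _ fun x => ((measurable_pathShift x).comp measurable_fst).add
    ((measurable_pi_apply x).comp measurable_snd)

instance : IsProbabilityMeasure (shiftedLaw e σ) :=
  Measure.isProbabilityMeasure_map measurable_pathShift_add.aemeasurable

/-- For every fixed path the shift is a relabelling of `Π_{0}` by all of `ℤ^d`, so the law does not
depend on the path and averaging changes nothing. -/
theorem map_labelConfig_shiftedLaw :
    (shiftedLaw e σ).map (labelConfig ∅) = latticeLaw σ {0} := by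
  ext C hC
  have hm := measurable_labelConfig (d := e + 3) ∅
  rw [shiftedLaw, Measure.map_map hm measurable_pathShift_add,
    Measure.map_apply (hm.comp measurable_pathShift_add) hC,
    Measure.prod_apply ((hm.comp measurable_pathShift_add) hC)]
  have h1 : ∀ ξ : ℕ × ℕ → ℕ × ℕ, displacementLaw (e + 3) σ (Prod.mk ξ ⁻¹'
      ((labelConfig ∅ ∘ fun p : (ℕ × ℕ → ℕ × ℕ) ×
        ((Fin (e + 3) → ℤ) → EuclideanSpace ℝ (Fin (e + 3))) => pathShift p.1 + p.2) ⁻¹' C)) =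
      latticeLaw σ {0} C := by
    intro ξ
    obtain ⟨φ, hφ⟩ := exists_equiv_pathShift (e := e) ξ
    have h2 := map_labelConfig_eq_of_equiv (σ := σ) φ hφ
    simp only [zero_add] at h2
    rw [latticeLaw, h2.symm, Measure.map_apply _ hC]
    · rfl
    · exact hm.comp (by fun_prop)
  simp only [h1, lintegral_const, measure_univ, mul_one]

/-- The density of the law of the displacements in `J` shifted along the path. -/
noncomputable def pathDensity (σ : ℝ) (J : Finset (Fin (e + 3) → ℤ)) (ξ : ℕ × ℕ → ℕ × ℕ)
    (y : (Fin (e + 3) → ℤ) → EuclideanSpace ℝ (Fin (e + 3))) : ℝ≥0∞ :=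
  ∏ x ∈ J, shiftDensity σ (pathShift ξ x) (y x)

theorem measurable_uncurry_pathDensity (J : Finset (Fin (e + 3) → ℤ)) :
    Measurable (Function.uncurry (pathDensity σ J)) := by
  have h : ∀ x : Fin (e + 3) → ℤ, Measurable fun p : (ℕ × ℕ → ℕ × ℕ) ×
      ((Fin (e + 3) → ℤ) → EuclideanSpace ℝ (Fin (e + 3))) =>
      shiftDensity σ (pathShift p.1 x) (p.2 x) := fun x =>
    (measurable_uncurry_shiftDensity (d := e + 3) (σ := σ)).comp
      (f := fun p : (ℕ × ℕ → ℕ × ℕ) × ((Fin (e + 3) → ℤ) → EuclideanSpace ℝ (Fin (e + 3))) =>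
        (pathShift p.1 x, p.2 x))
      (Measurable.prodMk ((measurable_pathShift x).comp measurable_fst) (by fun_prop))
  exact Finset.measurable_fun_prod J fun x _ => h x

theorem lintegral_pathDensity_mul_le (hσ : 0 < σ) (J : Finset (Fin (e + 3) → ℤ)) {n : ℕ}
    (hJ : ∀ x ∈ J, (x 0).toNat ≤ n) {θ : ℝ≥0∞}
    (hθ : ENNReal.ofReal (Real.exp ((e + 3) / σ ^ 2)) ≤ 1 + θ) (ξ ξ' : ℕ × ℕ → ℕ × ℕ) :
    ∫⁻ y, pathDensity σ J ξ y * pathDensity σ J ξ' y ∂displacementLaw (e + 3) σ ≤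
      ∏ k ∈ Finset.range (n + 1), (1 + θ * atPlace k (lateral ξ' k) ξ) := by
  have := Fact.mk hσ
  have hxm : ∀ x, Measurable fun z : EuclideanSpace ℝ (Fin (e + 3)) =>
      shiftDensity σ (pathShift ξ x) z * shiftDensity σ (pathShift ξ' x) z := fun x =>
    (measurable_shiftDensity _).mul (measurable_shiftDensity _)
  simp only [pathDensity, ← Finset.prod_mul_distrib]
  rw [lintegral_prod_eq_prod_lintegral_of_indepFun (μ := displacementLaw (e + 3) σ) J
    (fun x y => shiftDensity σ (pathShift ξ x) (y x) * shiftDensity σ (pathShift ξ' x) (y x))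
    (iIndepFun_infinitePi (P := fun _ : Fin (e + 3) → ℤ => siteGaussian (e + 3) σ) hxm)
    (fun x => (hxm x).comp (measurable_pi_apply x))]
  refine le_trans (le_of_eq (Finset.prod_congr rfl fun x _ => ?_))
    (prod_exp_inner_pathShift_le J hJ hθ ξ ξ')
  rw [← lintegral_shiftDensity_mul hσ]
  exact (measurePreserving_eval_displacementLaw x).lintegral_comp (hxm x)

/-- The squared mixed density is an average over two independent paths; their correlation is
controlled by their meetings, with a bound that does not depend on `J`. -/
theorem shiftedLaw_cylinder_le (hσ : 0 < σ) {θ : ℝ≥0∞}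
    (hθ : ENNReal.ofReal (Real.exp ((e + 3) / σ ^ 2)) ≤ 1 + θ)
    (hθK : θ * ∑' g, gapBound g ≤ 2⁻¹) {ε : NNReal} (hε : 0 < ε)
    {t : Set ((Fin (e + 3) → ℤ) → EuclideanSpace ℝ (Fin (e + 3)))}
    (ht : t ∈ measurableCylinders (fun _ : Fin (e + 3) → ℤ => EuclideanSpace ℝ (Fin (e + 3)))) :
    shiftedLaw e σ t ≤ ε * ((1 + θ) * 2) + (ε : ℝ≥0∞)⁻¹ * displacementLaw (e + 3) σ t := by
  obtain ⟨J, S, hS, rfl⟩ := (mem_measurableCylinders t).1 ht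
  have hC : MeasurableSet (cylinder J S) := MeasurableSet.preimage hS
    (Finset.measurable_restrict (X := fun _ => EuclideanSpace ℝ (Fin (e + 3))) J)
  have hGm := measurable_uncurry_pathDensity (σ := σ) J
  have h1 : shiftedLaw e σ (cylinder J S) =
      ∫⁻ y in cylinder J S, ∫⁻ ξ, pathDensity σ J ξ y ∂pathLaw ∂displacementLaw (e + 3) σ := by
    rw [shiftedLaw, Measure.map_apply measurable_pathShift_add hC,
      Measure.prod_apply (measurable_pathShift_add hC), ← lintegral_lintegral_swap hGm.aemeasurable]
    exact lintegral_congr fun ξ => displacementLaw_add_mem_cylinder hσ (pathShift ξ) J hS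
  obtain ⟨n, hn⟩ : ∃ n, ∀ x ∈ J, (x 0).toNat ≤ n :=
    ⟨J.sup fun x => (x 0).toNat, fun x hx => Finset.le_sup (f := fun x => (x 0).toNat) hx⟩
  have h3 : ∫⁻ y, (∫⁻ ξ, pathDensity σ J ξ y ∂pathLaw) * ∫⁻ ξ, pathDensity σ J ξ y ∂pathLaw
      ∂displacementLaw (e + 3) σ ≤ (1 + θ) * 2 := by
    rw [lintegral_lintegral_mul_self _ _ hGm]
    calc _ ≤ ∫⁻ ξ', ∫⁻ ξ, ∏ k ∈ Finset.range (n + 1), (1 + θ * atPlace k (lateral ξ' k) ξ)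
            ∂pathLaw ∂pathLaw := lintegral_mono fun ξ' => lintegral_mono fun ξ =>
          lintegral_pathDensity_mul_le hσ J hn hθ ξ ξ'
      _ ≤ ∫⁻ _ξ', (1 + θ) * 2 ∂pathLaw :=
          lintegral_mono fun ξ' => lintegral_prod_atPlace_le hθK (lateral ξ') n
      _ = (1 + θ) * 2 := by simp
  rw [h1]
  exact setLIntegral_le_of_lintegral_mul_self_le _ (Measurable.lintegral_prod_left' hGm) h3 hε _

theorem exists_not_mutuallySingular_latticeLaw (e : ℕ) :
    ∃ σ : ℝ, 0 < σ ∧ ¬latticeLaw σ ({0} : Set (Fin (e + 3) → ℤ)) ⟂ₘ latticeLaw σ ∅ := by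
  set K := (∑' g, gapBound g).toReal with hK
  have hK0 : 0 ≤ K := ENNReal.toReal_nonneg
  -- This makes `η * K ≤ 1 / 2`, as the renewal bound requires; `σ` is then chosen with `exp ((e +
  -- 3) / σ²) = 1 + η`.
  set η := 1 / (2 * (K + 1)) with hη
  have hη0 : 0 < η := by positivity
  have hlog : 0 < Real.log (1 + η) := Real.log_pos (by linarith)
  set σ := √((e + 3) / Real.log (1 + η)) with hσ
  have hσ0 : 0 < σ := Real.sqrt_pos.2 (by positivity)
  have hσ2 : (e + 3) / σ ^ 2 = Real.log (1 + η) := by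
    rw [hσ, Real.sq_sqrt (by positivity)]
    field_simp
  refine ⟨σ, hσ0, ?_⟩
  have hθ : ENNReal.ofReal (Real.exp ((e + 3) / σ ^ 2)) ≤ 1 + ENNReal.ofReal η := by
    rw [hσ2, Real.exp_log (by linarith), ENNReal.ofReal_add zero_le_one hη0.le,
      ENNReal.ofReal_one]
  have hθK : ENNReal.ofReal η * ∑' g, gapBound g ≤ 2⁻¹ := by
    rw [← ENNReal.ofReal_toReal tsum_gapBound_lt_top.ne, ← ENNReal.ofReal_mul hη0.le, ← hK]
    have : (2⁻¹ : ℝ≥0∞) = ENNReal.ofReal 2⁻¹ := by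
      rw [ENNReal.ofReal_inv_of_pos two_pos]; simp
    rw [this]
    refine ENNReal.ofReal_le_ofReal ?_
    rw [hη, one_div, inv_mul_le_iff₀ (by positivity)]
    linarith
  have hac : shiftedLaw e σ ≪ displacementLaw (e + 3) σ :=
    absolutelyContinuous_of_forall_cylinder _ _ (K := (1 + ENNReal.ofReal η) * 2) (by finiteness)
      fun ε hε t ht => shiftedLaw_cylinder_le hσ0 hθ hθK hε ht
  rintro ⟨C, hC, hC1, hC2⟩
  have h1 : latticeLaw σ ({0} : Set (Fin (e + 3) → ℤ)) Cᶜ = 0 := by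
    rw [← map_labelConfig_shiftedLaw, Measure.map_apply (measurable_labelConfig _) hC.compl]
    refine hac ?_
    rwa [latticeLaw_apply _ hC.compl] at hC2
  rw [prob_compl_eq_zero_iff hC, hC1] at h1
  exact zero_ne_one h1

end LargeNoise

/-! ### From deleting the origin's point to deleting an arbitrary `Π`-point -/

section Deletion

variable {d : ℕ} {σ : ℝ} {Ω : Type*} [MeasurableSpace Ω] {P : Measure Ω} [IsProbabilityMeasure P]
  {Y : (Fin d → ℤ) → Ω → EuclideanSpace ℝ (Fin d)}

theorem latticeLaw_singleton_absolutelyContinuous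
    (h : latticeLaw σ ({0} : Set (Fin d → ℤ)) ≪ latticeLaw σ ∅) (x : Fin d → ℤ) :
    latticeLaw σ {x} ≪ latticeLaw σ ∅ := by
  have h1 := h.map (PointConfig.measurable_translate (latticePoint (-x)))
  rwa [map_translate_latticeLaw (-x) {x} {0} fun x' => by simp [add_neg_eq_zero],
    map_translate_latticeLaw (-x) ∅ ∅ fun x' => by simp] at h1

theorem mutuallySingular_latticeLaw_singleton
    (h : latticeLaw σ ({0} : Set (Fin d → ℤ)) ⟂ₘ latticeLaw σ ∅) (x : Fin d → ℤ) :
    latticeLaw σ ∅ ⟂ₘ latticeLaw σ {x} := by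
  have hm := PointConfig.measurable_translate (latticePoint x)
  obtain ⟨C, hC, h1, h2⟩ := h
  rw [← map_translate_latticeLaw x {0} {x} fun x' => by simp, Measure.map_apply hm hC] at h1
  rw [← map_translate_latticeLaw x ∅ ∅ fun x' => by simp, Measure.map_apply hm hC.compl] at h2
  exact Measure.MutuallySingular.symm ⟨_, hm hC, h1, h2⟩

theorem IsIIDGaussian.ae_goodLabels (h : IsIIDGaussian P σ Y) (hd : 0 < d) (hσ : 0 < σ) :
    ∀ᵐ ω ∂P, (fun x => Y x ω) ∈ goodLabels d :=
  h.measurePreserving.quasiMeasurePreserving.ae (_root_.ae_goodLabels hd hσ)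

/-- The deleted point has some label `x`, one of countably many; as the points are distinct, erasing
it gives exactly `Π_{x}`. -/
theorem IsIIDGaussian.map_erase_absolutelyContinuous (h : IsIIDGaussian P σ Y) (hd : 0 < d)
    (hσ : 0 < σ) {Z : Ω → EuclideanSpace ℝ (Fin d)} (hZ : IsPointOf P (perturbedLattice Y) Z) :
    P.map (fun ω => (perturbedLattice Y ω).erase (Z ω)) ≪
      Measure.sum fun x : Fin d → ℤ => latticeLaw σ {x} := by
  refine Measure.AbsolutelyContinuous.mk fun C hC hC0 => ?_
  rw [Measure.map_apply (measurable_perturbedLattice_erase Y h.measurable Z hZ.1) hC]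
  have h1 : ∀ x : Fin d → ℤ, ∀ᵐ ω ∂P, perturbedLatticeWithout {x} Y ω ∉ C := by
    intro x
    have h2 := (Measure.sum_apply_eq_zero' hC).1 hC0 x
    rw [← h.map_perturbedLatticeWithout,
      Measure.map_apply (measurable_perturbedLatticeWithout _ Y h.measurable) hC] at h2
    exact measure_eq_zero_iff_ae_notMem.1 h2
  refine measure_eq_zero_iff_ae_notMem.2 ?_
  filter_upwards [ae_all_iff.2 h1, hZ.2, h.ae_goodLabels hd hσ] with ω hω hZω hg hmem
  obtain ⟨x, -, hx⟩ := hZω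
  refine hω x ?_
  convert (show (perturbedLattice Y ω).erase (Z ω) ∈ C from hmem) using 1
  ext p
  constructor
  · rintro ⟨x', hx', rfl⟩
    refine ⟨⟨x', Set.notMem_empty _, rfl⟩, fun hp => hx' ?_⟩
    exact hg.1 ((Set.mem_singleton_iff.1 hp).trans hx.symm)
  · rintro ⟨⟨x', -, rfl⟩, hp⟩
    refine ⟨x', fun hx' => hp ?_, rfl⟩
    rw [Set.mem_singleton_iff.1 hx', hx]
    rfl

theorem IsIIDGaussian.deletionTolerant (h : IsIIDGaussian P σ Y) (hd : 0 < d) (hσ : 0 < σ)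
    (h0 : latticeLaw σ ({0} : Set (Fin d → ℤ)) ≪ latticeLaw σ ∅) :
    DeletionTolerant P (perturbedLattice Y) := by
  intro Z hZ
  have h1 : P.map (perturbedLattice Y) = latticeLaw σ ∅ := h.map_perturbedLatticeWithout ∅
  rw [h1]
  exact (h.map_erase_absolutelyContinuous hd hσ hZ).trans
    (Measure.absolutelyContinuous_sum_left fun x => latticeLaw_singleton_absolutelyContinuous h0 x)

theorem IsIIDGaussian.deletionSingular (h : IsIIDGaussian P σ Y) (hd : 0 < d) (hσ : 0 < σ)
    (h0 : latticeLaw σ ({0} : Set (Fin d → ℤ)) ⟂ₘ latticeLaw σ ∅) :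
    DeletionSingular P (perturbedLattice Y) := by
  intro Z hZ
  have h1 : P.map (perturbedLattice Y) = latticeLaw σ ∅ := h.map_perturbedLatticeWithout ∅
  rw [h1]
  exact (Measure.MutuallySingular.sum_right.2 fun x =>
    mutuallySingular_latticeLaw_singleton h0 x).mono_ac Measure.AbsolutelyContinuous.rfl
    (h.map_erase_absolutelyContinuous hd hσ hZ)

end Deletion

/-! ### Rigidity as mutual singularity for different numbers of deleted points -/

section Rigidity

variable {d : ℕ} {σ : ℝ}

theorem IsIIDGaussian.rigid_iff {Ω : Type*} [MeasurableSpace Ω] {P : Measure Ω}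
    [IsProbabilityMeasure P] {Y : (Fin d → ℤ) → Ω → EuclideanSpace ℝ (Fin d)}
    (h : IsIIDGaussian P σ Y) :
    Rigid P (perturbedLattice Y) ↔ Rigid (displacementLaw d σ) (labelConfig ∅) := by
  refine forall_congr' fun c => forall_congr' fun r => forall_congr' fun _ =>
    exists_congr fun N => and_congr_right fun hN => ?_
  rw [← h.measurePreserving.map_eq, ae_map_iff h.measurePreserving.measurable.aemeasurable]
  · rfl
  · have hl := measurable_labelConfig (d := d) ∅
    exact measurableSet_eq_fun
      (hN.comp ((PointConfig.measurable_outside measurableSet_ball).comp hl))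
      ((PointConfig.measurable_count measurableSet_ball).comp hl)

theorem labelConfig_outside_eq {S : Set (Fin d → ℤ)} {y : (Fin d → ℤ) → EuclideanSpace ℝ (Fin d)}
    {B : Set (EuclideanSpace ℝ (Fin d))} (hS : ∀ x ∈ S, latticePoint x + y x ∈ B) :
    (labelConfig ∅ y).outside B = (labelConfig S y).outside B := by
  ext p
  constructor
  · rintro ⟨⟨x, -, rfl⟩, hp⟩
    exact ⟨⟨x, fun hx => hp (hS x hx), rfl⟩, hp⟩
  · rintro ⟨⟨x, -, rfl⟩, hp⟩
    exact ⟨⟨x, Set.notMem_empty _, rfl⟩, hp⟩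

theorem labelConfig_count_eq {S : Set (Fin d → ℤ)} {y : (Fin d → ℤ) → EuclideanSpace ℝ (Fin d)}
    (hy : Function.Injective fun x => latticePoint x + y x)
    {B : Set (EuclideanSpace ℝ (Fin d))} (hS : ∀ x ∈ S, latticePoint x + y x ∈ B) :
    (labelConfig ∅ y).count B = (labelConfig S y).count B + S.encard := by
  have h1 : (labelConfig ∅ y).pts ∩ B =
      ((labelConfig S y).pts ∩ B) ∪ (fun x => latticePoint x + y x) '' S := by
    ext p
    constructor
    · rintro ⟨⟨x, -, rfl⟩, hp⟩
      by_cases hx : x ∈ S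
      · exact Or.inr ⟨x, hx, rfl⟩
      · exact Or.inl ⟨⟨x, hx, rfl⟩, hp⟩
    · rintro (⟨⟨x, -, rfl⟩, hp⟩ | ⟨x, hx, rfl⟩)
      · exact ⟨⟨x, Set.notMem_empty _, rfl⟩, hp⟩
      · exact ⟨⟨x, Set.notMem_empty _, rfl⟩, hS x hx⟩
  rw [PointConfig.count, h1, Set.encard_union_eq, hy.encard_image]
  · rfl
  · rw [Set.disjoint_left]
    rintro _ ⟨⟨x, hx, rfl⟩, -⟩ ⟨x', hx', h⟩
    exact hx (hy h ▸ hx')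

/-- Suppose one configuration arises with `S` deleted from `y` and with `T` deleted from `y'`. In a
ball containing all deleted points, restoring them leaves the outside unchanged. Rigidity then gives
equal inside counts, and cancelling the common finite count leaves `|S| = |T|`. -/
theorem Rigid.mutuallySingular_latticeLaw (hd : 0 < d) (hσ : 0 < σ)
    (h : Rigid (displacementLaw d σ) (labelConfig ∅)) {S T : Set (Fin d → ℤ)} (hS : S.Finite)
    (hT : T.Finite) (hST : S.ncard ≠ T.ncard) : latticeLaw σ S ⟂ₘ latticeLaw σ T := by
  choose N hN hNB using fun n : ℕ => h 0 (n + 1 : ℕ) (by positivity)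
  have hl := measurable_labelConfig (d := d) ∅
  have hD : MeasurableSet {y : (Fin d → ℤ) → EuclideanSpace ℝ (Fin d) |
      ∀ n, N n ((labelConfig ∅ y).outside (Metric.ball 0 (n + 1 : ℕ))) =
        (labelConfig ∅ y).count (Metric.ball 0 (n + 1 : ℕ))} := by
    rw [Set.ofPred_forall]
    exact MeasurableSet.iInter fun n => measurableSet_eq_fun
      ((hN n).comp ((PointConfig.measurable_outside measurableSet_ball).comp hl))
      ((PointConfig.measurable_count measurableSet_ball).comp hl)
  refine mutuallySingular_latticeLaw_of_ae hd hσ hD hD (ae_all_iff.2 hNB) (ae_all_iff.2 hNB)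
    fun y hy hyg y' hy' hyg' heq => hST ?_
  have hbd : ∀ {S : Set (Fin d → ℤ)} (_ : S.Finite) (y : (Fin d → ℤ) → EuclideanSpace ℝ (Fin d)),
      ∃ n : ℕ, ∀ m : ℕ, n ≤ m → ∀ x ∈ S, latticePoint x + y x ∈ Metric.ball 0 (m + 1 : ℕ) := by
    intro S hS y
    obtain ⟨R, hR⟩ := (hS.image fun x => ‖latticePoint x + y x‖).bddAbove
    obtain ⟨n, hn⟩ := exists_nat_ge R
    refine ⟨n, fun m hm x hx => ?_⟩
    rw [mem_ball_zero_iff]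
    have h1 : ‖latticePoint x + y x‖ ≤ R := hR ⟨x, hx, rfl⟩
    have h2 : (n : ℝ) ≤ m := by exact_mod_cast hm
    push_cast
    linarith
  obtain ⟨n, hn⟩ := hbd hS y
  obtain ⟨n', hn'⟩ := hbd hT y'
  have hm := hn (max n n') (le_max_left _ _)
  have hm' := hn' (max n n') (le_max_right _ _)
  have h1 := hy (max n n')
  rw [labelConfig_outside_eq hm, heq, ← labelConfig_outside_eq hm', hy' (max n n'),
    labelConfig_count_eq hyg.1 hm, labelConfig_count_eq hyg'.1 hm', heq] at h1
  have hfin : (labelConfig T y').count (Metric.ball 0 (max n n' + 1 : ℕ)) ≠ ⊤ :=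
    Set.encard_ne_top_iff.2 (locallyFinite_labelConfig hyg' _)
  rw [Set.ncard, Set.ncard, WithTop.add_left_cancel hfin h1]

/-- The set of labels in the ball is random but takes countably many values, so the separating
events may be used for all finite sets at once, off one null set. -/
theorem rigid_of_forall_mutuallySingular (hd : 0 < d) (hσ : 0 < σ)
    (h : ∀ S T : Set (Fin d → ℤ), S.Finite → T.Finite → S.ncard ≠ T.ncard →
      latticeLaw σ S ⟂ₘ latticeLaw σ T) : Rigid (displacementLaw d σ) (labelConfig ∅) := by
  intro c r hr
  have hex : ∀ S T : Finset (Fin d → ℤ), ∃ E : Set (PointConfig d), MeasurableSet E ∧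
      (S.card ≠ T.card → (∀ᵐ y ∂displacementLaw d σ, labelConfig S y ∈ E) ∧
        ∀ᵐ y ∂displacementLaw d σ, labelConfig T y ∉ E) := by
    intro S T
    by_cases hc : S.card = T.card
    · exact ⟨Set.univ, MeasurableSet.univ, fun h => absurd hc h⟩
    · obtain ⟨C, hC, h1, h2⟩ := h S T S.finite_toSet T.finite_toSet (by simpa using hc)
      rw [latticeLaw_apply _ hC] at h1
      rw [latticeLaw_apply _ hC.compl] at h2
      refine ⟨Cᶜ, hC.compl, fun _ => ⟨?_, ?_⟩⟩
      · exact measure_eq_zero_iff_ae_notMem.1 h1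
      · exact measure_eq_zero_iff_ae_notMem.1 h2
  choose E hE hES using hex
  classical
  -- `F S` contains `Π_S` almost surely, but almost surely no `Π_T` with a different number of
  -- deleted points.
  let F : Finset (Fin d → ℤ) → Set (PointConfig d) := fun S => ⋂ (T) (_ : S.card ≠ T.card), E S T
  have hF : ∀ S, MeasurableSet (F S) := fun S =>
    MeasurableSet.iInter fun T => MeasurableSet.iInter fun _ => hE S T
  have : BorelSpace ℕ∞ := ⟨by rw [borel_eq_top_of_countable]; rfl⟩
  -- All sets `S` with `A ∈ F S` almost surely have the right cardinality, so the supremum is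
  -- attained; the value `0` of the others does not matter.
  refine ⟨fun A => ⨆ S, if A ∈ F S then (S.card : ℕ∞) else 0,
    Measurable.iSup fun S => Measurable.ite (hF S) measurable_const measurable_const, ?_⟩
  have h1 : ∀ᵐ y ∂displacementLaw d σ, ∀ S T : Finset (Fin d → ℤ), S.card ≠ T.card →
      labelConfig S y ∈ E S T ∧ labelConfig T y ∉ E S T := by
    simp only [ae_all_iff]
    intro S T hc
    exact (hES S T hc).1.and (hES S T hc).2
  filter_upwards [h1, ae_goodLabels hd hσ] with y hy hyg
  have hfin : {x | latticePoint x + y x ∈ Metric.ball c r}.Finite := by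
    obtain ⟨n, hn⟩ := exists_nat_ge (r + dist c 0)
    exact (hyg.2 n).subset fun x hx => Metric.ball_subset_ball' hn hx
  set S := hfin.toFinset with hS
  have hmem : ∀ x, x ∈ S ↔ latticePoint x + y x ∈ Metric.ball c r := fun x => by simp [hS]
  have hSB : ∀ x ∈ (S : Set (Fin d → ℤ)), latticePoint x + y x ∈ Metric.ball c r := fun x hx =>
    (hmem x).1 hx
  have hdisj : ∀ p ∈ (labelConfig (S : Set (Fin d → ℤ)) y).pts, p ∉ Metric.ball c r := by
    rintro _ ⟨x, hx, rfl⟩ hp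
    exact hx ((hmem x).2 hp)
  have hout : (labelConfig ∅ y).outside (Metric.ball c r) = labelConfig S y := by
    rw [labelConfig_outside_eq hSB]
    ext p
    exact ⟨fun hp => hp.1, fun hp => ⟨hp, hdisj p hp⟩⟩
  have hcount : (labelConfig ∅ y).count (Metric.ball c r) = S.card := by
    rw [labelConfig_count_eq hyg.1 hSB, PointConfig.count,
      (Set.disjoint_left.2 hdisj).inter_eq, Set.encard_empty, zero_add,
      Set.encard_coe_eq_coe_finsetCard]
  rw [hout, hcount]
  refine le_antisymm (iSup_le fun S' => ?_) (le_iSup_of_le S ?_)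
  · split_ifs with hS'
    · by_cases hc : S'.card = S.card
      · rw [hc]
      · exact absurd (Set.mem_iInter₂.1 hS' S hc) (hy S' S hc).2
    · exact zero_le
  · rw [if_pos]
    exact Set.mem_iInter₂.2 fun T hc => (hy S T hc).1

end Rigidity

/-! ### The critical values -/

theorem theorem1p2 (d : ℕ) (hd : 3 ≤ d) :
    ∃ σr σc : ℝ, 0 < σr ∧ σr ≤ σc ∧
      ∀ (Ω : Type*) [MeasurableSpace Ω] (P : Measure Ω) [IsProbabilityMeasure P]
        (σ : ℝ) (Y : (Fin d → ℤ) → Ω → EuclideanSpace ℝ (Fin d)),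
        0 < σ → IsIIDGaussian P σ Y →
          (σc < σ →
            DeletionTolerant P (perturbedLattice Y) ∧
            P.map (perturbedLattice Y) ≪ P.map (perturbedLatticeWithout {0} Y) ∧
            P.map (perturbedLatticeWithout {0} Y) ≪ P.map (perturbedLattice Y)) ∧
          (σ < σc → DeletionSingular P (perturbedLattice Y)) ∧
          (σ < σr → Rigid P (perturbedLattice Y)) ∧
          (σr < σ → ¬ Rigid P (perturbedLattice Y)) := by
  have hd0 : 0 < d := by omega
  set R : Set ℝ := {σ | 0 < σ ∧ ∀ S T : Set (Fin d → ℤ), S.Finite → T.Finite →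
    S.ncard ≠ T.ncard → latticeLaw σ S ⟂ₘ latticeLaw σ T} with hR
  set C : Set ℝ := {σ | 0 < σ ∧ latticeLaw σ ({0} : Set (Fin d → ℤ)) ⟂ₘ latticeLaw σ ∅} with hC
  have hRC : R ⊆ C := fun σ hσ =>
    ⟨hσ.1, hσ.2 _ _ (Set.finite_singleton 0) Set.finite_empty (by simp)⟩
  obtain ⟨σ₀, hσ₀, hσ₀R⟩ := exists_pos_mutuallySingular_latticeLaw hd0
  have hRmem : σ₀ ∈ R := ⟨hσ₀, hσ₀R⟩
  -- By monotonicity, one noise level without singularity bounds all those with it.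
  have hbdd : BddAbove C := by
    obtain ⟨e, rfl⟩ : ∃ e, d = e + 3 := ⟨d - 3, by omega⟩
    obtain ⟨ρ, hρ, hρC⟩ := exists_not_mutuallySingular_latticeLaw e
    exact ⟨ρ, fun σ hσ => le_of_not_gt fun h =>
      hρC (mutuallySingular_latticeLaw_of_le hd0 hρ h.le hσ.2)⟩
  refine ⟨sSup R, sSup C, hσ₀.trans_le (le_csSup (hbdd.mono hRC) hRmem),
    csSup_le_csSup hbdd ⟨σ₀, hRmem⟩ hRC, ?_⟩
  intro Ω _ P _ σ Y hσ hY
  have hmap : P.map (perturbedLattice Y) = latticeLaw σ ∅ := hY.map_perturbedLatticeWithout ∅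
  refine ⟨fun h => ?_, fun h => ?_, fun h => ?_, fun h hr => ?_⟩
  · have hns : ¬latticeLaw σ ({0} : Set (Fin d → ℤ)) ⟂ₘ latticeLaw σ ∅ := fun hs =>
      (le_csSup hbdd ⟨hσ, hs⟩).not_gt h
    -- Above the supremum singularity fails, and the dichotomy in both directions gives mutual
    -- absolute continuity.
    have h1 := (latticeLaw_absolutelyContinuous_or_mutuallySingular hd0 hσ {0} ∅).resolve_right hns
    have h2 := (latticeLaw_absolutelyContinuous_or_mutuallySingular hd0 hσ ∅ {0}).resolve_right
      fun hs => hns hs.symm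
    rw [hmap, hY.map_perturbedLatticeWithout]
    exact ⟨hY.deletionTolerant hd0 hσ h1, h2, h1⟩
  · obtain ⟨ρ, hρ, hσρ⟩ := exists_lt_of_lt_csSup ⟨σ₀, hRC hRmem⟩ h
    exact hY.deletionSingular hd0 hσ (mutuallySingular_latticeLaw_of_le hd0 hσ hσρ.le hρ.2)
  · obtain ⟨ρ, hρ, hσρ⟩ := exists_lt_of_lt_csSup ⟨σ₀, hRmem⟩ h
    exact hY.rigid_iff.2 (rigid_of_forall_mutuallySingular hd0 hσ fun S T hS hT hST =>
      mutuallySingular_latticeLaw_of_le hd0 hσ hσρ.le (hρ.2 S T hS hT hST))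
  -- Rigidity would put `σ` into `R`, and so below the supremum.
  · refine (le_csSup (hbdd.mono hRC) (show σ ∈ R from ⟨hσ, fun S T hS hT hST => ?_⟩)).not_gt h
    exact (hY.rigid_iff.1 hr).mutuallySingular_latticeLaw hd0 hσ hS hT hST
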